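/- For $N\ge 1$ let $S_N$ be the symmetric group on $\{1,\dots,N\}$ and let $\tau_x=(x,x+1)$, $1\le x\le N-1$, be the adjacent transpositions. The adjacent transposition shuffle is the continuous-time Markov chain on $S_N$ with generator $$(\mathcal L f)(\sigma)=\sum_{x=1}^{N-1}\bigl(f(\sigma\circ\tau_x)-f(\sigma)\bigr),\qquad f:S_N\to\mathbb R .$$ Let $P_t$ be its law at time $t$ when it is started from the identity, and let $\mu$ be the uniform probability measure on $S_N$. Put $$d_S^N(t)=\max_{\sigma\in S_N}\Bigl(1-\frac{P_t(\sigma)}{\mu(\sigma)}\Bigr),\qquad T^N_{\mathrm{sep}}(\varepsilon)=\inf\{t\ge 0 : d_S^N(t)\le\varepsilon\}.$$ Then for every $\varepsilon\in(0,1)$ $$\lim_{N\to\infty}\frac{\pi^2\,T^N_{\mathrm{sep}}(\varepsilon)}{N^2\log N}=1 .$$ -/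

import Mathlib

namespace ATShuffle

noncomputable section

/-- The nearest-neighbour transposition `τ_x = (x, x+1)` of the `N` positions; the positions
`1, …, N` are represented by `Fin N`, and `x` ranges over the `N - 1` adjacent pairs. -/
def tau (N : ℕ) (x : Fin (N - 1)) : Equiv.Perm (Fin N) :=
  Equiv.swap ⟨x.1, by omega⟩ ⟨x.1 + 1, by omega⟩

/-- The generator of the adjacent transposition shuffle, acting on real functions on the
symmetric group: `(ℒ f)(σ) = ∑_x (f (σ ∘ τ_x) - f σ)`. -/
def generator (N : ℕ) : (Equiv.Perm (Fin N) → ℝ) →ₗ[ℝ] (Equiv.Perm (Fin N) → ℝ) where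
  toFun f σ := ∑ x : Fin (N - 1), (f (σ * tau N x) - f σ)
  map_add' f g := by
    funext σ
    simp only [Pi.add_apply, ← Finset.sum_add_distrib]
    exact Finset.sum_congr rfl fun x _ => by ring
  map_smul' c f := by
    funext σ
    simp only [Pi.smul_apply, smul_eq_mul, RingHom.id_apply, Finset.mul_sum]
    exact Finset.sum_congr rfl fun x _ => by ring

/-- The transition matrix `p_t(σ, σ')` at time `t` of the continuous-time Markov chain on the
(finite) symmetric group with generator `ℒ`, namely the matrix exponential `exp (t ℒ)`. -/
def transition (N : ℕ) (t : ℝ) : Matrix (Equiv.Perm (Fin N)) (Equiv.Perm (Fin N)) ℝ :=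
  NormedSpace.exp (t • LinearMap.toMatrix' (generator N))

/-- `P_t`: the law at time `t` of the chain started from the identity permutation. -/
def law (N : ℕ) (t : ℝ) (σ : Equiv.Perm (Fin N)) : ℝ := transition N t 1 σ

/-- The uniform probability on the symmetric group. -/
def unif (N : ℕ) (_σ : Equiv.Perm (Fin N)) : ℝ :=
  1 / (Fintype.card (Equiv.Perm (Fin N)) : ℝ)

/-- The separation distance `max_x (1 - α x / β x)` on a finite nonempty set. -/
def sepDist {Ω : Type*} [Fintype Ω] [Nonempty Ω] (α β : Ω → ℝ) : ℝ :=
  Finset.univ.sup' Finset.univ_nonempty fun x => 1 - α x / β x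

/-- Separation distance to equilibrium at time `t`. -/
def dSep (N : ℕ) (t : ℝ) : ℝ := sepDist (law N t) (unif N)

/-- The separation mixing time `inf {t ≥ 0 | d_S(t) ≤ ε}`. -/
def Tsep (N : ℕ) (ε : ℝ) : ℝ := sInf {t : ℝ | 0 ≤ t ∧ dSep N t ≤ ε}

end

end ATShuffle

/-! Encode σ by its heights `ht σ x y`, the number of labels below y among the first x positions,
and order permutations by comparing all heights; the identity is the maximum. At a fixed level y the
heights form a lattice path, and an adjacent exchange flips a corner of it, so mean heights solve
the discrete heat equation, with relaxation rate `lam N` ~ π²/N². Mean heights start at distance of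
order N from equilibrium while fluctuations have order √N, so heights forget their start at time
T/2, where T = N² log N / π². Separation needs T, because a transition in time 2s is a pairing of
two evolutions of length s, one from each endpoint.

Upper bound. If the law at time s is close to uniform in total variation, convolving it with itself
and using ab ≥ a + b - 1 on [0,1] bounds the separation at 2s (`dSep_two_mul_le`). The density is
increasing, so increasing test functions f suffice (`Pt_incr_le`). Freezing edges only raises the
mean of f (`dotProduct_Pt_le_censored`), so during short initial and final periods the shuffle may
be confined to K blocks. This makes f almost a function of the heights at the cuts (`block_osc`);
inversion exchanges positions and labels, and doing it for both leaves a monotone function F of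
fewer than K² heights. Let W be their sum. In `Pt_heights_le`, F ≤ g + W/r with g decreasing. The
mean of g from the identity is at most its uniform mean; the excess mean of W has decayed to order
N^(1/2 - η/8); and g + W/r is dominated by F with its heights shifted by r. Such a shift costs about
r/√N (`sum_shift_heights_le`), because resampling exchanges between the first and last blocks adds
one common binomial variable to all these heights. Taking r slightly below √N finishes.

Lower bound. Let f and g indicate starts whose middle-level profile is maximal, respectively
minimal; then ⟨f, P_{2s} g⟩ = ⟨P_s f, P_s g⟩. For s slightly below T/2 the means from both starts
are still much farther than √N from equilibrium (`mul_exp_mul_sinv_le`), and the variance is at most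
N/2 (`Pt_sq_Hf_le`), so P_s f and P_s g concentrate on opposite sides of a median-like height. On
each side the increasing P_s f and the decreasing P_s g are negatively correlated, by the four
functions theorem (`card_mul_sum_le_of_incr`), so the pairing is far below its equilibrium value
(`one_sub_dSep_two_mul_le`). -/

namespace ATShuffle

noncomputable section

/-! ### One-parameter semigroups on functions over a finite set -/

section Semigroup

variable {ι κ : Type*} [Fintype ι] [Fintype κ]

/-- Operators on real functions on a finite set. -/
abbrev Op (ι : Type*) [Fintype ι] := (ι → ℝ) →L[ℝ] (ι → ℝ)

/-- The semigroup `exp (t A)`. -/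
def sg (A : Op ι) (t : ℝ) : Op ι := NormedSpace.exp (t • A)

lemma sg_zero (A : Op ι) (f : ι → ℝ) : sg A 0 f = f := by
  simp [sg, NormedSpace.exp_zero]

lemma sg_add (A : Op ι) (s t : ℝ) (f : ι → ℝ) : sg A (s + t) f = sg A s (sg A t f) := by
  let : NormedAlgebra ℚ (Op ι) := NormedAlgebra.restrictScalars ℚ ℝ (Op ι)
  have h : Commute (s • A) (t • A) := (Commute.refl A).smul_left s |>.smul_right t
  have := NormedSpace.exp_add_of_commute h
  rw [sg, add_smul, this]
  rfl

lemma hasDerivAt_sg (A : Op ι) (f : ι → ℝ) (t : ℝ) :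
    HasDerivAt (fun u => sg A u f) (A (sg A t f)) t := by
  have h := hasDerivAt_exp_smul_const' (𝕂 := ℝ) A t
  exact ((ContinuousLinearMap.apply ℝ (ι → ℝ) f).hasFDerivAt.comp_hasDerivAt t h)

lemma hasDerivAt_sg_left (A : Op ι) (f : ι → ℝ) (t : ℝ) :
    HasDerivAt (fun u => sg A u f) (sg A t (A f)) t := by
  have h := hasDerivAt_exp_smul_const (𝕂 := ℝ) A t
  exact ((ContinuousLinearMap.apply ℝ (ι → ℝ) f).hasFDerivAt.comp_hasDerivAt t h)

lemma sg_comm (A : Op ι) (f : ι → ℝ) (t : ℝ) : A (sg A t f) = sg A t (A f) :=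
  (hasDerivAt_sg A f t).unique (hasDerivAt_sg_left A f t)

/-- Product rule for `s ↦ exp ((t - s) A) (u s)`. -/
lemma hasDerivAt_sg_sub (A : Op ι) {u : ℝ → ι → ℝ} {u' : ι → ℝ} {s : ℝ} (t : ℝ)
    (hu : HasDerivAt u u' s) :
    HasDerivAt (fun r => sg A (t - r) (u r)) (sg A (t - s) (u' - A (u s))) s := by
  have h0 := hasDerivAt_exp_smul_const (𝕂 := ℝ) A (t - s)
  have h1 : HasDerivAt (fun r => sg A (t - r)) ((-1 : ℝ) • (sg A (t - s) * A)) s :=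
    HasDerivAt.scomp s h0 ((hasDerivAt_id s).const_sub t)
  have h2 := h1.clm_apply hu
  have h3 : sg A (t - s) (u' - A (u s))
      = ((-1 : ℝ) • (sg A (t - s) * A)) (u s) + sg A (t - s) u' := by
    rw [map_sub, sub_eq_add_neg, add_comm]; simp
  rw [h3]
  exact h2

/-- Since exp(tA) = e^{-tc} exp(t(A + c)) and the series of the second factor has nonnegative
coefficients, a closed convex cone stable under A + c is stable under the semigroup. It yields both
positivity and the preservation of monotone functions. -/
lemma sg_mem_cone (A : Op ι) (c : ℝ) (K : Set (ι → ℝ)) (hK : IsClosed K)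
    (h0 : (0 : ι → ℝ) ∈ K) (hadd : ∀ f ∈ K, ∀ g ∈ K, f + g ∈ K)
    (hsmul : ∀ a : ℝ, 0 ≤ a → ∀ f ∈ K, a • f ∈ K)
    (hA : ∀ f ∈ K, A f + c • f ∈ K) {t : ℝ} (ht : 0 ≤ t) {f : ι → ℝ} (hf : f ∈ K) :
    sg A t f ∈ K := by
  let : NormedAlgebra ℚ (Op ι) := NormedAlgebra.restrictScalars ℚ ℝ (Op ι)
  set B : Op ι := A + c • (1 : Op ι) with hB
  have hBK : ∀ n : ℕ, (B ^ n) f ∈ K := by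
    intro n
    induction n with
    | zero => simpa using hf
    | succ k ih =>
      rw [pow_succ']
      have := hA _ ih
      simpa [hB] using this
  have hexp : NormedSpace.exp (t • B) f ∈ K := by
    have hs := NormedSpace.exp_series_hasSum_exp' (𝕂 := ℝ) (t • B)
    have hs' := hs.mapL (ContinuousLinearMap.apply ℝ (ι → ℝ) f)
    refine hK.mem_of_tendsto hs' (Filter.Eventually.of_forall fun S => ?_)
    induction S using Finset.induction_on with
    | empty => simpa using h0
    | insert a S ha ih =>
      rw [Finset.sum_insert ha]
      refine hadd _ ?_ _ ih
      have : (ContinuousLinearMap.apply ℝ (ι → ℝ) f) (((a.factorial : ℝ))⁻¹ • (t • B) ^ a)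
          = ((a.factorial : ℝ)⁻¹ * t ^ a) • ((B ^ a) f) := by
        simp [smul_pow, mul_smul]
      rw [this]
      exact hsmul _ (by positivity) _ (hBK a)
  have hcomm : Commute (t • B) ((-(t * c)) • (1 : Op ι)) :=
    (Commute.one_right _).smul_right _
  have hsum : t • A = t • B + (-(t * c)) • (1 : Op ι) := by
    rw [hB, smul_add, smul_smul, add_assoc, ← add_smul]; simp
  have h1 : NormedSpace.exp ((-(t * c)) • (1 : Op ι)) = Real.exp (-(t * c)) • (1 : Op ι) := by
    have := NormedSpace.algebraMap_exp_comm (𝕂 := ℝ) (𝔸 := Op ι) (-(t * c))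
    rw [← Algebra.algebraMap_eq_smul_one, ← this, Algebra.algebraMap_eq_smul_one,
      Real.exp_eq_exp_ℝ]
  rw [sg, hsum, NormedSpace.exp_add_of_commute hcomm, h1]
  simpa using hsmul _ (Real.exp_pos _).le _ hexp

lemma sg_nonneg (A : Op ι) (c : ℝ) (hA : ∀ f : ι → ℝ, 0 ≤ f → 0 ≤ A f + c • f)
    {t : ℝ} (ht : 0 ≤ t) {f : ι → ℝ} (hf : 0 ≤ f) : 0 ≤ sg A t f :=
  sg_mem_cone A c (Set.Ici 0) isClosed_Ici (Set.mem_Ici.2 le_rfl)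
    (fun _ hf _ hg => Set.mem_Ici.2 (add_nonneg hf hg))
    (fun _ ha _ hf => Set.mem_Ici.2 (smul_nonneg ha hf)) hA ht hf

lemma sg_mono (A : Op ι) (c : ℝ) (hA : ∀ f : ι → ℝ, 0 ≤ f → 0 ≤ A f + c • f)
    {t : ℝ} (ht : 0 ≤ t) {f g : ι → ℝ} (hf : f ≤ g) : sg A t f ≤ sg A t g := by
  have := sg_nonneg A c hA ht (sub_nonneg.2 hf)
  rwa [map_sub, sub_nonneg] at this

/-- Supersolutions dominate the semigroup. -/
lemma sg_le_of_supersolution (A : Op ι) (c : ℝ) (hA : ∀ f : ι → ℝ, 0 ≤ f → 0 ≤ A f + c • f)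
    {t : ℝ} (ht : 0 ≤ t) {u u' : ℝ → ι → ℝ} (hu : ∀ s, HasDerivAt u (u' s) s)
    (hsup : ∀ s, 0 ≤ u' s - A (u s)) : sg A t (u 0) ≤ u t := by
  intro i
  have hd : ∀ s, HasDerivAt (fun r => sg A (t - r) (u r) i)
      (sg A (t - s) (u' s - A (u s)) i) s := fun s =>
    hasDerivAt_pi.1 (hasDerivAt_sg_sub A t (hu s)) i
  have hm : MonotoneOn (fun r => sg A (t - r) (u r) i) (Set.Icc 0 t) := by
    refine monotoneOn_of_deriv_nonneg (convex_Icc 0 t)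
      (fun s _ => (hd s).continuousAt.continuousWithinAt)
      (fun s _ => (hd s).differentiableAt.differentiableWithinAt) fun s hs => ?_
    rw [interior_Icc] at hs
    rw [(hd s).deriv]
    exact sg_nonneg A c hA (by linarith [hs.2]) (hsup s) i
  have := hm (Set.left_mem_Icc.2 ht) (Set.right_mem_Icc.2 ht) ht
  simpa [sg_zero] using this

/-- Solutions of the linear equation are given by the semigroup. -/
lemma sg_eq_of_solution (A : Op ι) {u : ℝ → ι → ℝ} (hu : ∀ s, HasDerivAt u (A (u s)) s) (t : ℝ) :
    sg A t (u 0) = u t := by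
  have hd : ∀ s, HasDerivAt (fun r => sg A (t - r) (u r)) 0 s := fun s => by
    simpa using hasDerivAt_sg_sub A t (hu s)
  have := is_const_of_deriv_eq_zero (fun s => (hd s).differentiableAt) (fun s => (hd s).deriv) 0 t
  simpa [sg_zero] using this

/-- The right side solves the linear equation of the left side, with the same initial value. It is
applied to left translations and to the reduction to a single card. -/
lemma sg_intertwine (A : Op ι) (B : Op κ) (T : (κ → ℝ) →L[ℝ] (ι → ℝ))
    (h : ∀ f, A (T f) = T (B f)) (t : ℝ) (f : κ → ℝ) : sg A t (T f) = T (sg B t f) := by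
  have hu : ∀ s, HasDerivAt (fun s => T (sg B s f)) (A (T (sg B s f))) s := fun s => by
    rw [h]; exact T.hasFDerivAt.comp_hasDerivAt s (hasDerivAt_sg B f s)
  have := sg_eq_of_solution A hu t
  simpa [sg_zero] using this

lemma sg_fixed (A : Op ι) {f : ι → ℝ} (h : A f = 0) (t : ℝ) : sg A t f = f := by
  have hu : ∀ s : ℝ, HasDerivAt (fun _ : ℝ => f) (A f) s := fun s => by
    rw [h]; exact hasDerivAt_const s f
  exact sg_eq_of_solution A hu t

lemma hasDerivAt_dotProduct {u v : ℝ → ι → ℝ} {u' v' : ι → ℝ} {s : ℝ}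
    (hu : HasDerivAt u u' s) (hv : HasDerivAt v v' s) :
    HasDerivAt (fun r => u r ⬝ᵥ v r) (u' ⬝ᵥ v s + u s ⬝ᵥ v') s := by
  simp only [dotProduct, ← Finset.sum_add_distrib]
  exact HasDerivAt.fun_sum fun i _ => (hasDerivAt_pi.1 hu i).mul (hasDerivAt_pi.1 hv i)

/-- The pairing of exp((t - r)A) f with exp(rA) g has zero derivative in r; compare r = 0 and r = t.
-/
lemma sg_symm (A : Op ι) (hA : ∀ f g : ι → ℝ, f ⬝ᵥ A g = A f ⬝ᵥ g) (t : ℝ) (f g : ι → ℝ) :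
    f ⬝ᵥ sg A t g = sg A t f ⬝ᵥ g := by
  have hd : ∀ s, HasDerivAt (fun r => sg A (t - r) f ⬝ᵥ sg A r g) 0 s := fun s => by
    have h1 := hasDerivAt_sg_sub A t (hasDerivAt_const s f)
    have h2 := hasDerivAt_dotProduct h1 (hasDerivAt_sg A g s)
    convert h2 using 1
    rw [zero_sub, map_neg, neg_dotProduct, hA, sg_comm]; simp
  have := is_const_of_deriv_eq_zero (fun s => (hd s).differentiableAt) (fun s => (hd s).deriv) 0 t
  simpa [sg_zero] using this.symm

end Semigroup

/-! ### The shuffle restricted to a set of edges -/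

/-- Right translation `f ↦ f (· * τ)`. -/
def rtrans {N : ℕ} (τ : Equiv.Perm (Fin N)) : Op (Equiv.Perm (Fin N)) :=
  ContinuousLinearMap.pi fun σ => ContinuousLinearMap.proj (σ * τ)

/-- The generator of the shuffle in which only the edges in `C` are active. -/
def gen (N : ℕ) (C : Finset (Fin (N - 1))) : Op (Equiv.Perm (Fin N)) :=
  ∑ x ∈ C, (rtrans (tau N x) - 1)

lemma gen_apply {N : ℕ} (C : Finset (Fin (N - 1))) (f : Equiv.Perm (Fin N) → ℝ)
    (σ : Equiv.Perm (Fin N)) : gen N C f σ = ∑ x ∈ C, (f (σ * tau N x) - f σ) := by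
  simp [gen, rtrans, Finset.sum_apply]

@[simp] lemma tau_mul_self {N : ℕ} (x : Fin (N - 1)) : tau N x * tau N x = 1 := by
  simp [tau]

lemma sum_mul_right {N : ℕ} (τ : Equiv.Perm (Fin N)) (f : Equiv.Perm (Fin N) → ℝ) :
    ∑ σ, f (σ * τ) = ∑ σ, f σ :=
  Equiv.sum_comp (Equiv.mulRight τ) f

lemma gen_symm {N : ℕ} (C : Finset (Fin (N - 1))) (f g : Equiv.Perm (Fin N) → ℝ) :
    f ⬝ᵥ gen N C g = gen N C f ⬝ᵥ g := by
  simp only [dotProduct, gen_apply, Finset.mul_sum, Finset.sum_mul]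
  rw [Finset.sum_comm, Finset.sum_comm (s := Finset.univ) (t := C)]
  refine Finset.sum_congr rfl fun x _ => ?_
  simp only [mul_sub, sub_mul, Finset.sum_sub_distrib]
  congr 1
  rw [← sum_mul_right (tau N x)]
  simp [mul_assoc]

lemma gen_pos {N : ℕ} (C : Finset (Fin (N - 1))) (f : Equiv.Perm (Fin N) → ℝ) (hf : 0 ≤ f) :
    0 ≤ gen N C f + (C.card : ℝ) • f := by
  intro σ
  simp only [Pi.add_apply, gen_apply, Pi.smul_apply, smul_eq_mul, Finset.sum_sub_distrib,
    Finset.sum_const, nsmul_eq_mul, sub_add_cancel, Pi.zero_apply]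
  exact Finset.sum_nonneg fun x _ => hf _

/-- The semigroup of the shuffle with active edges `C`. -/
def Pt (N : ℕ) (C : Finset (Fin (N - 1))) (t : ℝ) : Op (Equiv.Perm (Fin N)) := sg (gen N C) t

variable {N : ℕ} {C : Finset (Fin (N - 1))} {f g : Equiv.Perm (Fin N) → ℝ} {t : ℝ}

lemma Pt_mono (ht : 0 ≤ t) (h : f ≤ g) : Pt N C t f ≤ Pt N C t g :=
  sg_mono _ _ (gen_pos C) ht h

lemma Pt_const (c : ℝ) : Pt N C t (fun _ => c) = fun _ => c :=
  sg_fixed _ (by funext σ; simp [gen_apply]) t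

lemma Pt_symm (f g : Equiv.Perm (Fin N) → ℝ) : f ⬝ᵥ Pt N C t g = Pt N C t f ⬝ᵥ g :=
  sg_symm _ (gen_symm C) t f g

lemma Pt_add (s t : ℝ) : Pt N C (s + t) f = Pt N C s (Pt N C t f) := sg_add _ s t f

lemma Pt_le_const (ht : 0 ≤ t) {c : ℝ} (h : ∀ σ, f σ ≤ c) (σ : Equiv.Perm (Fin N)) :
    Pt N C t f σ ≤ c := by
  have := Pt_mono (C := C) ht (f := f) (g := fun _ => c) h σ
  rwa [Pt_const] at this

lemma const_le_Pt (ht : 0 ≤ t) {c : ℝ} (h : ∀ σ, c ≤ f σ) (σ : Equiv.Perm (Fin N)) :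
    c ≤ Pt N C t f σ := by
  have := Pt_mono (C := C) ht (g := f) (f := fun _ => c) h σ
  rwa [Pt_const] at this

lemma sum_Pt (f : Equiv.Perm (Fin N) → ℝ) : ∑ σ, Pt N C t f σ = ∑ σ, f σ := by
  have := Pt_symm (C := C) (t := t) (fun _ => (1 : ℝ)) f
  rw [Pt_const] at this
  simpa [dotProduct] using this

/-- Left translation commutes with the shuffle. -/
lemma Pt_mul_left (ρ : Equiv.Perm (Fin N)) (f : Equiv.Perm (Fin N) → ℝ) (σ : Equiv.Perm (Fin N)) :
    Pt N C t (fun σ => f (ρ * σ)) σ = Pt N C t f (ρ * σ) := by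
  let T : Op (Equiv.Perm (Fin N)) :=
    ContinuousLinearMap.pi fun σ => ContinuousLinearMap.proj (ρ * σ)
  have := sg_intertwine (gen N C) (gen N C) T
    (fun f => by funext σ; simp [T, gen_apply, mul_assoc]) t f
  exact congrFun this σ

/-- The semigroup is linear: it is the kernel with entries `Pt (Pi.single σ 1)`. -/
lemma Pt_eq_sum (f : Equiv.Perm (Fin N) → ℝ) (ρ : Equiv.Perm (Fin N)) :
    Pt N C t f ρ = ∑ σ, Pt N C t (Pi.single ρ 1) σ * f σ := by
  have := Pt_symm (C := C) (t := t) (Pi.single ρ 1) f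
  rw [single_one_dotProduct] at this
  exact this

/-- Matrices acting on vectors form an algebra map into operators, and a continuous algebra map
commutes with the exponential. -/
lemma law_eq (N : ℕ) (t : ℝ) (σ : Equiv.Perm (Fin N)) :
    law N t σ = Pt N Finset.univ t (Pi.single 1 1) σ := by
  let : NormedRing (Matrix (Equiv.Perm (Fin N)) (Equiv.Perm (Fin N)) ℝ) :=
    Matrix.linftyOpNormedRing
  let : NormedAlgebra ℝ (Matrix (Equiv.Perm (Fin N)) (Equiv.Perm (Fin N)) ℝ) :=
    Matrix.linftyOpNormedAlgebra
  let : NormedAlgebra ℚ (Matrix (Equiv.Perm (Fin N)) (Equiv.Perm (Fin N)) ℝ) :=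
    NormedAlgebra.restrictScalars ℚ ℝ _
  let : NormedAlgebra ℚ (Op (Equiv.Perm (Fin N))) := NormedAlgebra.restrictScalars ℚ ℝ _
  let F : Matrix (Equiv.Perm (Fin N)) (Equiv.Perm (Fin N)) ℝ →ₐ[ℝ] Op (Equiv.Perm (Fin N)) :=
    (Module.End.toContinuousLinearMap (Equiv.Perm (Fin N) → ℝ)).toAlgHom.comp
      (Matrix.toLinAlgEquiv' (R := ℝ)).toAlgHom
  have happ : ∀ M f, F M f = M.mulVec f := fun _ _ => rfl
  have hc : Continuous F := F.toLinearMap.continuous_of_finiteDimensional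
  have hF := NormedSpace.map_exp F hc (t • LinearMap.toMatrix' (generator N))
  have hg : F (t • LinearMap.toMatrix' (generator N)) = t • gen N Finset.univ := by
    rw [map_smul]
    congr 1
    refine ContinuousLinearMap.ext fun f => ?_
    funext σ
    rw [happ, LinearMap.toMatrix'_mulVec, gen_apply]
    rfl
  rw [hg] at hF
  have h1 := congrFun (congrArg (fun A : Op (Equiv.Perm (Fin N)) => A (Pi.single σ 1)) hF) 1
  -- The matrix entry (1, σ) is the evolved point mass at σ read at 1; symmetry of the semigroup
  -- exchanges the two points.
  have h2 : Pt N Finset.univ t (Pi.single 1 1) σ = Pt N Finset.univ t (Pi.single σ 1) 1 := by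
    rw [Pt_eq_sum (Pi.single σ 1) 1]
    simp [Pi.single_apply]
  rw [h2, Pt, sg, ← h1]
  simp only [happ, law, transition, Matrix.mulVec_single_one, Matrix.col_apply]
  rfl

/-! ### Heights of a permutation and monotone functions -/

section Heights

variable {N : ℕ}

/-- `ht σ x y` is the number of positions `z < x` holding a label `σ z < y`. -/
def ht (σ : Equiv.Perm (Fin N)) (x y : ℕ) : ℤ :=
  ∑ z : Fin N, if z.val < x ∧ (σ z).val < y then 1 else 0

@[simp] lemma ht_zero_left (σ : Equiv.Perm (Fin N)) (y : ℕ) : ht σ 0 y = 0 := by simp [ht]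

lemma ht_succ (σ : Equiv.Perm (Fin N)) {x : ℕ} (hx : x < N) (y : ℕ) :
    ht σ (x + 1) y = ht σ x y + if (σ ⟨x, hx⟩).val < y then 1 else 0 := by
  have h1 : (if (σ ⟨x, hx⟩).val < y then (1 : ℤ) else 0)
      = ∑ z : Fin N, if z = ⟨x, hx⟩ then (if (σ z).val < y then (1 : ℤ) else 0) else 0 := by
    rw [Finset.sum_ite_eq' Finset.univ (⟨x, hx⟩ : Fin N)]; simp
  rw [h1, ht, ht, ← Finset.sum_add_distrib]
  refine Finset.sum_congr rfl fun z _ => ?_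
  by_cases hz : z = ⟨x, hx⟩
  · subst hz; simp
  · have : z.val ≠ x := fun h => hz (Fin.ext h)
    have h2 : z.val < x + 1 ↔ z.val < x := by omega
    simp [hz, h2]

lemma ht_inv (σ : Equiv.Perm (Fin N)) (x y : ℕ) : ht σ⁻¹ x y = ht σ y x := by
  rw [ht, ht, ← Equiv.sum_comp σ]
  refine Finset.sum_congr rfl fun z _ => ?_
  simp [and_comm]

lemma ht_of_le (σ : Equiv.Perm (Fin N)) {x : ℕ} (hx : N ≤ x) (y : ℕ) :
    ht σ x y = ∑ z : Fin N, if z.val < y then 1 else 0 := by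
  rw [ht, ← Equiv.sum_comp σ fun z : Fin N => if z.val < y then (1 : ℤ) else 0]
  refine Finset.sum_congr rfl fun z _ => ?_
  have : z.val < x := z.2.trans_le hx
  simp [this]

lemma ht_le_of_le (σ σ' : Equiv.Perm (Fin N)) {x : ℕ} (hx : N ≤ x) (y : ℕ) :
    ht σ x y ≤ ht σ' x y := by rw [ht_of_le σ hx, ht_of_le σ' hx]

lemma ht_mono_left (σ : Equiv.Perm (Fin N)) {x x' : ℕ} (h : x ≤ x') (y : ℕ) :
    ht σ x y ≤ ht σ x' y := by
  refine Finset.sum_le_sum fun z _ => ?_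
  split_ifs <;> omega

lemma ht_nonneg (σ : Equiv.Perm (Fin N)) (x y : ℕ) : 0 ≤ ht σ x y :=
  Finset.sum_nonneg fun z _ => by split_ifs <;> norm_num

lemma ht_add_le (σ : Equiv.Perm (Fin N)) (x d y : ℕ) : ht σ (x + d) y ≤ ht σ x y + d := by
  induction d with
  | zero => simp
  | succ d ih =>
    by_cases h : x + d < N
    · rw [← add_assoc, ht_succ σ h]; push_cast; split_ifs <;> omega
    · rw [ht_of_le σ (show N ≤ x + (d + 1) by omega), ← ht_of_le σ (show N ≤ x + d by omega)]
      push_cast; omega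

lemma ht_le_left (σ : Equiv.Perm (Fin N)) (x y : ℕ) : ht σ x y ≤ x := by
  simpa using ht_add_le σ 0 x y

/-- For x ≤ y the identity already counts every position below x; the case y ≤ x follows by
inversion. Thus the starting point of the chain is the maximum of the order. -/
lemma ht_le_one (σ : Equiv.Perm (Fin N)) (x y : ℕ) : ht σ x y ≤ ht (1 : Equiv.Perm (Fin N)) x y := by
  rcases le_total x y with h | h
  · refine Finset.sum_le_sum fun z _ => ?_
    split_ifs with h1 h2 <;> first | omega | (simp at h2; omega)
  · rw [← ht_inv σ, ← ht_inv (1 : Equiv.Perm (Fin N))]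
    refine Finset.sum_le_sum fun z _ => ?_
    split_ifs with h1 h2 <;> first | omega | (simp at h2; omega)

lemma ht_one_of_le {x y : ℕ} (h : x ≤ y) (hx : x ≤ N) : ht (1 : Equiv.Perm (Fin N)) x y = x := by
  induction x with
  | zero => simp
  | succ x ih => rw [ht_succ _ (show x < N by omega), ih (by omega) (by omega)]; simp; omega

/-- The two positions exchanged by `tau N x`. -/
def lo (x : Fin (N - 1)) : Fin N := ⟨x.1, by omega⟩
/-- The two positions exchanged by `tau N x`. -/
def hi (x : Fin (N - 1)) : Fin N := ⟨x.1 + 1, by omega⟩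

lemma tau_eq (x : Fin (N - 1)) : tau N x = Equiv.swap (lo x) (hi x) := rfl

lemma ht_succ_lo (σ : Equiv.Perm (Fin N)) (x : Fin (N - 1)) (y : ℕ) :
    ht σ (x.1 + 1) y = ht σ x.1 y + if (σ (lo x)).val < y then 1 else 0 :=
  ht_succ σ (lo x).2 y

lemma ht_succ_hi (σ : Equiv.Perm (Fin N)) (x : Fin (N - 1)) (y : ℕ) :
    ht σ (x.1 + 2) y = ht σ (x.1 + 1) y + if (σ (hi x)).val < y then 1 else 0 :=
  ht_succ σ (hi x).2 y

lemma ht_mul_tau_of_ne (σ : Equiv.Perm (Fin N)) (x : Fin (N - 1)) {x' : ℕ} (h : x' ≠ x.1 + 1)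
    (y : ℕ) : ht (σ * tau N x) x' y = ht σ x' y := by
  rw [ht, ht, ← Equiv.sum_comp (tau N x)]
  refine Finset.sum_congr rfl fun z _ => ?_
  have h1 : (σ * tau N x) (tau N x z) = σ z := by
    rw [← Equiv.Perm.mul_apply, mul_assoc, tau_mul_self, mul_one]
  have h2 : (tau N x z).val < x' ↔ z.val < x' := by
    rw [tau_eq]
    rcases eq_or_ne z (lo x) with rfl | h3
    · rw [Equiv.swap_apply_left]; simp only [lo, hi]; omega
    · rcases eq_or_ne z (hi x) with rfl | h4
      · rw [Equiv.swap_apply_right]; simp only [lo, hi]; omega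
      · rw [Equiv.swap_apply_of_ne_of_ne h3 h4]
  rw [h1]
  simp only [h2]

lemma ht_mul_tau (σ : Equiv.Perm (Fin N)) (x : Fin (N - 1)) (y : ℕ) :
    ht (σ * tau N x) (x.1 + 1) y = ht σ x.1 y + if (σ (hi x)).val < y then 1 else 0 := by
  rw [ht_succ_lo, ht_mul_tau_of_ne _ _ (by omega)]
  simp [tau_eq]

/-- Whatever the order of the two labels, the new height is linear in three neighbouring heights.
This is why mean heights satisfy a closed heat equation. -/
lemma ht_mul_tau' (σ : Equiv.Perm (Fin N)) (x : Fin (N - 1)) (y : ℕ) :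
    ht (σ * tau N x) (x.1 + 1) y = ht σ x.1 y + ht σ (x.1 + 2) y - ht σ (x.1 + 1) y := by
  rw [ht_mul_tau, ht_succ_hi]; ring

/-- Comparison of heights at the label levels `y ∈ Y`. -/
def HLe (Y : Set ℕ) (σ σ' : Equiv.Perm (Fin N)) : Prop := ∀ x, ∀ y ∈ Y, ht σ x y ≤ ht σ' x y

lemma HLe.refl {Y : Set ℕ} (σ : Equiv.Perm (Fin N)) : HLe Y σ σ := fun _ _ _ => le_rfl

lemma HLe.trans {Y : Set ℕ} {σ σ' σ'' : Equiv.Perm (Fin N)} (h : HLe Y σ σ') (h' : HLe Y σ' σ'') :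
    HLe Y σ σ'' := fun x y hy => (h x y hy).trans (h' x y hy)

lemma HLe.one {Y : Set ℕ} (σ : Equiv.Perm (Fin N)) : HLe Y σ 1 := fun x y _ => ht_le_one σ x y

/-- Functions that increase with the heights at the label levels `y ∈ Y`. -/
def Incr (Y : Set ℕ) (f : Equiv.Perm (Fin N) → ℝ) : Prop := ∀ ⦃σ σ'⦄, HLe Y σ σ' → f σ ≤ f σ'

/-- The increment of the height at position z tells whether the label there is below y, so the
heights at all levels determine the permutation. -/
lemma eq_of_HLe {σ σ' : Equiv.Perm (Fin N)} (h : HLe Set.univ σ σ') (h' : HLe Set.univ σ' σ) :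
    σ = σ' := by
  have he : ∀ x y, ht σ x y = ht σ' x y := fun x y =>
    le_antisymm (h x y trivial) (h' x y trivial)
  ext z
  have key : ∀ y, (σ z).val < y ↔ (σ' z).val < y := fun y => by
    have h1 := ht_succ σ z.2 y
    have h2 := ht_succ σ' z.2 y
    rw [he, he] at h1
    simp only [Fin.eta] at h1 h2
    split_ifs at h1 h2 <;> omega
  have h1 := key ((σ z).val + 1)
  have h2 := key ((σ' z).val + 1)
  omega

lemma HLe_mul_tau {Y : Set ℕ} {σ : Equiv.Perm (Fin N)} {x : Fin (N - 1)}
    (h : σ (lo x) < σ (hi x)) : HLe Y (σ * tau N x) σ := by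
  intro x' y _
  by_cases hx : x' = x.1 + 1
  · subst hx
    rw [ht_mul_tau, ht_succ_lo]
    have : (σ (lo x)).val < (σ (hi x)).val := h
    split_ifs <;> omega
  · rw [ht_mul_tau_of_ne _ _ hx]

lemma mul_tau_lo_hi (σ : Equiv.Perm (Fin N)) (x : Fin (N - 1)) :
    (σ * tau N x) (lo x) = σ (hi x) ∧ (σ * tau N x) (hi x) = σ (lo x) := by
  simp [tau_eq]

lemma apply_lo_ne_hi (σ : Equiv.Perm (Fin N)) (x : Fin (N - 1)) : σ (lo x) ≠ σ (hi x) := by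
  intro h
  have := congrArg Fin.val (σ.injective h)
  simp [lo, hi] at this

lemma HLe_mul_tau' {Y : Set ℕ} {σ : Equiv.Perm (Fin N)} {x : Fin (N - 1)}
    (h : ¬ σ (lo x) < σ (hi x)) : HLe Y σ (σ * tau N x) := by
  have h1 : (σ * tau N x) (lo x) < (σ * tau N x) (hi x) := by
    rw [(mul_tau_lo_hi σ x).1, (mul_tau_lo_hi σ x).2]
    exact lt_of_le_of_ne (not_lt.1 h) (apply_lo_ne_hi σ x).symm
  have := HLe_mul_tau (Y := Y) h1
  rwa [mul_assoc, tau_mul_self, mul_one] at this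

/-- If both permutations are increasing across the edge `x`, the comparison survives the exchange. -/
lemma HLe_mul_tau_mul_tau {Y : Set ℕ} {σ σ' : Equiv.Perm (Fin N)} {x : Fin (N - 1)}
    (h : HLe Y σ σ') (hσ : σ (lo x) < σ (hi x)) (hσ' : σ' (lo x) < σ' (hi x)) :
    HLe Y (σ * tau N x) (σ' * tau N x) := by
  intro x' y hy
  by_cases hx : x' = x.1 + 1
  · subst hx
    have h0 := h x.1 y hy
    have h2 := h (x.1 + 2) y hy
    rw [ht_mul_tau, ht_mul_tau]
    rw [ht_succ_hi, ht_succ_hi, ht_succ_lo, ht_succ_lo] at h2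
    have : (σ (lo x)).val < (σ (hi x)).val := hσ
    have : (σ' (lo x)).val < (σ' (hi x)).val := hσ'
    split_ifs at h2 ⊢ <;> omega
  · rw [ht_mul_tau_of_ne _ _ hx, ht_mul_tau_of_ne _ _ hx]; exact h x' y hy

/-- Exchanging the lower permutation into increasing order keeps it below an increasing one. -/
lemma HLe_mul_tau_of_increasing {Y : Set ℕ} {σ σ' : Equiv.Perm (Fin N)} {x : Fin (N - 1)}
    (h : HLe Y σ σ') (hσ : ¬ σ (lo x) < σ (hi x)) (hσ' : σ' (lo x) < σ' (hi x)) :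
    HLe Y (σ * tau N x) σ' := by
  intro x' y hy
  by_cases hx : x' = x.1 + 1
  · subst hx
    have h0 := h x.1 y hy
    have h2 := h (x.1 + 2) y hy
    rw [ht_mul_tau, ht_succ_lo]
    rw [ht_succ_hi, ht_succ_hi, ht_succ_lo, ht_succ_lo] at h2
    have : ¬ (σ (lo x)).val < (σ (hi x)).val := hσ
    have : (σ' (lo x)).val < (σ' (hi x)).val := hσ'
    split_ifs at h2 ⊢ <;> omega
  · rw [ht_mul_tau_of_ne _ _ hx]; exact h x' y hy

/-- A decreasing permutation below another one stays below after the latter is exchanged. -/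
lemma HLe_of_decreasing {Y : Set ℕ} {σ σ' : Equiv.Perm (Fin N)} {x : Fin (N - 1)}
    (h : HLe Y σ σ') (hσ : ¬ σ (lo x) < σ (hi x)) (hσ' : σ' (lo x) < σ' (hi x)) :
    HLe Y σ (σ' * tau N x) := by
  have h1 : (σ * tau N x) (lo x) < (σ * tau N x) (hi x) := by
    rw [(mul_tau_lo_hi σ x).1, (mul_tau_lo_hi σ x).2]
    exact lt_of_le_of_ne (not_lt.1 hσ) (apply_lo_ne_hi σ x).symm
  have := HLe_mul_tau_mul_tau (HLe_mul_tau_of_increasing h hσ hσ') h1 hσ'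
  rwa [mul_assoc, tau_mul_self, mul_one] at this

/-- Randomizing an edge preserves monotonicity. -/
lemma Incr.average {Y : Set ℕ} {f : Equiv.Perm (Fin N) → ℝ} (hf : Incr Y f) (x : Fin (N - 1)) :
    Incr Y fun σ => f σ + f (σ * tau N x) := by
  intro σ σ' h
  show f σ + f (σ * tau N x) ≤ f σ' + f (σ' * tau N x)
  by_cases hσ : σ (lo x) < σ (hi x) <;> by_cases hσ' : σ' (lo x) < σ' (hi x)
  · exact add_le_add (hf h) (hf (HLe_mul_tau_mul_tau h hσ hσ'))
  · have h1 := hf (h.trans (HLe_mul_tau' (Y := Y) hσ'))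
    have h2 := hf ((HLe_mul_tau (Y := Y) hσ).trans h)
    linarith
  · have h1 := hf (HLe_mul_tau_of_increasing h hσ hσ')
    have h2 := hf (HLe_of_decreasing h hσ hσ')
    linarith
  · have aux : ∀ ρ : Equiv.Perm (Fin N), ¬ ρ (lo x) < ρ (hi x) →
        (ρ * tau N x) (lo x) < (ρ * tau N x) (hi x) := fun ρ hρ => by
      rw [(mul_tau_lo_hi ρ x).1, (mul_tau_lo_hi ρ x).2]
      exact lt_of_le_of_ne (not_lt.1 hρ) (apply_lo_ne_hi ρ x).symm
    exact add_le_add (hf h) (hf (HLe_mul_tau_of_increasing (h.trans (HLe_mul_tau' hσ')) hσ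
      (aux σ' hσ')))

lemma isClosed_incr (Y : Set ℕ) : IsClosed {f : Equiv.Perm (Fin N) → ℝ | Incr Y f} := by
  simp only [Incr, Set.ofPred_forall]
  exact isClosed_iInter fun σ => isClosed_iInter fun σ' => isClosed_iInter fun _ =>
    isClosed_le (continuous_apply σ) (continuous_apply σ')

lemma Incr.zero (Y : Set ℕ) : Incr Y (0 : Equiv.Perm (Fin N) → ℝ) := fun _ _ _ => le_rfl

lemma Incr.add {Y : Set ℕ} {f g : Equiv.Perm (Fin N) → ℝ} (hf : Incr Y f) (hg : Incr Y g) :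
    Incr Y (f + g) := fun _ _ h => add_le_add (hf h) (hg h)

lemma Incr.smul {Y : Set ℕ} {f : Equiv.Perm (Fin N) → ℝ} {a : ℝ} (ha : 0 ≤ a) (hf : Incr Y f) :
    Incr Y (a • f) := fun _ _ h => mul_le_mul_of_nonneg_left (hf h) ha

lemma Incr.sum {Y : Set ℕ} {α : Type*} (S : Finset α) {f : α → Equiv.Perm (Fin N) → ℝ}
    (hf : ∀ a ∈ S, Incr Y (f a)) : Incr Y fun σ => ∑ a ∈ S, f a σ :=
  fun _ _ h => Finset.sum_le_sum fun a ha => hf a ha h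

/-- The shuffle preserves monotone functions. -/
lemma Incr.Pt {Y : Set ℕ} {f : Equiv.Perm (Fin N) → ℝ} (hf : Incr Y f) (C : Finset (Fin (N - 1)))
    {t : ℝ} (ht : 0 ≤ t) : Incr Y (Pt N C t f) := by
  refine sg_mem_cone (gen N C) (2 * C.card) {f | Incr Y f} (isClosed_incr Y) (Incr.zero Y)
    (fun _ h _ h' => h.add h') (fun _ ha _ h => h.smul ha) (fun f hf => ?_) ht hf
  have : gen N C f + (2 * C.card : ℝ) • f = fun σ => ∑ x ∈ C, (f σ + f (σ * tau N x)) := by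
    funext σ
    simp only [Pi.add_apply, gen_apply, Pi.smul_apply, smul_eq_mul, Finset.sum_sub_distrib,
      Finset.sum_add_distrib, Finset.sum_const, nsmul_eq_mul]
    ring
  rw [this]
  exact Incr.sum C fun x _ => hf.average x

/-- The mass sits at the maximum of the order. Together with `Incr.Pt` this makes the law of the
chain increasing at all times. -/
lemma incr_single_one : Incr Set.univ (Pi.single (1 : Equiv.Perm (Fin N)) (1 : ℝ)) := by
  intro σ σ' h
  by_cases hσ : σ = 1
  · subst hσ
    rw [eq_of_HLe h (HLe.one σ')]
  · rw [Pi.single_eq_of_ne hσ]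
    by_cases h' : σ' = 1
    · simp [h']
    · simp [h']

/-- Exchanges across an edge move two monotone functions in the same direction. -/
lemma Incr.mul_tau_nonneg {f g : Equiv.Perm (Fin N) → ℝ} (hf : Incr Set.univ f)
    (hg : Incr Set.univ g) (σ : Equiv.Perm (Fin N)) (x : Fin (N - 1)) :
    0 ≤ (f (σ * tau N x) - f σ) * (g (σ * tau N x) - g σ) := by
  by_cases h : σ (lo x) < σ (hi x)
  · exact mul_nonneg_of_nonpos_of_nonpos (sub_nonpos.2 (hf (HLe_mul_tau h)))
      (sub_nonpos.2 (hg (HLe_mul_tau h)))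
  · exact mul_nonneg (sub_nonneg.2 (hf (HLe_mul_tau' h))) (sub_nonneg.2 (hg (HLe_mul_tau' h)))

/-- In Dirichlet form each edge contributes separately, and for two increasing functions every
contribution has the same sign. -/
lemma dotProduct_gen {C : Finset (Fin (N - 1))} (f g : Equiv.Perm (Fin N) → ℝ) :
    f ⬝ᵥ gen N C g
      = -(1 / 2) * ∑ x ∈ C, ∑ σ, (f (σ * tau N x) - f σ) * (g (σ * tau N x) - g σ) := by
  simp only [dotProduct, gen_apply, Finset.mul_sum]
  rw [Finset.sum_comm]
  refine Finset.sum_congr rfl fun x _ => ?_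
  have h1 : ∑ σ, f (σ * tau N x) * g (σ * tau N x) = ∑ σ, f σ * g σ :=
    sum_mul_right (tau N x) fun σ => f σ * g σ
  have h2 : ∑ σ, f (σ * tau N x) * g σ = ∑ σ, f σ * g (σ * tau N x) := by
    rw [← sum_mul_right (tau N x)]; simp [mul_assoc]
  rw [← Finset.mul_sum]
  simp only [mul_sub, sub_mul, Finset.sum_sub_distrib, h1, h2]
  ring

/-- Censoring inequality: freezing edges keeps an increasing law larger. -/
lemma dotProduct_Pt_le_censored {f g : Equiv.Perm (Fin N) → ℝ} (hf : Incr Set.univ f)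
    (hg : Incr Set.univ g) (C : Finset (Fin (N - 1))) {t : ℝ} (ht : 0 ≤ t) :
    f ⬝ᵥ Pt N Finset.univ t g ≤ f ⬝ᵥ Pt N C t g := by
  -- Interpolate between the two dynamics: the derivative is the Dirichlet form over all edges minus
  -- the one over C, which is nonnegative because both evolved functions remain increasing.
  have hd : ∀ s, HasDerivAt (fun r => Pt N Finset.univ (t - r) f ⬝ᵥ Pt N C r g)
      (Pt N Finset.univ (t - s) f ⬝ᵥ gen N C (Pt N C s g)
        - Pt N Finset.univ (t - s) f ⬝ᵥ gen N Finset.univ (Pt N C s g)) s := fun s => by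
    have h1 := hasDerivAt_sg_sub (gen N Finset.univ) t (hasDerivAt_const s f)
    have h2 := hasDerivAt_dotProduct h1 (hasDerivAt_sg (gen N C) g s)
    refine h2.congr_deriv ?_
    rw [zero_sub, map_neg, neg_dotProduct, gen_symm Finset.univ, ← sg_comm]
    simp only [Pt]; ring
  have hm : MonotoneOn (fun r => Pt N Finset.univ (t - r) f ⬝ᵥ Pt N C r g) (Set.Icc 0 t) := by
    refine monotoneOn_of_deriv_nonneg (convex_Icc 0 t)
      (fun s _ => (hd s).continuousAt.continuousWithinAt)
      (fun s _ => (hd s).differentiableAt.differentiableWithinAt) fun s hs => ?_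
    rw [interior_Icc] at hs
    rw [(hd s).deriv, dotProduct_gen, dotProduct_gen]
    have hF := hf.Pt Finset.univ (t := t - s) (by linarith [hs.2])
    have hG := hg.Pt C hs.1.le
    have := Finset.sum_le_sum_of_subset_of_nonneg (Finset.subset_univ C)
      (f := fun x => ∑ σ, (Pt N Finset.univ (t - s) f (σ * tau N x) - Pt N Finset.univ (t - s) f σ)
        * (Pt N C s g (σ * tau N x) - Pt N C s g σ))
      (fun x _ _ => Finset.sum_nonneg fun σ _ => hF.mul_tau_nonneg hG σ x)
    linarith
  have := hm (Set.left_mem_Icc.2 ht) (Set.right_mem_Icc.2 ht) ht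
  simp only [sub_zero, sub_self] at this
  rw [Pt_symm]
  simpa [Pt, sg_zero] using this

end Heights

/-! ### The heat equation satisfied by mean heights -/

section Heat

/-- Unlike the negative part itself, its square is differentiable at 0, so it can serve as an energy
in `heat_nonneg`. -/
lemma hasDerivAt_min_zero_sq (y : ℝ) :
    HasDerivAt (fun y : ℝ => (min y 0) ^ 2) (2 * min y 0) y := by
  rcases lt_trichotomy y 0 with h | h | h
  · have h1 : (fun y : ℝ => (min y 0) ^ 2) =ᶠ[nhds y] fun y => y ^ 2 := by
      filter_upwards [Iio_mem_nhds h] with z hz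
      rw [min_eq_left (le_of_lt hz)]
    rw [min_eq_left h.le]
    simpa using (hasDerivAt_pow 2 y).congr_of_eventuallyEq h1
  · subst h
    rw [hasDerivAt_iff_isLittleO_nhds_zero]
    refine Asymptotics.IsBigO.trans_isLittleO ?_
      (Asymptotics.isLittleO_pow_id (𝕜 := ℝ) one_lt_two)
    refine Asymptotics.IsBigO.of_bound 1 (Filter.Eventually.of_forall fun z => ?_)
    simp only [zero_add, min_self, mul_zero, smul_zero, sub_zero, one_mul, norm_pow, ne_eq,
      OfNat.ofNat_ne_zero, not_false_eq_true, zero_pow, Real.norm_eq_abs]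
    refine pow_le_pow_left₀ (abs_nonneg _) ?_ 2
    rcases le_total z 0 with hz | hz
    · rw [min_eq_left hz]
    · rw [min_eq_right hz]; simp
  · have h1 : (fun y : ℝ => (min y 0) ^ 2) =ᶠ[nhds y] fun y => 0 := by
      filter_upwards [Ioi_mem_nhds h] with z hz
      rw [min_eq_right (le_of_lt hz)]; simp
    rw [min_eq_right h.le, mul_zero]
    exact (hasDerivAt_const y (0 : ℝ)).congr_of_eventuallyEq h1

/-- Minimum principle for the discrete heat equation on `{0, …, N}`. -/
lemma heat_nonneg (N : ℕ) (u u' : ℕ → ℝ → ℝ)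
    (hd : ∀ x, 0 < x → x < N → ∀ t, HasDerivAt (u x) (u' x t) t)
    (h0 : ∀ x, 0 < x → x < N → 0 ≤ u x 0)
    (hl : ∀ t, 0 ≤ t → 0 ≤ u 0 t) (hr : ∀ t, 0 ≤ t → 0 ≤ u N t)
    (hstep : ∀ x, 0 < x → x < N → ∀ t, 0 ≤ t →
      0 ≤ u x t ∨ u (x - 1) t + u (x + 1) t - 2 * u x t ≤ u' x t)
    {t : ℝ} (ht : 0 ≤ t) {x : ℕ} (hx : 0 < x) (hxN : x < N) : 0 ≤ u x t := by
  set v : ℕ → ℝ → ℝ := fun x t => min (u x t) 0 with hv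
  have hv0 : ∀ x t, v x t ≤ 0 := fun x t => min_le_right _ _
  have hvu : ∀ x t, v x t ≤ u x t := fun x t => min_le_left _ _
  -- The energy of the negative parts starts at 0 and does not increase, hence vanishes.
  set Φ : ℝ → ℝ := fun t => ∑ x ∈ Finset.range (N - 1), (v (x + 1) t) ^ 2 with hΦ
  have hΦd : ∀ t, HasDerivAt Φ
      (∑ x ∈ Finset.range (N - 1), 2 * v (x + 1) t * u' (x + 1) t) t := fun t => by
    refine HasDerivAt.fun_sum fun x hx => ?_
    rw [Finset.mem_range] at hx
    exact (hasDerivAt_min_zero_sq (u (x + 1) t)).comp t (hd (x + 1) (by omega) (by omega) t)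
  have hneg : ∀ t, 0 ≤ t →
      ∑ x ∈ Finset.range (N - 1), 2 * v (x + 1) t * u' (x + 1) t ≤ 0 := by
    intro t ht
    -- From 2ab ≤ a² + b², the dissipation is bounded by second differences of v², whose sum
    -- telescopes to boundary terms of the right sign.
    have h1 : ∀ x ∈ Finset.range (N - 1), 2 * v (x + 1) t * u' (x + 1) t ≤
        (v (x + 2) t ^ 2 - v (x + 1) t ^ 2) - (v (x + 1) t ^ 2 - v x t ^ 2) := by
      intro x hx
      rw [Finset.mem_range] at hx
      rcases hstep (x + 1) (by omega) (by omega) t ht with h | h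
      · have : v (x + 1) t = 0 := min_eq_right h
        rw [this]; nlinarith [sq_nonneg (v (x + 2) t), sq_nonneg (v x t)]
      · by_cases h2 : 0 ≤ u (x + 1) t
        · have : v (x + 1) t = 0 := min_eq_right h2
          rw [this]; nlinarith [sq_nonneg (v (x + 2) t), sq_nonneg (v x t)]
        · have h3 : v (x + 1) t = u (x + 1) t := min_eq_left (not_le.1 h2).le
          have h4 : v x t + v (x + 2) t - 2 * v (x + 1) t ≤ u' (x + 1) t := by
            have := hvu x t
            have := hvu (x + 2) t
            rw [h3]
            simp only [Nat.add_sub_cancel] at h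
            linarith [show u (x + 1 + 1) t = u (x + 2) t from rfl]
          have h5 := mul_le_mul_of_nonpos_left h4 (hv0 (x + 1) t)
          nlinarith [sq_nonneg (v (x + 1) t - v x t), sq_nonneg (v (x + 1) t - v (x + 2) t)]
    refine (Finset.sum_le_sum h1).trans ?_
    rw [Finset.sum_range_sub (fun x => v (x + 1) t ^ 2 - v x t ^ 2) (N - 1)]
    have h2 : v (N - 1 + 1) t = 0 := by
      rw [show N - 1 + 1 = N by omega]; exact min_eq_right (hr t ht)
    have h3 : v 0 t = 0 := min_eq_right (hl t ht)
    rw [h2, h3]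
    nlinarith [sq_nonneg (v (N - 1) t), sq_nonneg (v (0 + 1) t)]
  have hanti : AntitoneOn Φ (Set.Icc 0 t) := by
    refine antitoneOn_of_deriv_nonpos (convex_Icc 0 t)
      (fun s _ => (hΦd s).continuousAt.continuousWithinAt)
      (fun s _ => (hΦd s).differentiableAt.differentiableWithinAt) fun s hs => ?_
    rw [interior_Icc] at hs
    rw [(hΦd s).deriv]
    exact hneg s hs.1.le
  have hΦ0 : Φ 0 = 0 := Finset.sum_eq_zero fun x hx => by
    rw [Finset.mem_range] at hx
    have : v (x + 1) 0 = 0 := min_eq_right (h0 (x + 1) (by omega) (by omega))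
    rw [this]; simp
  have h1 := hanti (Set.left_mem_Icc.2 ht) (Set.right_mem_Icc.2 ht) ht
  rw [hΦ0] at h1
  have h2 : v (x - 1 + 1) t ^ 2 ≤ 0 :=
    (Finset.single_le_sum (f := fun x => v (x + 1) t ^ 2) (fun _ _ => sq_nonneg _)
      (Finset.mem_range.2 (show x - 1 < N - 1 by omega))).trans h1
  rw [show x - 1 + 1 = x by omega] at h2
  have h3 : v x t = 0 := pow_eq_zero_iff two_ne_zero |>.1 (le_antisymm h2 (sq_nonneg _))
  rw [← h3]
  exact hvu x t

/-- The gap of the path with `n` edges under Dirichlet conditions. -/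
def lam (n : ℕ) : ℝ := 2 * (1 - Real.cos (Real.pi / n))

/-- The ground state of the path, repeated with period `n`. -/
def sinv (n x : ℕ) : ℝ := Real.sin (Real.pi * (x % n : ℕ) / n)

lemma sinv_of_dvd {n x : ℕ} (h : n ∣ x) : sinv n x = 0 := by
  simp [sinv, Nat.mod_eq_zero_of_dvd h]

lemma sinv_nonneg (n x : ℕ) : 0 ≤ sinv n x := by
  rcases Nat.eq_zero_or_pos n with rfl | hn
  · simp [sinv]
  · refine Real.sin_nonneg_of_nonneg_of_le_pi (by positivity) ?_
    rw [div_le_iff₀ (by positivity)]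
    have : ((x % n : ℕ) : ℝ) ≤ n := by exact_mod_cast (Nat.mod_lt x hn).le
    exact mul_le_mul_of_nonneg_left this Real.pi_pos.le

lemma sinv_le_one (n x : ℕ) : sinv n x ≤ 1 := Real.sin_le_one _

lemma sinv_laplacian {n x : ℕ} (hn : 0 < n) (h : ¬ n ∣ x) :
    sinv n (x - 1) + sinv n (x + 1) - 2 * sinv n x = -lam n * sinv n x := by
  set k := x % n with hk
  have hk0 : 0 < k := Nat.pos_of_ne_zero fun h' => h (Nat.dvd_of_mod_eq_zero h')
  have hkn : k < n := Nat.mod_lt x hn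
  have hx := Nat.div_add_mod x n
  rw [← hk] at hx
  have h1 : (x - 1) % n = k - 1 := by
    rw [show x - 1 = k - 1 + n * (x / n) by omega, Nat.add_mul_mod_self_left,
      Nat.mod_eq_of_lt (by omega)]
  have h2 : sinv n (x + 1) = Real.sin (Real.pi * (k + 1 : ℕ) / n) := by
    rw [sinv, show x + 1 = k + 1 + n * (x / n) by omega, Nat.add_mul_mod_self_left]
    rcases Nat.lt_or_ge (k + 1) n with h3 | h3
    · rw [Nat.mod_eq_of_lt h3]
    -- At the end of a block the residue wraps to 0, which is harmless since sin π = sin 0.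
    · have h4 : k + 1 = n := by omega
      rw [h4, Nat.mod_self]
      have : Real.pi * (n : ℝ) / n = Real.pi := by field_simp
      rw [this]; simp
  have hn' : (n : ℝ) ≠ 0 := by positivity
  rw [h2, sinv, h1, sinv, ← hk, Nat.cast_sub (by omega), Nat.cast_add, lam]
  have e1 : Real.pi * ((k : ℝ) - (1 : ℕ)) / n = Real.pi * k / n - Real.pi / n := by
    push_cast; ring
  have e2 : Real.pi * ((k : ℝ) + (1 : ℕ)) / n = Real.pi * k / n + Real.pi / n := by
    push_cast; ring
  rw [e1, e2, Real.sin_sub, Real.sin_add]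
  ring

/-- Jordan's inequality sin θ ≥ 2θ/π on [0, π/2], used from whichever end of the block is closer. It
places initial height differences under a multiple of the ground state. -/
lemma min_le_sinv {n x : ℕ} (hn : 0 < n) {d : ℝ} (h1 : d ≤ (x % n : ℕ))
    (h2 : d ≤ n - (x % n : ℕ)) : d ≤ n / 2 * sinv n x := by
  have hn' : (0 : ℝ) < n := by positivity
  have hk : ((x % n : ℕ) : ℝ) ≤ n := by exact_mod_cast (Nat.mod_lt x hn).le
  set k : ℝ := ((x % n : ℕ) : ℝ) with hkdef
  have hk0 : 0 ≤ k := by positivity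
  have hpi := Real.pi_pos
  have key : ∀ a : ℝ, 0 ≤ a → a ≤ n / 2 → a ≤ n / 2 * Real.sin (Real.pi * a / n) := by
    intro a ha ha'
    have := Real.mul_le_sin (x := Real.pi * a / n) (by positivity)
      (by rw [div_le_div_iff₀ hn' two_pos]; nlinarith)
    calc a = n / 2 * (2 / Real.pi * (Real.pi * a / n)) := by field_simp
      _ ≤ _ := mul_le_mul_of_nonneg_left this (by positivity)
  rcases le_total k (n / 2) with h | h
  · exact h1.trans (key k hk0 h)
  · have := key (n - k) (by linarith) (by linarith)
    have e : Real.pi * (n - k) / n = Real.pi - Real.pi * k / n := by field_simp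
    rw [e, Real.sin_pi_sub] at this
    exact h2.trans this

variable {N : ℕ}

/-- The edges that do not cross a multiple of `n`. -/
def blockEdges (N n : ℕ) : Finset (Fin (N - 1)) := Finset.univ.filter fun x => ¬ n ∣ x.1 + 1

/-- A single block of length N freezes nothing, since e + 1 lies strictly between 0 and N for each
edge e. Block estimates with n = N therefore concern the full shuffle. -/
lemma blockEdges_self (N : ℕ) : blockEdges N N = Finset.univ := by
  refine Finset.filter_true_of_mem fun x _ h => ?_
  have := Nat.le_of_dvd (by omega) h
  omega

/-- The height as a real function of the permutation. -/
def Hf (N x y : ℕ) : Equiv.Perm (Fin N) → ℝ := fun σ => ht σ x y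

lemma gen_Hf_of_ne (C : Finset (Fin (N - 1))) {x : ℕ} (h : ∀ e ∈ C, x ≠ e.1 + 1) (y : ℕ) :
    gen N C (Hf N x y) = 0 := by
  funext σ
  rw [gen_apply]
  exact Finset.sum_eq_zero fun e he => by
    rw [Hf, ht_mul_tau_of_ne σ e (h e he), Hf, sub_self]

lemma gen_Hf (C : Finset (Fin (N - 1))) {e : Fin (N - 1)} (he : e ∈ C) (y : ℕ) :
    gen N C (Hf N (e.1 + 1) y)
      = Hf N e.1 y + Hf N (e.1 + 2) y - (2 : ℝ) • Hf N (e.1 + 1) y := by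
  funext σ
  rw [gen_apply, Finset.sum_eq_single_of_mem e he]
  · simp only [Hf, Pi.add_apply, Pi.sub_apply, Pi.smul_apply, smul_eq_mul]
    rw [ht_mul_tau']; push_cast; ring
  · intro e' _ hne
    have : e.1 + 1 ≠ e'.1 + 1 := fun h => hne (Fin.ext (by omega))
    simp only [Hf]
    rw [ht_mul_tau_of_ne σ e' this, sub_self]

lemma Pt_Hf_cut {n x : ℕ} (h : n ∣ x ∨ N ≤ x ∨ x = 0) (y : ℕ) (t : ℝ) :
    Pt N (blockEdges N n) t (Hf N x y) = Hf N x y := by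
  refine sg_fixed _ (gen_Hf_of_ne _ (fun e he hx => ?_) y) t
  rw [blockEdges, Finset.mem_filter] at he
  rcases h with h | h | h
  · exact he.2 (hx ▸ h)
  · omega
  · omega

lemma hasDerivAt_Pt_Hf {n x : ℕ} (hx : 0 < x) (hxN : x < N) (h : ¬ n ∣ x) (y : ℕ)
    (σ : Equiv.Perm (Fin N)) (t : ℝ) :
    HasDerivAt (fun s => Pt N (blockEdges N n) s (Hf N x y) σ)
      (Pt N (blockEdges N n) t (Hf N (x - 1) y) σ + Pt N (blockEdges N n) t (Hf N (x + 1) y) σ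
        - 2 * Pt N (blockEdges N n) t (Hf N x y) σ) t := by
  have h1 := hasDerivAt_pi.1 (hasDerivAt_sg_left (gen N (blockEdges N n)) (Hf N x y) t) σ
  have he : (⟨x - 1, by omega⟩ : Fin (N - 1)) ∈ blockEdges N n := by
    rw [blockEdges, Finset.mem_filter]
    refine ⟨Finset.mem_univ _, ?_⟩
    rwa [show x - 1 + 1 = x by omega]
  have h2 := gen_Hf _ he y
  simp only [show x - 1 + 1 = x by omega, show x - 1 + 2 = x + 1 by omega] at h2
  refine h1.congr_deriv ?_
  rw [h2, map_sub, map_add, map_smul]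
  rfl

/-- Decay of the difference of mean heights when the heights at the cuts agree. -/
lemma Pt_Hf_sub_le {n : ℕ} (hn : 0 < n) {σ σ' : Equiv.Perm (Fin N)} {y : ℕ}
    (hcut : ∀ i, ht σ (n * i) y = ht σ' (n * i) y) {t : ℝ} (ht0 : 0 ≤ t) (x : ℕ) :
    Pt N (blockEdges N n) t (Hf N x y) σ - Pt N (blockEdges N n) t (Hf N x y) σ'
      ≤ n / 2 * Real.exp (-lam n * t) := by
  by_cases hx : n ∣ x ∨ N ≤ x ∨ x = 0
  · rw [Pt_Hf_cut hx]
    have : (ht σ x y : ℝ) - ht σ' x y = 0 := by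
      rcases hx with ⟨i, rfl⟩ | h | h
      · rw [hcut, sub_self]
      · rw [ht_of_le σ h, ht_of_le σ' h, sub_self]
      · subst h; simp
    simp only [Hf, this]
    positivity
  push Not at hx
  obtain ⟨hx1, hxN, hx0⟩ := hx
  set C := blockEdges N n
  -- Compare with the decaying ground state of each block. At cuts the heights are frozen and equal
  -- for both starts, so the derivative there is set to 0 and the first alternative of `heat_nonneg`
  -- is used.
  have key := heat_nonneg N
    (fun x t => n / 2 * Real.exp (-lam n * t) * sinv n x
      - (Pt N C t (Hf N x y) σ - Pt N C t (Hf N x y) σ'))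
    (fun x t => -lam n * (n / 2 * Real.exp (-lam n * t) * sinv n x)
      - if n ∣ x then 0 else
        ((Pt N C t (Hf N (x - 1) y) σ + Pt N C t (Hf N (x + 1) y) σ - 2 * Pt N C t (Hf N x y) σ) -
        (Pt N C t (Hf N (x - 1) y) σ' + Pt N C t (Hf N (x + 1) y) σ'
          - 2 * Pt N C t (Hf N x y) σ')))
    ?_ ?_ ?_ ?_ ?_ ht0 (Nat.pos_of_ne_zero hx0) hxN
  · have h1 := sinv_le_one n x
    have h2 : n / 2 * Real.exp (-lam n * t) * sinv n x ≤ n / 2 * Real.exp (-lam n * t) * 1 :=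
      mul_le_mul_of_nonneg_left h1 (by positivity)
    linarith
  · intro x hx hxN t
    have h1 : HasDerivAt (fun t => n / 2 * Real.exp (-lam n * t) * sinv n x)
        (-lam n * (n / 2 * Real.exp (-lam n * t) * sinv n x)) t := by
      have h2 : HasDerivAt (fun t => -lam n * t) (-lam n) t := by
        simpa using (hasDerivAt_id t).const_mul (-lam n)
      refine ((h2.exp.const_mul (n / 2 : ℝ)).mul_const (sinv n x)).congr_deriv ?_
      ring
    refine h1.sub ?_
    split_ifs with h
    · have : (fun t => Pt N C t (Hf N x y) σ - Pt N C t (Hf N x y) σ')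
          = fun _ => Hf N x y σ - Hf N x y σ' := by
        funext t; rw [Pt_Hf_cut (Or.inl h)]
      rw [this]; exact hasDerivAt_const _ _
    · exact (hasDerivAt_Pt_Hf hx hxN h y σ t).sub (hasDerivAt_Pt_Hf hx hxN h y σ' t)
  · intro x hx hxN
    have hx' := Nat.div_add_mod x n
    have hlt := Nat.mod_lt x hn
    set k := x % n with hk
    -- Heights agree at both neighbouring cuts and have steps 0 or 1, so their difference is at most
    -- the distance to either cut.
    have h1 : ht σ x y - ht σ' x y ≤ k := by
      have h2 := ht_add_le σ (n * (x / n)) k y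
      have h3 := ht_mono_left σ' (show n * (x / n) ≤ x by omega) y
      rw [hx'] at h2
      have := hcut (x / n)
      omega
    have h2 : ht σ x y - ht σ' x y ≤ n - k := by
      have h2 := ht_add_le σ' x (n - k) y
      have h3 := ht_mono_left σ (show x ≤ n * (x / n + 1) by rw [mul_add]; omega) y
      have h4 : x + (n - k) = n * (x / n + 1) := by rw [mul_add]; omega
      rw [h4] at h2
      have := hcut (x / n + 1)
      omega
    have h3 := min_le_sinv (n := n) (x := x) hn (d := (ht σ x y : ℝ) - ht σ' x y)
      (by rw [← hk]; exact_mod_cast h1) (by rw [← hk]; exact_mod_cast h2)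
    simp only [Pt, sg_zero, Hf, mul_zero, Real.exp_zero, mul_one]
    linarith
  · intro t _
    rw [Pt_Hf_cut (Or.inr (Or.inr rfl))]
    simp [Hf, sinv]
  · intro t _
    rw [Pt_Hf_cut (Or.inr (Or.inl le_rfl))]
    simp only [Hf, ht_of_le σ le_rfl, ht_of_le σ' le_rfl, sub_self, sub_zero]
    exact mul_nonneg (by positivity) (sinv_nonneg n N)
  · intro x hx hxN t _
    by_cases h : n ∣ x
    · left
      rw [Pt_Hf_cut (Or.inl h), sinv_of_dvd h]
      obtain ⟨i, rfl⟩ := h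
      simp [Hf, hcut]
    · right
      simp only [if_neg h]
      have := sinv_laplacian hn h
      have h2 : n / 2 * Real.exp (-lam n * t) *
          (sinv n (x - 1) + sinv n (x + 1) - 2 * sinv n x)
          = n / 2 * Real.exp (-lam n * t) * (-lam n * sinv n x) := by rw [this]
      nlinarith

end Heat

/-! ### Oscillation inside blocks -/

section Blocks

variable {N : ℕ}

open Classical in
/-- Sum of the heights over the levels in `Y`. -/
def WY (N : ℕ) (Y : Set ℕ) (σ : Equiv.Perm (Fin N)) : ℤ :=
  ∑ x ∈ Finset.range (N + 1), ∑ y ∈ (Finset.range (N + 1)).filter (· ∈ Y), ht σ x y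

/-- The sum of heights is an integer, so a strict increase of any height raises it by at least 1.
Levels and positions beyond N need no check because heights there are determined. -/
lemma HLe.WY_dichotomy {Y : Set ℕ} {σ σ' : Equiv.Perm (Fin N)} (h : HLe Y σ σ') :
    HLe Y σ' σ ∨ WY N Y σ + 1 ≤ WY N Y σ' := by
  classical
  by_cases hs : ∃ x ≤ N, ∃ y ≤ N, y ∈ Y ∧ ht σ x y < ht σ' x y
  · right
    obtain ⟨x, hx, y, hy, hyY, hlt⟩ := hs
    rw [Int.add_one_le_iff]
    refine Finset.sum_lt_sum (fun x _ => Finset.sum_le_sum fun y hy =>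
      h x y (Finset.mem_filter.1 hy).2) ⟨x, Finset.mem_range.2 (by omega), ?_⟩
    exact Finset.sum_lt_sum (fun y hy => h x y (Finset.mem_filter.1 hy).2)
      ⟨y, Finset.mem_filter.2 ⟨Finset.mem_range.2 (by omega), hyY⟩, hlt⟩
  · left
    push Not at hs
    intro x y hy
    by_cases hx : x ≤ N
    · by_cases hyN : y ≤ N
      · exact hs x hx y hyN hy
      · rw [← ht_inv, ← ht_inv σ]; exact ht_le_of_le _ _ (by omega) _
    · exact ht_le_of_le _ _ (by omega) _

/-- Each strict move up raises the sum of heights by at least 1, more than f can gain. Consequently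
the increments of an evolved f are controlled by those of mean heights. -/
lemma Incr.WY_sub {Y : Set ℕ} {f : Equiv.Perm (Fin N) → ℝ} (hf : Incr Y f) (h0 : ∀ σ, 0 ≤ f σ)
    (h1 : ∀ σ, f σ ≤ 1) : Incr Y fun σ => (WY N Y σ : ℝ) - f σ := by
  intro σ σ' h
  have hW : WY N Y σ ≤ WY N Y σ' := by
    classical
    exact Finset.sum_le_sum fun x _ => Finset.sum_le_sum fun y hy =>
      h x y (Finset.mem_filter.1 hy).2
  rcases h.WY_dichotomy with h' | h'
  · have := hf h'
    have : (WY N Y σ : ℝ) ≤ WY N Y σ' := by exact_mod_cast hW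
    show (WY N Y σ : ℝ) - f σ ≤ WY N Y σ' - f σ'
    linarith
  · have : (WY N Y σ : ℝ) + 1 ≤ WY N Y σ' := by exact_mod_cast h'
    show (WY N Y σ : ℝ) - f σ ≤ WY N Y σ' - f σ'
    linarith [h0 σ, h1 σ']

/-- `τ` is increasing inside every block of `n` consecutive positions. -/
def BlockAsc (n : ℕ) (τ : Equiv.Perm (Fin N)) : Prop :=
  ∀ e ∈ blockEdges N n, τ (lo e) < τ (hi e)

lemma BlockAsc.lt {n : ℕ} {τ : Equiv.Perm (Fin N)} (h : BlockAsc n τ) (i a b : ℕ)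
    (ha : n * i ≤ a) (hab : a < b) (hb : b < n * i + n) (hbN : b < N) :
    τ ⟨a, hab.trans hbN⟩ < τ ⟨b, hbN⟩ := by
  induction b with
  | zero => omega
  | succ b ih =>
    have hn : ¬ n ∣ b + 1 := by
      rintro ⟨j, hj⟩
      have h1 : i < j := by
        by_contra hc
        have := Nat.mul_le_mul_left n (not_lt.1 hc)
        omega
      have := Nat.mul_le_mul_left n (Nat.succ_le_of_lt h1)
      rw [Nat.succ_eq_add_one, mul_add] at this
      omega
    have h1 := h ⟨b, by omega⟩ (by simp [blockEdges, hn])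
    simp only [lo, hi] at h1
    rcases Nat.lt_or_ge a b with h2 | h2
    · exact (ih h2 (by omega) (by omega)).trans h1
    · have : a = b := by omega
      subst this
      exact h1

/-- Inside an ascending block the labels below y come first, so the height climbs with slope 1 and
is flat afterwards. Every path with the same values at the cuts lies below it. -/
lemma BlockAsc.ht_dichotomy {n : ℕ} {τ : Equiv.Perm (Fin N)} (h : BlockAsc n τ) (i x y : ℕ)
    (hx : n * i ≤ x) (hxn : x < n * i + n) (hxN : x < N) :
    ht τ x y = ht τ (n * i) y + (x - n * i : ℕ) ∨ ht τ x y = ht τ (n * i + n) y := by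
  rcases Nat.eq_or_lt_of_le hx with h0 | h0
  · left; rw [← h0]; simp
  by_cases hy : (τ ⟨x - 1, by omega⟩).val < y
  · left
    have : ∀ d, n * i + d ≤ x → ht τ (n * i + d) y = ht τ (n * i) y + d := by
      intro d
      induction d with
      | zero => simp
      | succ d ih =>
        intro hd
        rw [← add_assoc, ht_succ τ (show n * i + d < N by omega), ih (by omega), if_pos]
        · push_cast; ring
        · rcases Nat.lt_or_ge (n * i + d) (x - 1) with h2 | h2
          · have := h.lt i (n * i + d) (x - 1) (by omega) h2 (by omega) (by omega)
            exact lt_trans this hy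
          · have e : n * i + d = x - 1 := by omega
            simpa only [e] using hy
    have := this (x - n * i) (by omega)
    rwa [show n * i + (x - n * i) = x by omega] at this
  · right
    have : ∀ d, x + d ≤ n * i + n → ht τ (x + d) y = ht τ x y := by
      intro d
      induction d with
      | zero => simp
      | succ d ih =>
        intro hd
        by_cases hN : x + d < N
        · rw [← add_assoc, ht_succ τ hN, ih (by omega), if_neg, add_zero]
          have := h.lt i (x - 1) (x + d) (by omega) (by omega) (by omega) (by omega)
          have : (τ ⟨x - 1, by omega⟩).val < (τ ⟨x + d, hN⟩).val := this
          omega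
        · rw [ht_of_le τ (show N ≤ x + (d + 1) by omega), ← ih (by omega),
            ht_of_le τ (show N ≤ x + d by omega)]
    have := this (n * i + n - x) (by omega)
    rw [show x + (n * i + n - x) = n * i + n by omega] at this
    exact this.symm

/-- To be below a block-increasing permutation it suffices to compare heights at the cuts. -/
lemma BlockAsc.HLe {n : ℕ} (hn : 0 < n) {Y : Set ℕ} {σ τ : Equiv.Perm (Fin N)}
    (h : BlockAsc n τ) (hcut : ∀ i, ∀ y ∈ Y, ht σ (n * i) y ≤ ht τ (n * i) y) : HLe Y σ τ := by
  intro x y hy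
  rcases Nat.lt_or_ge x N with hxN | hxN
  · have hx := Nat.div_add_mod x n
    have hlt := Nat.mod_lt x hn
    rcases h.ht_dichotomy (x / n) x y (by omega) (by omega) hxN with h1 | h1
    · rw [h1]
      have h2 := ht_add_le σ (n * (x / n)) (x - n * (x / n)) y
      rw [show n * (x / n) + (x - n * (x / n)) = x by omega] at h2
      linarith [hcut (x / n) y hy]
    · rw [h1]
      have h2 := ht_mono_left σ (show x ≤ n * (x / n) + n by omega) y
      have h3 := hcut (x / n + 1) y hy
      rw [mul_add, mul_one] at h3
      linarith
  · exact ht_le_of_le _ _ hxN _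

/-- The block-increasing rearrangement. -/
lemma exists_blockAsc (n : ℕ) (σ : Equiv.Perm (Fin N)) :
    ∃ τ : Equiv.Perm (Fin N), BlockAsc n τ ∧ HLe Set.univ σ τ ∧
      ∀ i y, ht τ (n * i) y = ht σ (n * i) y := by
  classical
  set T : Finset (Equiv.Perm (Fin N)) := Finset.univ.filter fun τ =>
    HLe Set.univ σ τ ∧ ∀ i y, ht τ (n * i) y = ht σ (n * i) y with hT
  -- At a maximizer of the total height no descent remains inside a block, since exchanging it would
  -- raise the total without changing heights at cuts.
  obtain ⟨τ, hτ, hmax⟩ := Finset.exists_max_image T (WY N Set.univ)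
    ⟨σ, by rw [hT, Finset.mem_filter]; exact ⟨Finset.mem_univ _, HLe.refl σ, fun _ _ => rfl⟩⟩
  rw [hT, Finset.mem_filter] at hτ
  refine ⟨τ, fun e he => ?_, hτ.2.1, hτ.2.2⟩
  by_contra hc
  have hup : HLe Set.univ τ (τ * tau N e) := HLe_mul_tau' hc
  rw [blockEdges, Finset.mem_filter] at he
  have hmem : τ * tau N e ∈ T := by
    rw [hT, Finset.mem_filter]
    refine ⟨Finset.mem_univ _, hτ.2.1.trans hup, fun i y => ?_⟩
    rw [ht_mul_tau_of_ne τ e (fun h => he.2 ⟨i, h.symm⟩), hτ.2.2]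
  rcases hup.WY_dichotomy with h | h
  · have h1 := eq_of_HLe hup h
    have h2 := (mul_tau_lo_hi τ e).1
    rw [← h1] at h2
    exact apply_lo_ne_hi τ e h2
  · have := hmax _ hmem
    omega

/-- After the blocks have been shuffled for a while, a monotone function is almost a function of
the heights at the cuts. -/
lemma block_osc {n : ℕ} (hn : 0 < n) {Y : Set ℕ} {f : Equiv.Perm (Fin N) → ℝ} (hf : Incr Y f)
    (h0 : ∀ σ, 0 ≤ f σ) (h1 : ∀ σ, f σ ≤ 1) {t : ℝ} (ht0 : 0 ≤ t) {σ τ : Equiv.Perm (Fin N)}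
    (h : ∀ i, ∀ y ∈ Y, ht τ (n * i) y ≤ ht σ (n * i) y) :
    Pt N (blockEdges N n) t f τ ≤ Pt N (blockEdges N n) t f σ
      + (N + 1) ^ 2 * (n / 2 * Real.exp (-lam n * t)) := by
  classical
  obtain ⟨ρ, hρ, hσρ, hcut⟩ := exists_blockAsc n σ
  set C := blockEdges N n
  -- The rearrangement ρ of σ dominates τ. Passing from σ to ρ then gains at most the difference of
  -- mean total heights, by monotonicity of W - f, and that difference decays.
  have h2 : Pt N C t f τ ≤ Pt N C t f ρ := hf.Pt C ht0
    (hρ.HLe hn fun i y hy => by rw [hcut]; exact h i y hy)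
  have h3 := (hf.WY_sub h0 h1).Pt C ht0 (show HLe Y σ ρ from fun x y _ => hσρ x y trivial)
  have hW : (fun σ => (WY N Y σ : ℝ)) = ∑ x ∈ Finset.range (N + 1),
      ∑ y ∈ (Finset.range (N + 1)).filter (· ∈ Y), Hf N x y := by
    funext σ
    simp [WY, Hf, Finset.sum_apply]
  have e : (fun σ => (WY N Y σ : ℝ) - f σ) = (∑ x ∈ Finset.range (N + 1),
      ∑ y ∈ (Finset.range (N + 1)).filter (· ∈ Y), Hf N x y) - f := by
    rw [← hW]; rfl
  rw [e, map_sub] at h3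
  simp only [map_sum, Pi.sub_apply, Finset.sum_apply] at h3
  have h4 : ∑ x ∈ Finset.range (N + 1), ∑ y ∈ (Finset.range (N + 1)).filter (· ∈ Y),
      (Pt N C t (Hf N x y) ρ - Pt N C t (Hf N x y) σ)
      ≤ (N + 1) ^ 2 * (n / 2 * Real.exp (-lam n * t)) := by
    have hB : 0 ≤ (n / 2 * Real.exp (-lam n * t) : ℝ) := by positivity
    calc _ ≤ ∑ x ∈ Finset.range (N + 1), ∑ y ∈ (Finset.range (N + 1)).filter (· ∈ Y),
          (n / 2 * Real.exp (-lam n * t) : ℝ) :=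
          Finset.sum_le_sum fun x _ => Finset.sum_le_sum fun y _ =>
            Pt_Hf_sub_le hn (fun i => hcut i y) ht0 x
      _ ≤ ∑ x ∈ Finset.range (N + 1), ∑ y ∈ Finset.range (N + 1),
          (n / 2 * Real.exp (-lam n * t) : ℝ) :=
          Finset.sum_le_sum fun x _ => Finset.sum_le_sum_of_subset_of_nonneg
            (Finset.filter_subset _ _) fun _ _ _ => hB
      _ = _ := by simp; ring
  simp only [Finset.sum_sub_distrib] at h4
  linarith

end Blocks

/-! ### Shifting the heights: swaps between the first and the last block -/

section Binomial

/-- By induction, the step being (2k + 1)(2k + 3) ≤ (2k + 2)². -/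
lemma centralBinom_sq_mul_le (k : ℕ) : k.centralBinom ^ 2 * (2 * k + 1) ≤ 16 ^ k := by
  induction k with
  | zero => simp
  | succ k ih =>
    have h := Nat.succ_mul_centralBinom_succ k
    have h1 : (k + 1) ^ 2 * ((k + 1).centralBinom ^ 2 * (2 * (k + 1) + 1))
        ≤ (k + 1) ^ 2 * 16 ^ (k + 1) := by
      calc (k + 1) ^ 2 * ((k + 1).centralBinom ^ 2 * (2 * (k + 1) + 1))
          = ((k + 1) * (k + 1).centralBinom) ^ 2 * (2 * k + 3) := by ring
        _ = (k.centralBinom ^ 2 * (2 * k + 1)) * (4 * (2 * k + 1) * (2 * k + 3)) := by rw [h]; ring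
        _ ≤ 16 ^ k * (4 * (2 * k + 1) * (2 * k + 3)) := Nat.mul_le_mul_right _ ih
        _ ≤ 16 ^ k * (16 * (k + 1) ^ 2) := Nat.mul_le_mul_left _ (by nlinarith)
        _ = _ := by ring
    exact Nat.le_of_mul_le_mul_left h1 (by positivity)

/-- The central coefficient is the largest. The bound says that no value of a fair binomial variable
with Q trials has probability above 1/√Q. -/
lemma choose_sq_mul_le (Q k : ℕ) : Q.choose k ^ 2 * Q ≤ 4 ^ Q := by
  have h0 : Q.choose k ≤ Q.choose (Q / 2) := Nat.choose_le_middle k Q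
  have h1 : Q.choose (Q / 2) ^ 2 * Q ≤ 4 ^ Q := by
    rcases Nat.even_or_odd' Q with ⟨j, rfl | rfl⟩
    · have := centralBinom_sq_mul_le j
      rw [Nat.centralBinom] at this
      rw [show 2 * j / 2 = j by omega, pow_mul]
      norm_num
      nlinarith
    · have := centralBinom_sq_mul_le j
      rw [Nat.centralBinom] at this
      rw [show (2 * j + 1) / 2 = j by omega, pow_succ 4 (2 * j), pow_mul]
      have h2 : (2 * j + 1).choose j ≤ 2 * (2 * j).choose j := by
        rcases j with _ | j
        · simp
        · rw [Nat.choose_succ_succ']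
          have := Nat.choose_le_middle j (2 * (j + 1))
          rw [show 2 * (j + 1) / 2 = j + 1 by omega] at this
          omega
      have h3 := Nat.pow_le_pow_left h2 2
      norm_num
      nlinarith
  exact (Nat.mul_le_mul_right _ (Nat.pow_le_pow_left h0 2)).trans h1

lemma sum_shift_le {g : ℕ → ℝ} (h0 : ∀ k, 0 ≤ g k) (h1 : ∀ k, g k ≤ 1) (Q r : ℕ) :
    ∑ k ∈ Finset.range (Q + 1), (g (k + r) - g k) ≤ r := by
  induction r with
  | zero => simp
  | succ r ih =>
    have h2 := Finset.sum_range_sub (fun k => g (k + r)) (Q + 1)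
    have h3 : ∑ k ∈ Finset.range (Q + 1), (g (k + (r + 1)) - g k)
        = ∑ k ∈ Finset.range (Q + 1), (g (k + 1 + r) - g (k + r))
          + ∑ k ∈ Finset.range (Q + 1), (g (k + r) - g k) := by
      rw [← Finset.sum_add_distrib]
      refine Finset.sum_congr rfl fun k _ => ?_
      rw [show k + (r + 1) = k + 1 + r by ring]; ring
    rw [h3, h2]
    push_cast
    linarith [h1 (Q + 1 + r), h0 (0 + r)]

/-- The size of a uniform subset is binomial, each of its values has probability at most 1/√Q with Q
the cardinality of A, and the increments of g telescope to at most r. -/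
lemma sum_powerset_shift_le {g : ℕ → ℝ} (h0 : ∀ k, 0 ≤ g k) (h1 : ∀ k, g k ≤ 1)
    (hg : Monotone g) (r : ℕ) {α : Type*} (A : Finset α) (hA : 0 < A.card) :
    ∑ S ∈ A.powerset, (g (S.card + r) - g S.card) ≤ 2 ^ A.card * (r / √A.card) := by
  rw [Finset.sum_powerset_apply_card (fun k => g (k + r) - g k)]
  have hQ : (0 : ℝ) < √A.card := Real.sqrt_pos.2 (by exact_mod_cast hA)
  have hc : ∀ k, (A.card.choose k : ℝ) ≤ 2 ^ A.card / √A.card := fun k => by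
    rw [le_div_iff₀ hQ]
    refine le_of_sq_le_sq ?_ (by positivity)
    rw [mul_pow, Real.sq_sqrt (by positivity), ← pow_mul, mul_comm A.card 2, pow_mul]
    norm_num
    exact_mod_cast choose_sq_mul_le A.card k
  calc ∑ k ∈ Finset.range (A.card + 1), A.card.choose k • (g (k + r) - g k)
      ≤ ∑ k ∈ Finset.range (A.card + 1), 2 ^ A.card / √A.card * (g (k + r) - g k) := by
        refine Finset.sum_le_sum fun k _ => ?_
        rw [nsmul_eq_mul]
        exact mul_le_mul_of_nonneg_right (hc k) (sub_nonneg.2 (hg (by omega)))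
    _ = 2 ^ A.card / √A.card * ∑ k ∈ Finset.range (A.card + 1), (g (k + r) - g k) := by
        rw [Finset.mul_sum]
    _ ≤ 2 ^ A.card / √A.card * r :=
        mul_le_mul_of_nonneg_left (sum_shift_le h0 h1 _ _) (by positivity)
    _ = _ := by ring

end Binomial

section Swaps

variable {N m : ℕ}

/-- Position `l` of the first block. -/
def pa (l : Fin (N - m)) : Fin N := ⟨l.1, by omega⟩
/-- Position `m + l` of the last block. -/
def pb (l : Fin (N - m)) : Fin N := ⟨m + l.1, by omega⟩

lemma pa_ne_pb (hm : N - m ≤ m) (l l' : Fin (N - m)) : pa l ≠ pb l' := by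
  intro h
  have := congrArg Fin.val h
  simp only [pa, pb] at this
  omega

lemma pa_inj {l l' : Fin (N - m)} : pa l = pa l' ↔ l = l' := by
  simp [pa, Fin.ext_iff]

lemma pb_inj {l l' : Fin (N - m)} : pb l = pb l' ↔ l = l' := by
  simp [pb, Fin.ext_iff]

/-- Exchange of the positions `pa l` and `pb l` for `l ∈ S`. -/
def swapFun (S : Finset (Fin (N - m))) (z : Fin N) : Fin N :=
  if h : z.1 < N - m then (if ⟨z.1, h⟩ ∈ S then pb (m := m) ⟨z.1, h⟩ else z)
  else if h : m ≤ z.1 then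
    (if (⟨z.1 - m, by omega⟩ : Fin (N - m)) ∈ S then pa (m := m) ⟨z.1 - m, by omega⟩ else z)
  else z

lemma swapFun_pa (S : Finset (Fin (N - m))) (l : Fin (N - m)) :
    swapFun S (pa l) = if l ∈ S then pb l else pa l := by
  have h : (pa l).1 < N - m := l.2
  rw [swapFun, dif_pos h]
  rfl

lemma swapFun_pb (hm : N - m ≤ m) (S : Finset (Fin (N - m))) (l : Fin (N - m)) :
    swapFun S (pb l) = if l ∈ S then pa l else pb l := by
  have h : ¬ (pb l).1 < N - m := by simp only [pb]; omega
  have h' : m ≤ (pb l).1 := by simp only [pb]; omega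
  have e : (⟨(pb l).1 - m, by have := (pb l).2; omega⟩ : Fin (N - m)) = l :=
    Fin.ext (by simp [pb])
  rw [swapFun, dif_neg h, dif_pos h']
  simp only [e]

lemma pa_pb_cases (m : ℕ) (z : Fin N) :
    (∃ l : Fin (N - m), z = pa l) ∨ (∃ l : Fin (N - m), z = pb l) ∨ (N - m ≤ z.1 ∧ z.1 < m) := by
  have := z.2
  rcases Nat.lt_or_ge z.1 (N - m) with h | h
  · exact Or.inl ⟨⟨z.1, h⟩, rfl⟩
  · rcases Nat.lt_or_ge z.1 m with h' | h'
    · exact Or.inr (Or.inr ⟨h, h'⟩)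
    · exact Or.inr (Or.inl ⟨⟨z.1 - m, by omega⟩, Fin.ext (by simp only [pb]; omega)⟩)

lemma swapFun_mid (S : Finset (Fin (N - m))) {z : Fin N} (h : N - m ≤ z.1) (h' : z.1 < m) :
    swapFun S z = z := by
  rw [swapFun, dif_neg (by omega), dif_neg (by omega)]

lemma swapFun_involutive (hm : N - m ≤ m) (S : Finset (Fin (N - m))) :
    Function.Involutive (swapFun S) := by
  intro z
  rcases pa_pb_cases m z with ⟨l, rfl⟩ | ⟨l, rfl⟩ | ⟨h, h'⟩
  · rw [swapFun_pa]; split_ifs with h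
    · rw [swapFun_pb hm, if_pos h]
    · rw [swapFun_pa, if_neg h]
  · rw [swapFun_pb hm]; split_ifs with h
    · rw [swapFun_pa, if_pos h]
    · rw [swapFun_pb hm, if_neg h]
  · rw [swapFun_mid S h h', swapFun_mid S h h']

/-- Exchange of the positions `pa l` and `pb l` for `l ∈ S`, as a permutation. -/
def swapPerm (hm : N - m ≤ m) (S : Finset (Fin (N - m))) : Equiv.Perm (Fin N) :=
  (swapFun_involutive hm S).toPerm

lemma swapPerm_empty (hm : N - m ≤ m) : swapPerm (N := N) hm ∅ = 1 := by
  ext z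
  show (swapFun ∅ z).1 = z.1
  rcases pa_pb_cases m z with ⟨l, rfl⟩ | ⟨l, rfl⟩ | ⟨h, h'⟩
  · simp [swapFun_pa]
  · simp [swapFun_pb hm]
  · rw [swapFun_mid _ h h']

lemma swapPerm_insert (hm : N - m ≤ m) (S : Finset (Fin (N - m))) {l : Fin (N - m)}
    (hl : l ∉ S) : swapPerm hm (insert l S) = swapPerm hm S * Equiv.swap (pa l) (pb l) := by
  refine Equiv.ext fun z => ?_
  show swapFun (insert l S) z = swapFun S (Equiv.swap (pa l) (pb l) z)
  rcases pa_pb_cases m z with ⟨k, rfl⟩ | ⟨k, rfl⟩ | ⟨h, h'⟩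
  · rcases eq_or_ne k l with rfl | hk
    · rw [Equiv.swap_apply_left, swapFun_pa, swapFun_pb hm]; simp [hl]
    · rw [Equiv.swap_apply_of_ne_of_ne (mt pa_inj.1 hk) (pa_ne_pb hm k l), swapFun_pa, swapFun_pa]
      simp [hk]
  · rcases eq_or_ne k l with rfl | hk
    · rw [Equiv.swap_apply_right, swapFun_pa, swapFun_pb hm]; simp [hl]
    · rw [Equiv.swap_apply_of_ne_of_ne (pa_ne_pb hm l k).symm (mt pb_inj.1 hk), swapFun_pb hm,
        swapFun_pb hm]
      simp [hk]
  · rw [Equiv.swap_apply_of_ne_of_ne, swapFun_mid _ h h', swapFun_mid _ h h']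
    · rintro rfl; exact absurd l.2 (not_lt.2 h)
    · rintro rfl; simp only [pb] at h'; omega

lemma ht_mul_swap (σ : Equiv.Perm (Fin N)) {a b : Fin N} {x : ℕ} (ha : a.1 < x) (hb : x ≤ b.1)
    (y : ℕ) : ht (σ * Equiv.swap a b) x y
      = ht σ x y + ((if (σ b).1 < y then 1 else 0) - if (σ a).1 < y then 1 else 0) := by
  have hab : a ≠ b := by rintro rfl; omega
  have e : ht (σ * Equiv.swap a b) x y
      = ∑ z : Fin N, if (Equiv.swap a b z).1 < x ∧ (σ z).1 < y then 1 else 0 := by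
    rw [ht, ← Equiv.sum_comp (Equiv.swap a b)]
    refine Finset.sum_congr rfl fun z _ => ?_
    simp
  have h1 : (if (σ b).1 < y then (1 : ℤ) else 0)
      = ∑ z : Fin N, if z = b then (if (σ z).1 < y then (1 : ℤ) else 0) else 0 := by
    rw [Finset.sum_ite_eq' Finset.univ b]; simp
  have h2 : (if (σ a).1 < y then (1 : ℤ) else 0)
      = ∑ z : Fin N, if z = a then (if (σ z).1 < y then (1 : ℤ) else 0) else 0 := by
    rw [Finset.sum_ite_eq' Finset.univ a]; simp
  rw [e, h1, h2, ht, ← Finset.sum_sub_distrib, ← Finset.sum_add_distrib]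
  refine Finset.sum_congr rfl fun z _ => ?_
  rcases eq_or_ne z a with rfl | hza
  · simp [hab, not_lt.2 hb, ha]
  · rcases eq_or_ne z b with rfl | hzb
    · simp [hza, not_lt.2 hb, ha]
    · simp [Equiv.swap_apply_of_ne_of_ne hza hzb, hza, hzb]

lemma ht_mul_swapPerm (hm : N - m ≤ m) (σ : Equiv.Perm (Fin N)) (S : Finset (Fin (N - m)))
    {x : ℕ} (hx : N - m ≤ x) (hxm : x ≤ m) (y : ℕ) :
    ht (σ * swapPerm hm S) x y = ht σ x y + ∑ l ∈ S,
      ((if (σ (pb l)).1 < y then 1 else 0) - if (σ (pa l)).1 < y then 1 else 0) := by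
  induction S using Finset.induction_on with
  | empty => simp [swapPerm_empty]
  | insert l S hl ih =>
    have h1 : swapPerm hm S (pa l) = pa l := by
      show swapFun S (pa l) = pa l
      rw [swapFun_pa, if_neg hl]
    have h2 : swapPerm hm S (pb l) = pb l := by
      show swapFun S (pb l) = pb l
      rw [swapFun_pb hm, if_neg hl]
    rw [Finset.sum_insert hl, swapPerm_insert hm S hl, ← mul_assoc,
      ht_mul_swap (σ * swapPerm hm S) (a := pa l) (b := pb l) (l.2.trans_le hx)
        (by simp only [pb]; omega), ih, Equiv.Perm.mul_apply, Equiv.Perm.mul_apply, h1, h2]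
    ring

/-- The first position of the pair carries a label `< n`, the second a label `≥ m`. -/
def IsUp (n : ℕ) (σ : Equiv.Perm (Fin N)) (l : Fin (N - m)) : Prop :=
  (σ (pa l)).1 < n ∧ m ≤ (σ (pb l)).1

/-- The first position of the pair carries a label `≥ m`, the second a label `< n`. -/
def IsDown (n : ℕ) (σ : Equiv.Perm (Fin N)) (l : Fin (N - m)) : Prop :=
  m ≤ (σ (pa l)).1 ∧ (σ (pb l)).1 < n

open Classical in
/-- The pairs in the up state. -/
def upSet (m n : ℕ) (σ : Equiv.Perm (Fin N)) : Finset (Fin (N - m)) :=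
  Finset.univ.filter fun l => IsUp n σ l

open Classical in
/-- The pairs in one of the two states. -/
def goodSet (m n : ℕ) (σ : Equiv.Perm (Fin N)) : Finset (Fin (N - m)) :=
  Finset.univ.filter fun l => IsUp n σ l ∨ IsDown n σ l

lemma mem_upSet {n : ℕ} {σ : Equiv.Perm (Fin N)} {l : Fin (N - m)} :
    l ∈ upSet m n σ ↔ IsUp n σ l := by simp [upSet]

lemma mem_goodSet {n : ℕ} {σ : Equiv.Perm (Fin N)} {l : Fin (N - m)} :
    l ∈ goodSet m n σ ↔ IsUp n σ l ∨ IsDown n σ l := by simp [goodSet]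

lemma upSet_subset (n : ℕ) (σ : Equiv.Perm (Fin N)) : upSet m n σ ⊆ goodSet m n σ := by
  exact fun l hl => mem_goodSet.2 (Or.inl (mem_upSet.1 hl))

/-- An exchange turns an up pair into a down pair and conversely. Invariance of the good set is what
allows the states of good pairs to be resampled. -/
lemma goodSet_mul_swapPerm (hm : N - m ≤ m) (n : ℕ) (σ : Equiv.Perm (Fin N))
    (S : Finset (Fin (N - m))) : goodSet m n (σ * swapPerm hm S) = goodSet m n σ := by
  ext l
  have h1 : swapPerm hm S (pa l) = if l ∈ S then pb l else pa l := swapFun_pa S l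
  have h2 : swapPerm hm S (pb l) = if l ∈ S then pa l else pb l := swapFun_pb hm S l
  simp only [mem_goodSet, IsUp, IsDown, Equiv.Perm.mul_apply, h1, h2]
  split_ifs
  · constructor <;> rintro (h | h) <;> tauto
  · rfl

open scoped symmDiff in
-- An up pair contributes 1 and a down pair 0 to the first-block part of every height in the box,
-- and exchanging S changes the set of up pairs from U to U ∆ S. All heights in the box thus move by
-- the same amount.
lemma ht_mul_swapPerm_good (hm : N - m ≤ m) {n : ℕ} (hnJ : N - m ≤ n)
    (σ : Equiv.Perm (Fin N)) {S : Finset (Fin (N - m))} (hS : S ⊆ goodSet m n σ) {x y : ℕ}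
    (hx : n ≤ x) (hxm : x ≤ m) (hy : n ≤ y) (hym : y ≤ m) :
    ht (σ * swapPerm hm S) x y
      = ht σ x y - (upSet m n σ).card + (upSet m n σ ∆ S).card := by
  classical
  rw [ht_mul_swapPerm hm σ S (hnJ.trans hx) hxm]
  have h1 : ∑ l ∈ S,
      ((if (σ (pb l)).1 < y then (1 : ℤ) else 0) - if (σ (pa l)).1 < y then 1 else 0)
      = ∑ l ∈ S, (1 - 2 * if l ∈ upSet m n σ then 1 else 0) := by
    refine Finset.sum_congr rfl fun l hl => ?_
    have h2 := hS hl
    simp only [mem_goodSet, mem_upSet, IsUp, IsDown] at h2 ⊢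
    split_ifs <;> omega
  have h3 : ((upSet m n σ ∆ S).card : ℤ) + 2 * (upSet m n σ ∩ S).card
      = (upSet m n σ).card + S.card := by
    have e1 := Finset.card_union_of_disjoint (disjoint_sdiff_sdiff (x := upSet m n σ) (y := S))
    have e2 := Finset.card_sdiff_add_card_inter (upSet m n σ) S
    have e3 := Finset.card_sdiff_add_card_inter S (upSet m n σ)
    rw [Finset.inter_comm] at e3
    have e4 : (upSet m n σ ∆ S).card = ((upSet m n σ \ S) ∪ (S \ upSet m n σ)).card := rfl
    omega
  rw [h1, Finset.sum_sub_distrib, ← Finset.mul_sum, Finset.sum_ite_mem, Finset.inter_comm]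
  simp only [Finset.sum_const, nsmul_eq_mul, mul_one]
  linarith

/-- Randomizing the good pairs preserves the uniform measure. -/
lemma sum_swap_average (hm : N - m ≤ m) (n : ℕ) (f : Equiv.Perm (Fin N) → ℝ) :
    ∑ σ, f σ = ∑ σ, ((2 : ℝ) ^ (goodSet m n σ).card)⁻¹ *
      ∑ S ∈ (goodSet m n σ).powerset, f (σ * swapPerm hm S) := by
  classical
  have h1 : ∀ σ : Equiv.Perm (Fin N), ((2 : ℝ) ^ (goodSet m n σ).card)⁻¹ *
      ∑ S ∈ (goodSet m n σ).powerset, f (σ * swapPerm hm S)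
      = ∑ S : Finset (Fin (N - m)), (fun ρ => if S ⊆ goodSet m n ρ then
        ((2 : ℝ) ^ (goodSet m n ρ).card)⁻¹ * f ρ else 0) (σ * swapPerm hm S) := by
    intro σ
    simp only [goodSet_mul_swapPerm]
    rw [← Finset.sum_filter, Finset.mul_sum]
    refine Finset.sum_congr ?_ fun _ _ => rfl
    ext S; simp
  simp_rw [h1]
  rw [Finset.sum_comm]
  -- For fixed S, right multiplication by the exchange is a bijection, so the sum over permutations
  -- may be re-indexed; the 2^Q subsets of the good set then cancel the normalization.
  simp_rw [fun S : Finset (Fin (N - m)) => sum_mul_right (swapPerm hm S) fun ρ =>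
    if S ⊆ goodSet m n ρ then ((2 : ℝ) ^ (goodSet m n ρ).card)⁻¹ * f ρ else 0]
  rw [Finset.sum_comm]
  refine Finset.sum_congr rfl fun σ _ => ?_
  rw [← Finset.sum_filter, Finset.sum_const]
  have : (Finset.univ.filter fun S => S ⊆ goodSet m n σ) = (goodSet m n σ).powerset := by
    ext S; simp
  rw [this, Finset.card_powerset, nsmul_eq_mul]
  push_cast
  field_simp

end Swaps

/-! ### Abundance of good pairs under the uniform measure -/

section SecondMoment

variable {N m : ℕ}

/-- The images of `k` distinct positions under a uniform permutation are a uniform `k`-tuple of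
distinct labels. -/
lemma card_filter_embedding {k : ℕ} (z : Fin k ↪ Fin N) (T : Finset (Fin k ↪ Fin N)) :
    (Finset.univ.filter fun σ : Equiv.Perm (Fin N) => z.trans σ.toEmbedding ∈ T).card
      * N.descFactorial k = N.factorial * T.card := by
  classical
  -- The symmetric group is transitive on k-tuples of distinct labels, so all fibers have the same
  -- size.
  have hpre : ∀ e e' : Fin k ↪ Fin N, ∃ g : Equiv.Perm (Fin N), e.trans g.toEmbedding = e' := by
    intro e e'
    have hp : MulAction.IsMultiplyPretransitive (Equiv.Perm (Fin N)) (Fin N) k :=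
      Equiv.Perm.isMultiplyPretransitive (Fin N) k
    obtain ⟨g, hg⟩ := MulAction.isMultiplyPretransitive_iff.1 hp e e'
    refine ⟨g, ?_⟩
    rw [← hg]; ext; rfl
  set F : (Fin k ↪ Fin N) → ℕ := fun e =>
    (Finset.univ.filter fun σ : Equiv.Perm (Fin N) => z.trans σ.toEmbedding = e).card with hF
  have hconst : ∀ e e', F e = F e' := by
    intro e e'
    obtain ⟨g, hg⟩ := hpre e e'
    refine Finset.card_bij (fun σ _ => g * σ) ?_ ?_ ?_
    · intro σ hσ
      simp only [Finset.mem_filter, Finset.mem_univ, true_and] at hσ ⊢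
      rw [← hg, ← hσ]; ext; rfl
    · intro σ _ σ' _ h; exact mul_left_cancel h
    · intro σ hσ
      refine ⟨g⁻¹ * σ, ?_, by simp⟩
      simp only [Finset.mem_filter, Finset.mem_univ, true_and] at hσ ⊢
      rw [← hg] at hσ
      ext i
      have := congrArg (fun e : Fin k ↪ Fin N => (g⁻¹ (e i)).val) hσ
      simpa using this
  have hsum : ∀ T : Finset (Fin k ↪ Fin N),
      (Finset.univ.filter fun σ : Equiv.Perm (Fin N) => z.trans σ.toEmbedding ∈ T).card
        = T.card * F z := by
    intro T
    rw [Finset.card_eq_sum_card_fiberwise (f := fun σ : Equiv.Perm (Fin N) =>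
      z.trans σ.toEmbedding) (t := T)]
    · rw [Finset.sum_const_nat (m := F z)]
      intro e he
      rw [hconst z e, hF]
      congr 1
      ext σ
      simp only [Finset.mem_filter, Finset.mem_univ, true_and]
      constructor
      · rintro ⟨_, h⟩; exact h
      · intro h; exact ⟨h ▸ he, h⟩
    · intro σ hσ
      simpa using hσ
  have htot := hsum Finset.univ
  simp only [Finset.mem_univ, Finset.filter_true, Finset.card_univ, Fintype.card_perm,
    Fintype.card_fin, Fintype.card_embedding_eq] at htot
  rw [hsum, htot]; ring

/-- The pair of labels pattern of an up pair. -/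
def upPatterns (N m n : ℕ) : Finset (Fin 2 ↪ Fin N) :=
  Finset.univ.filter fun e => (e 0).1 < n ∧ m ≤ (e 1).1

lemma le_card_upPatterns {n : ℕ} (hnm : n ≤ m) (hm : m ≤ N) :
    n * (N - m) ≤ (upPatterns N m n).card := by
  have hne : ∀ (a : Fin n) (b : Fin (N - m)),
      (⟨a.1, by omega⟩ : Fin N) ≠ ⟨m + b.1, by omega⟩ := by
    intro a b h
    have := congrArg Fin.val h
    simp only at this
    omega
  set Ψ : Fin n × Fin (N - m) → (Fin 2 ↪ Fin N) := fun p =>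
    ⟨![⟨p.1.1, by omega⟩, ⟨m + p.2.1, by omega⟩], by
      intro i j h
      fin_cases i <;> fin_cases j <;> simp at h ⊢ <;> omega⟩ with hΨ
  have h1 : (Finset.univ.image Ψ).card = n * (N - m) := by
    rw [Finset.card_image_of_injective, Finset.card_univ, Fintype.card_prod, Fintype.card_fin,
      Fintype.card_fin]
    intro p q h
    have h0 := congrArg (fun e : Fin 2 ↪ Fin N => (e 0).val) h
    have h1 := congrArg (fun e : Fin 2 ↪ Fin N => (e 1).val) h
    have h0 : p.1.1 = q.1.1 := h0
    have h1 : m + p.2.1 = m + q.2.1 := h1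
    exact Prod.ext (Fin.ext h0) (Fin.ext (by omega))
  rw [← h1]
  refine Finset.card_le_card fun e he => ?_
  obtain ⟨p, _, rfl⟩ := Finset.mem_image.1 he
  rw [upPatterns, Finset.mem_filter]
  refine ⟨Finset.mem_univ _, ?_⟩
  show p.1.1 < n ∧ m ≤ m + p.2.1
  omega

open Classical in
/-- Number of up pairs, as a real number. -/
def upCount (m n : ℕ) (σ : Equiv.Perm (Fin N)) : ℝ :=
  ∑ l : Fin (N - m), if IsUp n σ l then 1 else 0

lemma upCount_le_card_goodSet (n : ℕ) (σ : Equiv.Perm (Fin N)) :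
    upCount m n σ ≤ (goodSet m n σ).card := by
  classical
  have h : upCount m n σ = (upSet m n σ).card := by
    simp [upCount, upSet]
  rw [h]
  exact_mod_cast Finset.card_le_card (upSet_subset n σ)

open Classical in
lemma sum_isUp (hm : N - m ≤ m) (hN : 2 ≤ N) (n : ℕ) (l : Fin (N - m)) :
    ∑ σ : Equiv.Perm (Fin N), (if IsUp n σ l then (1 : ℝ) else 0)
      = N.factorial * ((upPatterns N m n).card / (N * (N - 1))) := by
  have h := card_filter_embedding (⟨![pa l, pb l], by
      intro i j h
      have := pa_ne_pb hm l l
      fin_cases i <;> fin_cases j <;> simp_all [eq_comm]⟩ : Fin 2 ↪ Fin N) (upPatterns N m n)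
  have h2 : (Finset.univ.filter fun σ : Equiv.Perm (Fin N) => IsUp n σ l).card * N.descFactorial 2
      = N.factorial * (upPatterns N m n).card := by
    rw [← h]
    congr 2
    ext σ
    rw [Finset.mem_filter, Finset.mem_filter, upPatterns, Finset.mem_filter]
    simp only [Finset.mem_univ, true_and]
    exact Iff.rfl
  have h3 : ((N.descFactorial 2 : ℕ) : ℝ) = N * (N - 1) := by
    rw [show N.descFactorial 2 = N * (N - 1) by simp [Nat.descFactorial]; ring]
    push_cast [Nat.cast_sub (show 1 ≤ N by omega)]; ring
  have hN' : (2 : ℝ) ≤ N := by exact_mod_cast hN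
  have h4 : (N * (N - 1) : ℝ) ≠ 0 := by
    have : (0 : ℝ) < N * (N - 1) := by apply mul_pos <;> linarith
    exact this.ne'
  rw [Finset.sum_boole, ← mul_div_assoc, eq_div_iff h4, ← h3]
  exact_mod_cast h2

open Classical in
-- Dropping the requirement that the labels of the two pairs differ bounds the number of 4-tuples by
-- a square, giving near independence up to the ratio of the denominators.
lemma sum_isUp_mul_isUp (hm : N - m ≤ m) (hN : 4 ≤ N) (n : ℕ) {l l' : Fin (N - m)} (hl : l ≠ l') :
    ∑ σ : Equiv.Perm (Fin N), (if IsUp n σ l then (1 : ℝ) else 0) * (if IsUp n σ l' then 1 else 0)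
      ≤ N.factorial * ((upPatterns N m n).card ^ 2 / (N * (N - 1) * (N - 2) * (N - 3))) := by
  have hpq := pa_ne_pb hm
  have h1 : pa l ≠ pa l' := mt pa_inj.1 hl
  have h2 : pb l ≠ pb l' := mt pb_inj.1 hl
  set T : Finset (Fin 4 ↪ Fin N) := Finset.univ.filter fun e =>
    ((e 0).1 < n ∧ m ≤ (e 1).1) ∧ ((e 2).1 < n ∧ m ≤ (e 3).1) with hT
  have h := card_filter_embedding (⟨![pa l, pb l, pa l', pb l'], by
      intro i j h
      have := hpq l l
      have := hpq l l'
      have := hpq l' l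
      have := hpq l' l'
      fin_cases i <;> fin_cases j <;> simp_all [eq_comm]⟩ : Fin 4 ↪ Fin N) T
  have h3 : (Finset.univ.filter fun σ : Equiv.Perm (Fin N) => IsUp n σ l ∧ IsUp n σ l').card
      * N.descFactorial 4 = N.factorial * T.card := by
    rw [← h]
    congr 2
    ext σ
    rw [Finset.mem_filter, Finset.mem_filter, hT, Finset.mem_filter]
    simp only [Finset.mem_univ, true_and]
    exact Iff.rfl
  have hTc : T.card ≤ (upPatterns N m n).card ^ 2 := by
    rw [sq, ← Finset.card_product]
    have e01 : Function.Injective ![(0 : Fin 4), 1] := by decide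
    have e23 : Function.Injective ![(2 : Fin 4), 3] := by decide
    refine Finset.card_le_card_of_injOn (fun e => ((⟨_, e01⟩ : Fin 2 ↪ Fin 4).trans e,
      (⟨_, e23⟩ : Fin 2 ↪ Fin 4).trans e)) ?_ ?_
    · intro e he
      simp only [hT, Finset.coe_filter, Finset.mem_univ, true_and, Set.mem_ofPred_eq] at he
      simpa [upPatterns] using he
    · intro e _ e' _ hee
      simp only [Prod.mk.injEq] at hee
      ext i
      have a0 := congrArg (fun e : Fin 2 ↪ Fin N => (e 0).val) hee.1
      have a1 := congrArg (fun e : Fin 2 ↪ Fin N => (e 1).val) hee.1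
      have a2 := congrArg (fun e : Fin 2 ↪ Fin N => (e 0).val) hee.2
      have a3 := congrArg (fun e : Fin 2 ↪ Fin N => (e 1).val) hee.2
      fin_cases i <;> simpa using by assumption
  have h4 : ((N.descFactorial 4 : ℕ) : ℝ) = N * (N - 1) * (N - 2) * (N - 3) := by
    rw [show N.descFactorial 4 = N * (N - 1) * (N - 2) * (N - 3) by simp [Nat.descFactorial]; ring]
    push_cast [Nat.cast_sub (show 1 ≤ N by omega), Nat.cast_sub (show 2 ≤ N by omega),
      Nat.cast_sub (show 3 ≤ N by omega)]; ring
  have hN' : (4 : ℝ) ≤ N := by exact_mod_cast hN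
  have h5 : (0 : ℝ) < N * (N - 1) * (N - 2) * (N - 3) := by
    apply mul_pos (mul_pos (mul_pos _ _) _) <;> linarith
  have h6 : ∑ σ : Equiv.Perm (Fin N),
      (if IsUp n σ l then (1 : ℝ) else 0) * (if IsUp n σ l' then 1 else 0)
      = ((Finset.univ.filter fun σ : Equiv.Perm (Fin N) =>
        IsUp n σ l ∧ IsUp n σ l').card : ℝ) := by
    rw [← Finset.sum_boole]
    refine Finset.sum_congr rfl fun σ _ => ?_
    split_ifs <;> simp_all
  rw [h6, ← mul_div_assoc, le_div_iff₀ h5, ← h4]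
  exact_mod_cast h3.le.trans (Nat.mul_le_mul_left _ hTc)

open Classical in
/-- Most permutations have many good pairs. -/
lemma card_few_good_le (hm : N - m ≤ m) (hmN : m < N) {n : ℕ} (hn : 0 < n) (hnm : n ≤ m)
    (hN : 10 ≤ N) {c : ℝ} (hc : c = (N - m : ℕ) ^ 2 * n / N ^ 2) :
    ((Finset.univ.filter fun σ : Equiv.Perm (Fin N) => ((goodSet m n σ).card : ℝ) < c / 2).card : ℝ)
      ≤ N.factorial * (4 / c + 32 / N) := by
  set J : ℝ := ((N - m : ℕ) : ℝ) with hJ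
  set p : ℝ := (upPatterns N m n).card / (N * (N - 1)) with hp
  have hN' : (10 : ℝ) ≤ N := by exact_mod_cast hN
  have hJ0 : 0 < J := by rw [hJ]; exact_mod_cast (by omega : 0 < N - m)
  have hn0 : (0 : ℝ) < n := by exact_mod_cast hn
  have hf0 : (0 : ℝ) < N.factorial := by exact_mod_cast Nat.factorial_pos N
  have hpat : (n : ℝ) * J ≤ (upPatterns N m n).card := by
    rw [hJ]; exact_mod_cast le_card_upPatterns hnm hmN.le
  have hden : (0 : ℝ) < N * (N - 1) := by apply mul_pos <;> linarith
  have hp_le : n * J / N ^ 2 ≤ p := by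
    rw [hp]
    refine div_le_div₀ (by positivity) hpat hden ?_
    nlinarith
  have hp0 : 0 < p := lt_of_lt_of_le (by positivity) hp_le
  have hc0 : 0 < c := by rw [hc]; positivity
  have hcJ : c ≤ J * p := by
    rw [hc]
    calc J ^ 2 * n / N ^ 2 = J * (n * J / N ^ 2) := by ring
      _ ≤ _ := mul_le_mul_of_nonneg_left hp_le hJ0.le
  set X : Equiv.Perm (Fin N) → ℝ := upCount m n with hX
  have hcardP : ((Finset.univ : Finset (Equiv.Perm (Fin N))).card : ℝ) = N.factorial := by
    rw [Finset.card_univ, Fintype.card_perm, Fintype.card_fin]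
  have hS1 : ∑ σ, X σ = N.factorial * (J * p) := by
    rw [hX]
    simp only [upCount]
    rw [Finset.sum_comm, Finset.sum_congr rfl fun l _ => sum_isUp hm (by omega) n l]
    simp only [Finset.sum_const, Finset.card_univ, Fintype.card_fin, nsmul_eq_mul]
    ring
  have hS2 : ∑ σ, X σ ^ 2 ≤ N.factorial * (J * p + J ^ 2 * (p ^ 2 * (1 + 8 / N))) := by
    have e : ∀ σ, X σ ^ 2 = ∑ l : Fin (N - m), ∑ l' : Fin (N - m),
        (if IsUp n σ l then (1 : ℝ) else 0) * (if IsUp n σ l' then 1 else 0) := fun σ => by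
      rw [hX, sq, upCount, Finset.sum_mul_sum]
    simp_rw [e]
    rw [Finset.sum_comm]
    simp_rw [fun l : Fin (N - m) => Finset.sum_comm (s := (Finset.univ : Finset
      (Equiv.Perm (Fin N)))) (t := Finset.univ) (f := fun σ (l' : Fin (N - m)) =>
      (if IsUp n σ l then (1 : ℝ) else 0) * (if IsUp n σ l' then 1 else 0))]
    have hb : ∀ l l' : Fin (N - m), ∑ σ : Equiv.Perm (Fin N),
        (if IsUp n σ l then (1 : ℝ) else 0) * (if IsUp n σ l' then 1 else 0)
        ≤ (if l = l' then N.factorial * p else 0)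
          + N.factorial * (p ^ 2 * (1 + 8 / N)) := by
      intro l l'
      have hpos : 0 ≤ N.factorial * (p ^ 2 * (1 + 8 / N : ℝ)) := by positivity
      by_cases hl : l = l'
      · subst hl
        rw [if_pos rfl]
        have : ∑ σ : Equiv.Perm (Fin N),
            (if IsUp n σ l then (1 : ℝ) else 0) * (if IsUp n σ l then 1 else 0)
            = N.factorial * p := by
          rw [hp, ← sum_isUp hm (by omega) n l]
          refine Finset.sum_congr rfl fun σ _ => ?_
          split_ifs <;> simp
        linarith
      · rw [if_neg hl, zero_add]
        refine (sum_isUp_mul_isUp hm (by omega) n hl).trans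
          (mul_le_mul_of_nonneg_left ?_ hf0.le)
        have h5 : (0 : ℝ) < N * (N - 1) * (N - 2) * (N - 3) := by
          apply mul_pos (mul_pos (mul_pos _ _) _) <;> linarith
        have h6 : (0 : ℝ) < (N - 2) * (N - 3) := by apply mul_pos <;> linarith
        have h7 : ((upPatterns N m n).card : ℝ) = p * (N * (N - 1)) := by
          rw [hp, div_mul_cancel₀ _ hden.ne']
        have h8 : ((upPatterns N m n).card ^ 2 / (N * (N - 1) * (N - 2) * (N - 3)) : ℝ)
            = p ^ 2 * ((N * (N - 1)) / ((N - 2) * (N - 3))) := by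
          rw [h7]
          have : (N : ℝ) - 1 ≠ 0 := by linarith
          have : (N : ℝ) - 2 ≠ 0 := by linarith
          have : (N : ℝ) - 3 ≠ 0 := by linarith
          have : (N : ℝ) ≠ 0 := by linarith
          field_simp
        rw [h8]
        refine mul_le_mul_of_nonneg_left ?_ (sq_nonneg p)
        have h9 : (1 + 8 / N : ℝ) = (N + 8) / N := by
          have : (N : ℝ) ≠ 0 := by linarith
          field_simp
        rw [h9, div_le_div_iff₀ h6 (by linarith)]
        nlinarith
    refine (Finset.sum_le_sum fun l _ => Finset.sum_le_sum fun l' _ => hb l l').trans ?_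
    simp only [Finset.sum_add_distrib, Finset.sum_ite_eq, Finset.mem_univ, if_true,
      Finset.sum_const, Finset.card_univ, Fintype.card_fin, nsmul_eq_mul]
    rw [← hJ]
    apply le_of_eq; ring
  have hVar : ∑ σ, (X σ - J * p) ^ 2 ≤ N.factorial * (J * p + J ^ 2 * p ^ 2 * (8 / N)) := by
    have e : ∑ σ, (X σ - J * p) ^ 2
        = ∑ σ, X σ ^ 2 - 2 * (J * p) * ∑ σ, X σ + N.factorial * (J * p) ^ 2 := by
      simp only [sub_sq, Finset.sum_add_distrib, Finset.sum_sub_distrib, Finset.sum_const,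
        nsmul_eq_mul, hcardP, Finset.mul_sum]
      congr 2
      exact Finset.sum_congr rfl fun σ _ => by ring
    rw [e, hS1]
    linarith
  -- Chebyshev at half the mean: c is at most the mean J p of the up count, so fewer than c/2 good
  -- pairs forces a deviation of J p / 2.
  set S := Finset.univ.filter fun σ : Equiv.Perm (Fin N) => ((goodSet m n σ).card : ℝ) < c / 2
  have hcheb : (S.card : ℝ) * (J * p / 2) ^ 2 ≤ ∑ σ, (X σ - J * p) ^ 2 := by
    rw [← nsmul_eq_mul, ← Finset.sum_const]
    refine (Finset.sum_le_sum fun σ hσ => ?_).trans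
      (Finset.sum_le_sum_of_subset_of_nonneg (Finset.subset_univ S) fun _ _ _ => sq_nonneg _)
    have h1 := (Finset.mem_filter.1 hσ).2
    have h2 : X σ ≤ (goodSet m n σ).card := upCount_le_card_goodSet n σ
    have h3 : J * p / 2 ≤ J * p - X σ := by linarith
    calc (J * p / 2) ^ 2 ≤ (J * p - X σ) ^ 2 := pow_le_pow_left₀ (by positivity) h3 2
      _ = _ := by ring
  have hJp : 0 < J * p := mul_pos hJ0 hp0
  have h1 : (S.card : ℝ) ≤ N.factorial * (4 / (J * p) + 32 / N) := by
    have h2 := hcheb.trans hVar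
    have h3 : N.factorial * (J * p + J ^ 2 * p ^ 2 * (8 / N))
        = (N.factorial * (4 / (J * p) + 32 / N)) * (J * p / 2) ^ 2 := by
      have : (N : ℝ) ≠ 0 := by linarith
      field_simp
      ring
    rw [h3] at h2
    exact le_of_mul_le_mul_right h2 (by positivity)
  refine h1.trans (mul_le_mul_of_nonneg_left ?_ hf0.le)
  gcongr

end SecondMoment

/-! ### Smoothing of monotone functions of heights by resampled pairs -/

section Shift

variable {N m : ℕ}

open scoped symmDiff in
-- Given everything but the states of the good pairs, the heights in S depend only on the number of
-- up pairs, which is binomial. So F becomes a monotone function of that number, and G is bounded by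
-- the same function shifted by r.
lemma sum_swaps_le (hm : N - m ≤ m) {n : ℕ} (hnJ : N - m ≤ n) {S : Set (ℕ × ℕ)}
    (hS : ∀ p ∈ S, (n ≤ p.1 ∧ p.1 ≤ m) ∧ (n ≤ p.2 ∧ p.2 ≤ m)) {F G : Equiv.Perm (Fin N) → ℝ}
    (hF : ∀ σ σ', (∀ p ∈ S, ht σ p.1 p.2 ≤ ht σ' p.1 p.2) → F σ ≤ F σ')
    (hF0 : ∀ σ, 0 ≤ F σ) (hF1 : ∀ σ, F σ ≤ 1) (hG1 : ∀ σ, G σ ≤ 1) {r : ℕ}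
    (hG : ∀ σ σ', (∀ p ∈ S, ht σ p.1 p.2 + r ≤ ht σ' p.1 p.2) → G σ ≤ F σ')
    (σ : Equiv.Perm (Fin N)) (hpos : 0 < (goodSet m n σ).card) :
    ∑ A ∈ (goodSet m n σ).powerset, (G (σ * swapPerm hm A) - F (σ * swapPerm hm A))
      ≤ 2 ^ (goodSet m n σ).card * (r / √(goodSet m n σ).card) := by
  classical
  set Q := goodSet m n σ with hQ
  set U := upSet m n σ with hU
  have hUQ : U ⊆ Q := upSet_subset n σ
  have hsd : ∀ A ⊆ Q, U ∆ A ⊆ Q := fun A hA l hl => by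
    rcases Finset.mem_symmDiff.1 hl with h | h
    · exact hUQ h.1
    · exact hA h.1
  have hht : ∀ A ⊆ Q, ∀ p ∈ S, ht (σ * swapPerm hm A) p.1 p.2
      = ht σ p.1 p.2 - U.card + (U ∆ A).card := fun A hA p hp =>
    ht_mul_swapPerm_good hm hnJ σ hA (hS p hp).1.1 (hS p hp).1.2 (hS p hp).2.1 (hS p hp).2.2
  have hV : ∀ k, ∃ V : Finset (Fin (N - m)), k ≤ Q.card → V ⊆ Q ∧ V.card = k := fun k => by
    by_cases hk : k ≤ Q.card
    · obtain ⟨V, h1, h2⟩ := Finset.exists_subset_card_eq hk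
      exact ⟨V, fun _ => ⟨h1, h2⟩⟩
    · exact ⟨∅, fun h => absurd h hk⟩
  choose V hV using hV
  set g : ℕ → ℝ := fun k => if k ≤ Q.card then F (σ * swapPerm hm (U ∆ V k)) else 1 with hg
  have hUV : ∀ k ≤ Q.card, (U ∆ (U ∆ V k)).card = k := fun k hk => by
    rw [symmDiff_symmDiff_cancel_left, (hV k hk).2]
  have hg0 : ∀ k, 0 ≤ g k := fun k => by
    simp only [hg]; split_ifs
    · exact hF0 _
    · exact zero_le_one
  have hg1 : ∀ k, g k ≤ 1 := fun k => by
    simp only [hg]; split_ifs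
    · exact hF1 _
    · exact le_rfl
  have hgm : Monotone g := by
    intro k k' hk
    by_cases h' : k' ≤ Q.card
    · have h := hk.trans h'
      simp only [hg, if_pos h, if_pos h']
      refine hF _ _ fun p hp => ?_
      rw [hht _ (hsd _ (hV k h).1) p hp, hht _ (hsd _ (hV k' h').1) p hp, hUV k h, hUV k' h']
      have : (k : ℤ) ≤ k' := by exact_mod_cast hk
      linarith
    · have : g k' = 1 := by simp only [hg, if_neg h']
      rw [this]; exact hg1 k
  have hterm : ∀ A ∈ Q.powerset, G (σ * swapPerm hm A) - F (σ * swapPerm hm A)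
      ≤ g ((U ∆ A).card + r) - g (U ∆ A).card := by
    intro A hA
    rw [Finset.mem_powerset] at hA
    have hk : (U ∆ A).card ≤ Q.card := Finset.card_le_card (hsd A hA)
    have h1 : g (U ∆ A).card ≤ F (σ * swapPerm hm A) := by
      simp only [hg, if_pos hk]
      refine hF _ _ fun p hp => ?_
      rw [hht _ (hsd _ (hV _ hk).1) p hp, hht _ hA p hp, hUV _ hk]
    have h2 : G (σ * swapPerm hm A) ≤ g ((U ∆ A).card + r) := by
      by_cases h : (U ∆ A).card + r ≤ Q.card
      · simp only [hg, if_pos h]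
        refine hG _ _ fun p hp => ?_
        rw [hht _ (hsd _ (hV _ h).1) p hp, hht _ hA p hp, hUV _ h]
        push_cast; linarith
      · simp only [hg, if_neg h]; exact hG1 _
    linarith
  refine (Finset.sum_le_sum hterm).trans ?_
  -- Symmetric difference with U is an involution of the subsets of Q, so the up set is itself a
  -- uniform subset.
  have hre : ∑ A ∈ Q.powerset, (g ((U ∆ A).card + r) - g (U ∆ A).card)
      = ∑ A ∈ Q.powerset, (g (A.card + r) - g A.card) := by
    refine Finset.sum_nbij' (fun A => U ∆ A) (fun A => U ∆ A) ?_ ?_ ?_ ?_ ?_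
    · intro A hA; rw [Finset.mem_powerset] at *; exact hsd A hA
    · intro A hA; rw [Finset.mem_powerset] at *; exact hsd A hA
    · intro A _; exact symmDiff_symmDiff_cancel_left U A
    · intro A _; exact symmDiff_symmDiff_cancel_left U A
    · intro A _; rfl
  rw [hre]
  exact sum_powerset_shift_le hg0 hg1 hgm r Q hpos

/-- Shifting the heights in the box `[n, m]²` by `r` hardly changes the mean of a monotone
function of them. -/
lemma sum_shift_heights_le (hm : N - m ≤ m) (hmN : m < N) {n : ℕ} (hnJ : N - m ≤ n)
    (hnm : n ≤ m) (hN : 10 ≤ N) {S : Set (ℕ × ℕ)}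
    (hS : ∀ p ∈ S, (n ≤ p.1 ∧ p.1 ≤ m) ∧ (n ≤ p.2 ∧ p.2 ≤ m)) {F G : Equiv.Perm (Fin N) → ℝ}
    (hF : ∀ σ σ', (∀ p ∈ S, ht σ p.1 p.2 ≤ ht σ' p.1 p.2) → F σ ≤ F σ')
    (hF0 : ∀ σ, 0 ≤ F σ) (hF1 : ∀ σ, F σ ≤ 1) (hG1 : ∀ σ, G σ ≤ 1) {r : ℕ}
    (hG : ∀ σ σ', (∀ p ∈ S, ht σ p.1 p.2 + r ≤ ht σ' p.1 p.2) → G σ ≤ F σ')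
    {c : ℝ} (hc : c = (N - m : ℕ) ^ 2 * n / N ^ 2) :
    ∑ σ, G σ ≤ ∑ σ, F σ + N.factorial * (r / √(c / 2) + 4 / c + 32 / N) := by
  classical
  have hn : 0 < n := by omega
  have hc0 : 0 < c := by
    have h1 : (0 : ℝ) < ((N - m : ℕ) : ℝ) := by exact_mod_cast (by omega : 0 < N - m)
    have h2 : (0 : ℝ) < n := by exact_mod_cast hn
    have h3 : (0 : ℝ) < N := by exact_mod_cast (by omega : 0 < N)
    rw [hc]; positivity
  have hb : ∀ σ : Equiv.Perm (Fin N), ((2 : ℝ) ^ (goodSet m n σ).card)⁻¹ *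
      ∑ A ∈ (goodSet m n σ).powerset, (G (σ * swapPerm hm A) - F (σ * swapPerm hm A))
      ≤ r / √(c / 2) + if ((goodSet m n σ).card : ℝ) < c / 2 then 1 else 0 := by
    intro σ
    have hr0 : 0 ≤ r / √(c / 2) := by positivity
    rw [inv_mul_le_iff₀ (by positivity)]
    split_ifs with h
    · have h1 : ∑ A ∈ (goodSet m n σ).powerset,
          (G (σ * swapPerm hm A) - F (σ * swapPerm hm A))
          ≤ ∑ A ∈ (goodSet m n σ).powerset, (1 : ℝ) :=
        Finset.sum_le_sum fun A _ => by linarith [hF0 (σ * swapPerm hm A), hG1 (σ * swapPerm hm A)]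
      rw [Finset.sum_const, Finset.card_powerset, nsmul_eq_mul, mul_one] at h1
      push_cast at h1
      refine h1.trans (le_mul_of_one_le_right (by positivity) (by linarith))
    · rw [not_lt] at h
      have hpos : 0 < (goodSet m n σ).card := by
        have : (0 : ℝ) < (goodSet m n σ).card := by linarith
        exact_mod_cast this
      refine (sum_swaps_le hm hnJ hS hF hF0 hF1 hG1 hG σ hpos).trans ?_
      rw [add_zero]
      gcongr
  have h1 : ∑ σ, G σ - ∑ σ, F σ ≤ ∑ σ : Equiv.Perm (Fin N),
      (r / √(c / 2) + if ((goodSet m n σ).card : ℝ) < c / 2 then 1 else 0) := by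
    rw [← Finset.sum_sub_distrib, sum_swap_average hm n]
    exact Finset.sum_le_sum fun σ _ => hb σ
  rw [Finset.sum_add_distrib, Finset.sum_boole, Finset.sum_const, Finset.card_univ,
    Fintype.card_perm, Fintype.card_fin, nsmul_eq_mul] at h1
  have h2 := card_few_good_le hm hmN hn hnm hN hc
  linarith

end Shift

/-! ### Equilibration of increasing functions started from the identity -/

section UpperBound

variable {N : ℕ}

/-- The case of one block: the only cuts are 0 and points from N on, where all permutations have
equal heights. -/
lemma Pt_Hf_sub_le_univ (hN : 0 < N) (σ σ' : Equiv.Perm (Fin N)) {t : ℝ} (ht0 : 0 ≤ t) (x y : ℕ) :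
    Pt N Finset.univ t (Hf N x y) σ - Pt N Finset.univ t (Hf N x y) σ'
      ≤ N / 2 * Real.exp (-lam N * t) := by
  have := Pt_Hf_sub_le (n := N) hN (σ := σ) (σ' := σ') (y := y) (fun i => ?_) ht0 x
  · rwa [blockEdges_self] at this
  · rcases Nat.eq_zero_or_pos i with rfl | hi
    · simp
    · have : N ≤ N * i := Nat.le_mul_of_pos_right N hi
      rw [ht_of_le σ this, ht_of_le σ' this]

/-- The shuffle started from the identity almost equilibrates functions of finitely many heights. -/
lemma Pt_heights_le {m : ℕ} (hm : N - m ≤ m) (hmN : m < N) {n : ℕ} (hnJ : N - m ≤ n)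
    (hnm : n ≤ m) (hN : 10 ≤ N) {S : Finset (ℕ × ℕ)}
    (hS : ∀ p ∈ S, (n ≤ p.1 ∧ p.1 ≤ m) ∧ (n ≤ p.2 ∧ p.2 ≤ m)) {F : Equiv.Perm (Fin N) → ℝ}
    (hF : ∀ σ σ', (∀ p ∈ S, ht σ p.1 p.2 ≤ ht σ' p.1 p.2) → F σ ≤ F σ')
    (hF0 : ∀ σ, 0 ≤ F σ) (hF1 : ∀ σ, F σ ≤ 1) {r : ℕ} (hr : 0 < r)
    {c : ℝ} (hc : c = (N - m : ℕ) ^ 2 * n / N ^ 2) {t : ℝ} (ht0 : 0 ≤ t) :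
    N.factorial * Pt N Finset.univ t F 1 ≤ ∑ σ, F σ + N.factorial *
      (S.card * (N / 2 * Real.exp (-lam N * t)) / r + (r / √(c / 2) + 4 / c + 32 / N)) := by
  classical
  set W : Equiv.Perm (Fin N) → ℝ := ∑ p ∈ S, Hf N p.1 p.2 with hW
  have hWapp : ∀ σ, W σ = ((∑ p ∈ S, ht σ p.1 p.2 : ℤ) : ℝ) := fun σ => by
    simp [hW, Hf, Finset.sum_apply]
  have hr' : (0 : ℝ) < r := by exact_mod_cast hr
  set D : Equiv.Perm (Fin N) → Finset (Equiv.Perm (Fin N)) := fun σ =>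
    Finset.univ.filter fun σ' => HLe Set.univ σ σ' with hD
  have hDmem : ∀ {σ σ'}, σ' ∈ D σ ↔ HLe Set.univ σ σ' := fun {σ σ'} => by simp [hD]
  have hDne : ∀ σ, (D σ).Nonempty := fun σ => ⟨σ, hDmem.2 (HLe.refl σ)⟩
  -- The least decreasing function above F - W/r. Its mean from the identity cannot exceed its
  -- uniform mean, as the identity is the maximum.
  set g : Equiv.Perm (Fin N) → ℝ := fun σ => (D σ).sup' (hDne σ) fun σ' => F σ' - W σ' / r with hg
  have hgle : ∀ {σ σ'}, HLe Set.univ σ σ' → F σ' - W σ' / r ≤ g σ := fun {σ σ'} h =>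
    Finset.le_sup' (fun σ' => F σ' - W σ' / r) (hDmem.2 h)
  have hganti : Incr Set.univ (-g) := by
    intro σ σ' h
    refine neg_le_neg (Finset.sup'_le _ _ fun τ hτ => hgle (h.trans (hDmem.1 hτ)))
  have hPg : N.factorial * Pt N Finset.univ t g 1 ≤ ∑ σ, g σ := by
    have h1 := hganti.Pt Finset.univ ht0
    have h2 : ∀ σ, Pt N Finset.univ t g 1 ≤ Pt N Finset.univ t g σ := fun σ => by
      have := h1 (HLe.one σ)
      rw [map_neg] at this
      exact neg_le_neg_iff.1 this
    have h3 := Finset.sum_le_sum fun σ (_ : σ ∈ Finset.univ) => h2 σ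
    rw [sum_Pt, Finset.sum_const, Finset.card_univ, Fintype.card_perm, Fintype.card_fin,
      nsmul_eq_mul] at h3
    exact h3
  have hGshift : ∑ σ, (g σ + W σ / r)
      ≤ ∑ σ, F σ + N.factorial * (r / √(c / 2) + 4 / c + 32 / N) := by
    refine sum_shift_heights_le hm hmN hnJ hnm hN (S := ↑S) hS hF hF0 hF1 (fun σ => ?_)
      (fun σ σ'' hσ => ?_) hc
    · rw [← le_sub_iff_add_le]
      refine Finset.sup'_le _ _ fun σ' hσ' => ?_
      have hle : W σ ≤ W σ' := by
        rw [hWapp, hWapp]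
        exact_mod_cast Finset.sum_le_sum fun (p : ℕ × ℕ) _ => hDmem.1 hσ' p.1 p.2 trivial
      have := div_le_div_of_nonneg_right hle hr'.le
      linarith [hF1 σ']
    · rw [← le_sub_iff_add_le]
      refine Finset.sup'_le _ _ fun σ' hσ' => ?_
      -- If W rises by r or more between σ and σ', the penalty W/r exceeds the range of F. Otherwise
      -- no single height rises by more than r, and the shifted permutation dominates σ' on S.
      by_cases hbig : ∑ p ∈ S, ht σ p.1 p.2 + r ≤ ∑ p ∈ S, ht σ' p.1 p.2
      · have h1 : W σ + r ≤ W σ' := by rw [hWapp, hWapp]; exact_mod_cast hbig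
        have h2 : W σ / r + 1 ≤ W σ' / r := by
          rw [← div_self hr'.ne', ← add_div]; exact div_le_div_of_nonneg_right h1 hr'.le
        linarith [hF1 σ', hF0 σ'']
      · have hle : W σ ≤ W σ' := by
          rw [hWapp, hWapp]
          exact_mod_cast Finset.sum_le_sum fun (p : ℕ × ℕ) _ => hDmem.1 hσ' p.1 p.2 trivial
        have h2 := div_le_div_of_nonneg_right hle hr'.le
        have h3 : F σ' ≤ F σ'' := by
          refine hF _ _ fun p hp => (le_trans ?_ (hσ p hp))
          have h4 : ht σ' p.1 p.2 - ht σ p.1 p.2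
              ≤ ∑ p ∈ S, (ht σ' p.1 p.2 - ht σ p.1 p.2) :=
            Finset.single_le_sum (f := fun p : ℕ × ℕ => ht σ' p.1 p.2 - ht σ p.1 p.2)
              (fun p _ => sub_nonneg.2 (hDmem.1 hσ' p.1 p.2 trivial)) hp
          rw [Finset.sum_sub_distrib] at h4
          omega
        linarith
  have hsplit : Pt N Finset.univ t F 1 ≤ Pt N Finset.univ t g 1 + Pt N Finset.univ t W 1 / r := by
    have h1 : F ≤ g + (r : ℝ)⁻¹ • W := fun σ => by
      have := hgle (HLe.refl σ)
      simp only [Pi.add_apply, Pi.smul_apply, smul_eq_mul]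
      rw [inv_mul_eq_div]; linarith
    have h2 := Pt_mono (C := Finset.univ) ht0 h1 1
    rw [map_add, map_smul] at h2
    simp only [Pi.add_apply, Pi.smul_apply, smul_eq_mul] at h2
    rwa [inv_mul_eq_div] at h2
  have hWdecay : N.factorial * Pt N Finset.univ t W 1 - ∑ σ, W σ
      ≤ N.factorial * (S.card * (N / 2 * Real.exp (-lam N * t))) := by
    have h1 : ∀ σ, Pt N Finset.univ t W 1 - Pt N Finset.univ t W σ
        ≤ S.card * (N / 2 * Real.exp (-lam N * t)) := fun σ => by
      rw [hW, map_sum, Finset.sum_apply, Finset.sum_apply, ← Finset.sum_sub_distrib,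
        ← nsmul_eq_mul]
      exact Finset.sum_le_card_nsmul _ _ _ fun p _ =>
        Pt_Hf_sub_le_univ (by omega) 1 σ ht0 p.1 p.2
    have h2 := Finset.sum_le_sum fun σ (_ : σ ∈ Finset.univ) => h1 σ
    rw [Finset.sum_sub_distrib, sum_Pt, Finset.sum_const, Finset.sum_const, Finset.card_univ,
      Fintype.card_perm, Fintype.card_fin, nsmul_eq_mul, nsmul_eq_mul] at h2
    exact h2
  have hf0 : (0 : ℝ) < N.factorial := by exact_mod_cast Nat.factorial_pos N
  rw [Finset.sum_add_distrib, ← Finset.sum_div] at hGshift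
  have h1 := mul_le_mul_of_nonneg_left hsplit hf0.le
  have h2 := div_le_div_of_nonneg_right hWdecay hr'.le
  rw [sub_div, mul_div_assoc, mul_div_assoc] at h2
  rw [mul_add] at h1
  rw [mul_add (N.factorial : ℝ)]
  linarith

/-- Maximum over the permutations with lower heights at the cuts. -/
lemma exists_cut_max (n : ℕ) (Y : Set ℕ) (f : Equiv.Perm (Fin N) → ℝ) :
    ∃ F : Equiv.Perm (Fin N) → ℝ,
      (∀ σ τ, (∀ i, ∀ y ∈ Y, ht τ (n * i) y ≤ ht σ (n * i) y) → f τ ≤ F σ) ∧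
      ∀ σ, ∃ τ, (∀ i, ∀ y ∈ Y, ht τ (n * i) y ≤ ht σ (n * i) y) ∧ F σ = f τ := by
  classical
  set D : Equiv.Perm (Fin N) → Finset (Equiv.Perm (Fin N)) := fun σ =>
    Finset.univ.filter fun τ => ∀ i, ∀ y ∈ Y, ht τ (n * i) y ≤ ht σ (n * i) y with hD
  have hDmem : ∀ {σ τ}, τ ∈ D σ ↔ ∀ i, ∀ y ∈ Y, ht τ (n * i) y ≤ ht σ (n * i) y :=
    fun {σ τ} => by simp [hD]
  have hDne : ∀ σ, (D σ).Nonempty := fun σ => ⟨σ, hDmem.2 fun _ _ _ => le_rfl⟩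
  refine ⟨fun σ => (D σ).sup' (hDne σ) f, fun σ τ h => Finset.le_sup' f (hDmem.2 h), fun σ => ?_⟩
  obtain ⟨τ, h1, h2⟩ := Finset.exists_mem_eq_sup' (hDne σ) f
  exact ⟨τ, hDmem.1 h1, h2⟩

variable {C : Finset (Fin (N - 1))}

/-- By symmetry, going from 1 to σ is as likely as from σ to 1, which left translation turns into
going from 1 to σ⁻¹. -/
lemma Pt_single_one_inv (t : ℝ) (σ : Equiv.Perm (Fin N)) :
    Pt N C t (Pi.single 1 1) σ⁻¹ = Pt N C t (Pi.single 1 1) σ := by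
  have h1 := Pt_mul_left (C := C) (t := t) σ⁻¹ (Pi.single 1 1) 1
  have h2 : (fun ρ : Equiv.Perm (Fin N) => (Pi.single 1 1 : Equiv.Perm (Fin N) → ℝ) (σ⁻¹ * ρ))
      = Pi.single σ 1 := by
    funext ρ
    simp only [Pi.single_apply, inv_mul_eq_one]
    simp [eq_comm]
  rw [h2, Pt_eq_sum, mul_one] at h1
  rw [← h1]
  simp [Pi.single_apply]

/-- At the identity, shuffling labels is the same as shuffling positions. -/
lemma Pt_Pt_one_eq (s t : ℝ) (D : Finset (Fin (N - 1))) (f : Equiv.Perm (Fin N) → ℝ) :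
    Pt N C s (Pt N D t f) 1 = Pt N D t (fun σ => Pt N C s (fun ρ => f ρ⁻¹) σ⁻¹) 1 := by
  have h1 : (fun σ => Pt N C s (fun ρ => f ρ⁻¹) σ⁻¹)
      = ∑ ρ, Pt N C s (Pi.single 1 1) ρ • fun σ => f (ρ * σ) := by
    funext σ
    have := Pt_mul_left (C := C) (t := s) σ⁻¹ (fun ρ => f ρ⁻¹) 1
    rw [mul_one] at this
    rw [← this, Pt_eq_sum, Finset.sum_apply, ← Equiv.sum_comp (Equiv.inv _)]
    refine Finset.sum_congr rfl fun ρ _ => ?_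
    simp [Pt_single_one_inv]
  rw [h1, map_sum, Finset.sum_apply, Pt_eq_sum]
  refine Finset.sum_congr rfl fun ρ _ => ?_
  rw [map_smul, Pi.smul_apply, smul_eq_mul, Pt_mul_left, mul_one]

/-- Quantitative equilibration of monotone functions. -/
lemma Pt_incr_le {n K : ℕ} (hK : 2 ≤ K) (hmN : n * (K - 1) < N) (hNn : N ≤ n * K) (hN : 10 ≤ N)
    {f : Equiv.Perm (Fin N) → ℝ} (hf : Incr Set.univ f) (hf0 : ∀ σ, 0 ≤ f σ) (hf1 : ∀ σ, f σ ≤ 1)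
    {r : ℕ} (hr : 0 < r) {c : ℝ} (hc : c = (N - n * (K - 1) : ℕ) ^ 2 * n / N ^ 2)
    {t₀ t₁ : ℝ} (h0 : 0 ≤ t₀) (h1 : 0 ≤ t₁) :
    N.factorial * Pt N Finset.univ (t₀ + (t₁ + t₀)) f 1 ≤ ∑ σ, f σ + N.factorial *
      (2 * ((N + 1) ^ 2 * (n / 2 * Real.exp (-lam n * t₀))) +
      (K ^ 2 * (N / 2 * Real.exp (-lam N * t₁)) / r + (r / √(c / 2) + 4 / c + 32 / N))) := by
  have hn : 0 < n := Nat.pos_of_ne_zero fun h => by subst h; omega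
  set B := blockEdges N n
  set E : ℝ := (N + 1) ^ 2 * (n / 2 * Real.exp (-lam n * t₀)) with hE
  set f2 := Pt N B t₀ f with hf2
  obtain ⟨F1, hF1a, hF1b⟩ := exists_cut_max n Set.univ f2
  have hF1mono : ∀ σ σ', (∀ i y, ht σ (n * i) y ≤ ht σ' (n * i) y) → F1 σ ≤ F1 σ' := by
    intro σ σ' h
    obtain ⟨τ, hτ, he⟩ := hF1b σ
    rw [he]
    exact hF1a σ' τ fun i y hy => (hτ i y hy).trans (h i y)
  have hF1le : ∀ σ, F1 σ ≤ f2 σ + E := fun σ => by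
    obtain ⟨τ, hτ, he⟩ := hF1b σ
    rw [he]
    exact block_osc hn hf hf0 hf1 h0 hτ
  have hF1ge : ∀ σ, f2 σ ≤ F1 σ := fun σ => hF1a σ σ fun _ _ _ => le_rfl
  have hF10 : ∀ σ, 0 ≤ F1 σ := fun σ => (const_le_Pt h0 hf0 σ).trans (hF1ge σ)
  have hF11 : ∀ σ, F1 σ ≤ 1 := fun σ => by
    obtain ⟨τ, _, he⟩ := hF1b σ
    rw [he]; exact Pt_le_const h0 hf1 τ
  set Y : Set ℕ := {y | ∃ j, y = n * j} with hY
  -- Inversion exchanges positions and labels: dependence on positions at cuts becomes dependence on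
  -- labels in Y, so the block argument can be repeated.
  set F1i : Equiv.Perm (Fin N) → ℝ := fun σ => F1 σ⁻¹ with hF1i
  have hF1inc : Incr Y F1i := fun σ σ' h => hF1mono _ _ fun i y => by
    rw [ht_inv, ht_inv]; exact h y (n * i) ⟨i, rfl⟩
  set g := Pt N B t₀ F1i with hg
  obtain ⟨Fb, hFba, hFbb⟩ := exists_cut_max n Y g
  have hFble : ∀ σ, Fb σ ≤ g σ + E := fun σ => by
    obtain ⟨τ, hτ, he⟩ := hFbb σ
    rw [he]
    exact block_osc hn hF1inc (fun σ => hF10 _) (fun σ => hF11 _) h0 hτ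
  have hFbge : ∀ σ, g σ ≤ Fb σ := fun σ => hFba σ σ fun _ _ _ => le_rfl
  set F : Equiv.Perm (Fin N) → ℝ := fun σ => Fb σ⁻¹ with hFdef
  -- Only interior cuts matter: heights with an index 0, or at least n K ≥ N, are the same for all
  -- permutations.
  set S : Finset (ℕ × ℕ) := ((Finset.Icc 1 (K - 1)) ×ˢ (Finset.Icc 1 (K - 1))).image
    fun p => (n * p.1, n * p.2) with hSdef
  have hScard : (S.card : ℝ) ≤ K ^ 2 := by
    have h2 : S.card ≤ (K - 1) * (K - 1) := by
      refine Finset.card_image_le.trans ?_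
      simp
    have h3 : (K - 1) * (K - 1) ≤ K ^ 2 := by rw [sq]; exact Nat.mul_le_mul (by omega) (by omega)
    exact_mod_cast h2.trans h3
  have hFmono : ∀ σ σ', (∀ p ∈ S, ht σ p.1 p.2 ≤ ht σ' p.1 p.2) → F σ ≤ F σ' := by
    intro σ σ' h
    obtain ⟨τ, hτ, he⟩ := hFbb σ⁻¹
    show Fb σ⁻¹ ≤ Fb σ'⁻¹
    rw [he]
    refine hFba _ τ fun i y hy => (hτ i y hy).trans ?_
    obtain ⟨j, rfl⟩ := hy
    by_cases hi : 1 ≤ i ∧ i ≤ K - 1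
    · by_cases hj : 1 ≤ j ∧ j ≤ K - 1
      · rw [ht_inv, ht_inv]
        refine h (n * j, n * i) (Finset.mem_image.2 ⟨(j, i), ?_, rfl⟩)
        simp [hi, hj]
      · rw [ht_inv, ht_inv]
        rcases Nat.eq_zero_or_pos j with rfl | hj0
        · simp
        · have := Nat.mul_le_mul_left n (show K ≤ j by omega)
          exact ht_le_of_le _ _ (hNn.trans this) _
    · rcases Nat.eq_zero_or_pos i with rfl | hi0
      · simp
      · have := Nat.mul_le_mul_left n (show K ≤ i by omega)
        exact ht_le_of_le _ _ (hNn.trans this) _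
  have hSbox : ∀ p ∈ S, (n ≤ p.1 ∧ p.1 ≤ n * (K - 1)) ∧ (n ≤ p.2 ∧ p.2 ≤ n * (K - 1)) := by
    intro p hp
    obtain ⟨q, hq, rfl⟩ := Finset.mem_image.1 hp
    rw [Finset.mem_product, Finset.mem_Icc, Finset.mem_Icc] at hq
    exact ⟨⟨Nat.le_mul_of_pos_right n hq.1.1, Nat.mul_le_mul_left n hq.1.2⟩,
      ⟨Nat.le_mul_of_pos_right n hq.2.1, Nat.mul_le_mul_left n hq.2.2⟩⟩
  have hF0 : ∀ σ, 0 ≤ F σ := fun σ =>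
    (const_le_Pt h0 (f := F1i) (fun σ => hF10 _) σ⁻¹).trans (hFbge σ⁻¹)
  have hFle1 : ∀ σ, F σ ≤ 1 := fun σ => by
    obtain ⟨τ, _, he⟩ := hFbb σ⁻¹
    show Fb σ⁻¹ ≤ 1
    rw [he]; exact Pt_le_const h0 (fun σ => hF11 _) τ
  have hKn : N - n * (K - 1) ≤ n := by
    have : n * K = n * (K - 1) + n := by
      rw [← Nat.mul_succ]; congr 1; omega
    omega
  have hnm : n ≤ n * (K - 1) := Nat.le_mul_of_pos_right n (by omega)
  have hmain := Pt_heights_le (hKn.trans hnm) hmN hKn hnm hN hSbox hFmono hF0 hFle1 hr hc h1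
  have hsumF : ∑ σ, F σ ≤ ∑ σ, f σ + N.factorial * (2 * E) := by
    have hcard : ∀ a : ℝ, ∑ _σ : Equiv.Perm (Fin N), a = N.factorial * a := fun a => by
      rw [Finset.sum_const, Finset.card_univ, Fintype.card_perm, Fintype.card_fin, nsmul_eq_mul]
    have e1 : ∑ σ, F σ = ∑ σ, Fb σ := Equiv.sum_comp (Equiv.inv _) Fb
    have e2 : ∑ σ, Fb σ ≤ ∑ σ, g σ + N.factorial * E := by
      rw [← hcard, ← Finset.sum_add_distrib]; exact Finset.sum_le_sum fun σ _ => hFble σ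
    have e3 : ∑ σ, g σ = ∑ σ, F1 σ := by
      rw [hg, sum_Pt]; exact Equiv.sum_comp (Equiv.inv _) F1
    have e4 : ∑ σ, F1 σ ≤ ∑ σ, f2 σ + N.factorial * E := by
      rw [← hcard, ← Finset.sum_add_distrib]; exact Finset.sum_le_sum fun σ _ => hF1le σ
    have e5 : ∑ σ, f2 σ = ∑ σ, f σ := sum_Pt f
    linarith
  set δ : Equiv.Perm (Fin N) → ℝ := Pi.single 1 1 with hδ
  have hδ0 : 0 ≤ δ := by
    intro σ; simp only [hδ, Pi.single_apply, Pi.zero_apply]; split_ifs <;> norm_num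
  have hdot : ∀ h : Equiv.Perm (Fin N) → ℝ, δ ⬝ᵥ h = h 1 := fun h => by
    rw [hδ, single_one_dotProduct]
  have hchain : Pt N Finset.univ (t₀ + (t₁ + t₀)) f 1 ≤ Pt N Finset.univ t₁ F 1 := by
    have hinc := (hf.Pt Finset.univ h0).Pt Finset.univ h1
    have a1 := dotProduct_Pt_le_censored incr_single_one hinc B h0
    -- The last period is censored as well; symmetry of the semigroups moves the earlier evolution
    -- onto the increasing initial mass.
    have a2 := dotProduct_Pt_le_censored ((incr_single_one.Pt B h0).Pt Finset.univ h1) hf B h0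
    rw [← hδ] at a1 a2
    rw [← Pt_symm, ← Pt_symm, ← Pt_symm, ← Pt_symm] at a2
    have a3 : δ ⬝ᵥ Pt N B t₀ (Pt N Finset.univ t₁ (Pt N B t₀ f))
        ≤ δ ⬝ᵥ Pt N B t₀ (Pt N Finset.univ t₁ F1) := by
      rw [hdot, hdot]
      exact Pt_mono h0 (Pt_mono h1 hF1ge) 1
    -- Started from the identity, the initial block shuffle of positions may be performed as a final
    -- block shuffle of labels.
    have a4 : δ ⬝ᵥ Pt N B t₀ (Pt N Finset.univ t₁ F1) ≤ Pt N Finset.univ t₁ F 1 := by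
      rw [hdot, Pt_Pt_one_eq]
      exact Pt_mono h1 (fun σ => hFbge σ⁻¹) 1
    rw [Pt_add, Pt_add, ← hdot (Pt N Finset.univ t₀ (Pt N Finset.univ t₁ (Pt N Finset.univ t₀ f)))]
    exact a1.trans (a2.trans (a3.trans a4))
  have hf0 : (0 : ℝ) < N.factorial := by exact_mod_cast Nat.factorial_pos N
  have hS2 : S.card * (N / 2 * Real.exp (-lam N * t₁)) / r
      ≤ K ^ 2 * (N / 2 * Real.exp (-lam N * t₁)) / r := by gcongr
  have b1 := mul_le_mul_of_nonneg_left hchain hf0.le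
  have b2 := mul_le_mul_of_nonneg_left hS2 hf0.le
  rw [mul_add] at hmain
  rw [mul_add, mul_add (N.factorial : ℝ)]
  linarith

end UpperBound

/-! ### Separation distance and total variation -/

section Separation

variable {N : ℕ}

lemma card_perm_cast (N : ℕ) : (Fintype.card (Equiv.Perm (Fin N)) : ℝ) = N.factorial := by
  rw [Fintype.card_perm, Fintype.card_fin]

lemma factorial_cast_pos (N : ℕ) : (0 : ℝ) < N.factorial := by
  exact_mod_cast Nat.factorial_pos N

lemma sum_const_perm (a : ℝ) : ∑ _σ : Equiv.Perm (Fin N), a = N.factorial * a := by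
  rw [Finset.sum_const, Finset.card_univ, nsmul_eq_mul, card_perm_cast]

lemma dSep_le_iff (N : ℕ) (t ε : ℝ) :
    dSep N t ≤ ε ↔ ∀ σ, 1 - N.factorial * law N t σ ≤ ε := by
  simp only [dSep, sepDist, Finset.sup'_le_iff, Finset.mem_univ, true_imp_iff, unif,
    card_perm_cast, div_div_eq_mul_div, div_one]
  simp only [mul_comm]

lemma one_sub_le_dSep (N : ℕ) (t : ℝ) (σ : Equiv.Perm (Fin N)) :
    1 - dSep N t ≤ N.factorial * law N t σ := by
  have := (dSep_le_iff N t _).1 le_rfl σ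
  linarith

lemma law_add (s t : ℝ) (σ : Equiv.Perm (Fin N)) :
    law N (s + t) σ = ∑ ρ, law N s (σ⁻¹ * ρ) * law N t ρ := by
  rw [law_eq, Pt_add]
  have h1 := Pt_mul_left (C := Finset.univ) (t := s) σ
    (Pt N Finset.univ t (Pi.single 1 1)) 1
  rw [mul_one] at h1
  rw [← h1, Pt_eq_sum, ← Equiv.sum_comp (Equiv.mulLeft σ⁻¹)]
  refine Finset.sum_congr rfl fun ρ _ => ?_
  simp [law_eq]

lemma law_nonneg {t : ℝ} (ht : 0 ≤ t) (σ : Equiv.Perm (Fin N)) : 0 ≤ law N t σ := by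
  rw [law_eq]
  refine const_le_Pt ht (fun ρ => ?_) σ
  simp only [Pi.single_apply]; split_ifs <;> norm_num

lemma sum_law (t : ℝ) : ∑ σ, law N t σ = 1 := by
  simp_rw [law_eq]
  rw [sum_Pt]; simp

/-- The law at time t averages translates of the law at time s, so a lower bound on the density
persists. -/
lemma dSep_anti {s t : ℝ} (hst : s ≤ t) : dSep N t ≤ dSep N s := by
  rw [dSep_le_iff]
  intro σ
  rw [show t = (t - s) + s by ring, law_add, Finset.mul_sum]
  have h1 : ∀ ρ, law N (t - s) (σ⁻¹ * ρ) * (1 - dSep N s)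
      ≤ N.factorial * (law N (t - s) (σ⁻¹ * ρ) * law N s ρ) := fun ρ => by
    have := mul_le_mul_of_nonneg_left (one_sub_le_dSep N s ρ)
      (law_nonneg (sub_nonneg.2 hst) (σ⁻¹ * ρ))
    linarith
  have h2 := Finset.sum_le_sum fun ρ (_ : ρ ∈ Finset.univ) => h1 ρ
  rw [← Finset.sum_mul] at h2
  have h3 : ∑ ρ, law N (t - s) (σ⁻¹ * ρ) = 1 := by
    rw [← sum_law (N := N) (t - s)]
    exact Equiv.sum_comp (Equiv.mulLeft σ⁻¹) (law N (t - s))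
  rw [h3] at h2
  linarith

/-- Equilibration of monotone functions in total variation bounds the separation at twice the
time. -/
lemma dSep_two_mul_le {s e : ℝ} (hs : 0 ≤ s)
    (h : ∀ f : Equiv.Perm (Fin N) → ℝ, Incr Set.univ f → (∀ σ, 0 ≤ f σ) → (∀ σ, f σ ≤ 1) →
      N.factorial * Pt N Finset.univ s f 1 ≤ ∑ σ, f σ + N.factorial * e) :
    dSep N (s + s) ≤ 2 * e := by
  classical
  have hf0 := factorial_cast_pos N
  set ρ : Equiv.Perm (Fin N) → ℝ := fun σ => N.factorial * law N s σ with hρ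
  have hρinc : Incr Set.univ ρ := by
    have := (incr_single_one (N := N)).Pt Finset.univ hs
    intro σ σ' hle
    simp only [hρ, law_eq]
    exact mul_le_mul_of_nonneg_left (this hle) hf0.le
  have hρ0 : ∀ σ, 0 ≤ ρ σ := fun σ => mul_nonneg hf0.le (law_nonneg hs σ)
  -- This event realizes the total variation distance, and it is increasing because the density is.
  set A : Equiv.Perm (Fin N) → ℝ := fun σ => if 1 ≤ ρ σ then 1 else 0 with hA
  have hAinc : Incr Set.univ A := by
    intro σ σ' hle
    have := hρinc hle
    simp only [hA]
    split_ifs <;> linarith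
  have h1 := h A hAinc (fun σ => by simp only [hA]; split_ifs <;> norm_num)
    (fun σ => by simp only [hA]; split_ifs <;> norm_num)
  rw [Pt_eq_sum, Finset.mul_sum] at h1
  have h2 : ∑ σ, (N.factorial : ℝ) * (Pt N Finset.univ s (Pi.single 1 1) σ * A σ)
      = ∑ σ, (ρ σ + A σ - min (ρ σ) 1) := by
    refine Finset.sum_congr rfl fun σ _ => ?_
    rw [← law_eq, ← mul_assoc]
    show ρ σ * A σ = _
    simp only [hA]
    split_ifs with h
    · rw [min_eq_right h]; ring
    · rw [min_eq_left (not_le.1 h).le]; ring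
  have h3 : ∑ σ, ρ σ = N.factorial := by
    simp only [hρ]; rw [← Finset.mul_sum, sum_law, mul_one]
  rw [h2, Finset.sum_sub_distrib, Finset.sum_add_distrib, h3] at h1
  have h4 : N.factorial * (1 - e) ≤ ∑ σ, min (ρ σ) 1 := by linarith
  rw [dSep_le_iff]
  intro σ
  -- This is (1 - a)(1 - b) ≥ 0 for the truncated densities.
  have h5 : ∀ τ, min (ρ (σ⁻¹ * τ)) 1 + min (ρ τ) 1 - 1 ≤ ρ (σ⁻¹ * τ) * ρ τ := fun τ => by
    have a1 := min_le_left (ρ (σ⁻¹ * τ)) 1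
    have a2 := min_le_right (ρ (σ⁻¹ * τ)) 1
    have a3 := min_le_left (ρ τ) 1
    have a4 := min_le_right (ρ τ) 1
    have a5 : 0 ≤ min (ρ τ) 1 := le_min (hρ0 τ) zero_le_one
    have a6 : min (ρ (σ⁻¹ * τ)) 1 * min (ρ τ) 1 ≤ ρ (σ⁻¹ * τ) * ρ τ :=
      mul_le_mul a1 a3 a5 (hρ0 _)
    nlinarith
  have h6 := Finset.sum_le_sum fun τ (_ : τ ∈ Finset.univ) => h5 τ
  have h7 : ∑ τ, min (ρ (σ⁻¹ * τ)) 1 = ∑ τ, min (ρ τ) 1 :=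
    Equiv.sum_comp (Equiv.mulLeft σ⁻¹) fun τ => min (ρ τ) 1
  rw [Finset.sum_sub_distrib, Finset.sum_add_distrib, h7, sum_const_perm] at h6
  have h8 : ∑ τ, ρ (σ⁻¹ * τ) * ρ τ = N.factorial * (N.factorial * law N (s + s) σ) := by
    rw [law_add, Finset.mul_sum, Finset.mul_sum]
    refine Finset.sum_congr rfl fun τ _ => ?_
    simp only [hρ]; ring
  rw [h8] at h6
  have h9 : N.factorial * (1 - 2 * e) ≤ N.factorial * (N.factorial * law N (s + s) σ) := by
    linarith
  have := le_of_mul_le_mul_left h9 hf0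
  linarith

end Separation

/-! ### Choice of scales and the upper bound on the separation time -/

section Asymptotics

open Filter Topology

/-- A crude bound, sufficient wherever the constant is immaterial, as for blocks, where K can be
enlarged. -/
lemma four_div_sq_le_lam {n : ℕ} (hn : 0 < n) : 4 / (n : ℝ) ^ 2 ≤ lam n := by
  have hn' : (1 : ℝ) ≤ n := by exact_mod_cast hn
  have h1 : |Real.pi / n| ≤ Real.pi := by
    rw [abs_of_nonneg (by positivity)]
    exact div_le_self Real.pi_pos.le hn'
  have h2 := Real.cos_le_one_sub_mul_cos_sq h1
  have h3 : 2 / Real.pi ^ 2 * (Real.pi / n) ^ 2 = 2 / (n : ℝ) ^ 2 := by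
    have := Real.pi_pos.ne'
    field_simp
  rw [h3] at h2
  rw [lam]
  have : 4 / (n : ℝ) ^ 2 = 2 * (2 / (n : ℝ) ^ 2) := by ring
  linarith

lemma lam_le (n : ℕ) : lam n ≤ Real.pi ^ 2 / n ^ 2 := by
  have := Real.one_sub_sq_div_two_le_cos (x := Real.pi / n)
  rw [lam]
  have e : Real.pi ^ 2 / (n : ℝ) ^ 2 = (Real.pi / n) ^ 2 := by rw [div_pow]
  rw [e]; linarith

/-- Here the leading constant π² must be exact, since it fixes the constant of the theorem. -/
lemma le_lam {n : ℕ} (hn : 4 ≤ n) :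
    Real.pi ^ 2 / n ^ 2 * (1 - 2 / n ^ 2) ≤ lam n := by
  have hn' : (4 : ℝ) ≤ n := by exact_mod_cast hn
  set x := Real.pi / n with hx
  have hx0 : 0 ≤ x := by positivity
  have hx1 : |x| ≤ 1 := by
    rw [abs_of_nonneg hx0, hx, div_le_one (by linarith)]
    linarith [Real.pi_le_four]
  have h1 := (abs_le.1 (Real.cos_bound hx1)).2
  rw [abs_of_nonneg hx0] at h1
  have h2 : x ^ 2 * (5 / 48) ≤ 2 / n ^ 2 := by
    rw [hx, div_pow, div_mul_eq_mul_div]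
    refine div_le_div_of_nonneg_right ?_ (by positivity)
    nlinarith [Real.pi_le_four, Real.pi_pos]
  have h3 : Real.pi ^ 2 / (n : ℝ) ^ 2 = x ^ 2 := by rw [hx, div_pow]
  rw [h3, lam]
  have h4 := mul_le_mul_of_nonneg_left h2 (sq_nonneg x)
  nlinarith

/-- The time scale of the theorem. -/
def scale (N : ℕ) : ℝ := (N : ℝ) ^ 2 * Real.log N / Real.pi ^ 2

lemma exp_neg_mul_log {N : ℕ} (hN : 0 < N) (a : ℝ) :
    Real.exp (-(a * Real.log N)) = (N : ℝ) ^ (-a) := by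
  rw [Real.rpow_def_of_pos (by exact_mod_cast hN)]
  ring_nf

/-- Relaxation inside blocks of length at most 2N/κ is faster by a factor of order κ². For κ²η large
even the time (η/8) T gains N^(-4), against prefactors of order N³. -/
lemma block_relaxation_le {N n : ℕ} {κ η : ℝ} (hN : 10 ≤ N) (hn : 0 < n) (hκ : 2 ≤ κ)
    (hκn : κ * n ≤ 2 * N) (hη : 0 < η) (hκη : 32 * Real.pi ^ 2 ≤ κ ^ 2 * η) :
    ((N : ℝ) + 1) ^ 2 * (n / 2 * Real.exp (-lam n * (η / 8 * scale N))) ≤ 4 / N := by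
  have hN0 : (10 : ℝ) ≤ N := by exact_mod_cast hN
  have hNpos : (0 : ℝ) < N := by linarith
  have hn0 : (0 : ℝ) < n := by exact_mod_cast hn
  have hlog : 0 ≤ Real.log N := Real.log_nonneg (by linarith)
  have hscale : 0 ≤ scale N := by rw [scale]; positivity
  have hpi := Real.pi_pos
  have h1 : 4 * Real.log N ≤ lam n * (η / 8 * scale N) := by
    have h2 := mul_le_mul_of_nonneg_right (four_div_sq_le_lam hn)
      (by positivity : 0 ≤ η / 8 * scale N)
    refine le_trans ?_ h2
    have h3 : (n : ℝ) ^ 2 * κ ^ 2 ≤ 4 * (N : ℝ) ^ 2 := by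
      have := pow_le_pow_left₀ (by positivity) hκn 2
      linarith [this, mul_pow κ (n : ℝ) 2, mul_pow (2 : ℝ) (N : ℝ) 2]
    have h5 : 8 * Real.pi ^ 2 * (n : ℝ) ^ 2 ≤ η * (N : ℝ) ^ 2 := by
      have h6 := mul_le_mul_of_nonneg_right hκη (sq_nonneg (n : ℝ))
      have h7 := mul_le_mul_of_nonneg_right h3 hη.le
      linarith
    have h8 : 4 ≤ η * (N : ℝ) ^ 2 / (2 * Real.pi ^ 2 * (n : ℝ) ^ 2) := by
      rw [le_div_iff₀ (by positivity)]; linarith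
    have h9 : 4 / (n : ℝ) ^ 2 * (η / 8 * scale N)
        = η * (N : ℝ) ^ 2 / (2 * Real.pi ^ 2 * (n : ℝ) ^ 2) * Real.log N := by
      rw [scale]; field_simp; ring
    rw [h9]
    exact mul_le_mul_of_nonneg_right h8 hlog
  have h2 : Real.exp (-lam n * (η / 8 * scale N)) ≤ (N : ℝ) ^ (-(4 : ℝ)) := by
    rw [← exp_neg_mul_log (by omega)]
    exact Real.exp_le_exp.2 (by linarith)
  have h3 : (N : ℝ) ^ (-(4 : ℝ)) = 1 / (N : ℝ) ^ 4 := by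
    rw [Real.rpow_neg hNpos.le, one_div]
    congr 1
    exact_mod_cast Real.rpow_natCast (N : ℝ) 4
  rw [h3] at h2
  have h4 : (n : ℝ) / 2 ≤ N := by
    have := mul_le_mul_of_nonneg_right hκ hn0.le
    linarith
  have h5 : (N + 1 : ℝ) ^ 2 ≤ 4 * (N : ℝ) ^ 2 := by nlinarith
  calc (N + 1 : ℝ) ^ 2 * (n / 2 * Real.exp (-lam n * (η / 8 * scale N)))
      ≤ 4 * (N : ℝ) ^ 2 * ((N : ℝ) * (1 / (N : ℝ) ^ 4)) := by gcongr
    _ = (4 : ℝ) / N := by field_simp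

/-- The exponents add up to 1 - (1/2 + η/8) - (1/2 - η/16) = -η/16; the smallness condition on N
absorbs the error in `le_lam`. -/
lemma mean_relaxation_le {N : ℕ} {r κ η : ℝ} (hN : 10 ≤ N) (hη : 0 < η)
    (hNη : 2 / (N : ℝ) ^ 2 < η / (4 + 2 * η)) (hr : (N : ℝ) ^ (1 / 2 - η / 16) ≤ r) :
    κ ^ 2 * (N / 2 * Real.exp (-lam N * ((1 / 2 + η / 4) * scale N))) / r
      ≤ κ ^ 2 / 2 * (N : ℝ) ^ (-(η / 16)) := by
  have hN0 : (10 : ℝ) ≤ N := by exact_mod_cast hN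
  have hNpos : (0 : ℝ) < N := by linarith
  have hrp : 0 < (N : ℝ) ^ (1 / 2 - η / 16) := Real.rpow_pos_of_pos hNpos _
  have hlog : 0 ≤ Real.log N := Real.log_nonneg (by linarith)
  have hscale : 0 ≤ scale N := by rw [scale]; positivity
  have hpi := Real.pi_pos
  have h1 : (1 / 2 + η / 8) * Real.log N ≤ lam N * ((1 / 2 + η / 4) * scale N) := by
    have h2 := mul_le_mul_of_nonneg_right (le_lam (show 4 ≤ N by omega))
      (by positivity : 0 ≤ (1 / 2 + η / 4) * scale N)
    refine le_trans ?_ h2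
    have h3 : Real.pi ^ 2 / N ^ 2 * (1 - 2 / N ^ 2) * ((1 / 2 + η / 4) * scale N)
        = (1 - 2 / N ^ 2) * (1 / 2 + η / 4) * Real.log N := by
      rw [scale]; field_simp
    rw [h3]
    refine mul_le_mul_of_nonneg_right ?_ hlog
    rw [lt_div_iff₀ (by positivity)] at hNη
    linarith
  have h2 : Real.exp (-lam N * ((1 / 2 + η / 4) * scale N)) ≤ (N : ℝ) ^ (-(1 / 2 + η / 8)) := by
    rw [← exp_neg_mul_log (by omega)]
    exact Real.exp_le_exp.2 (by linarith)
  calc κ ^ 2 * (N / 2 * Real.exp (-lam N * ((1 / 2 + η / 4) * scale N))) / r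
      ≤ κ ^ 2 * (N / 2 * (N : ℝ) ^ (-(1 / 2 + η / 8))) / (N : ℝ) ^ (1 / 2 - η / 16) := by
        gcongr
    _ = κ ^ 2 / 2 * ((N : ℝ) ^ (1 : ℝ) * (N : ℝ) ^ (-(1 / 2 + η / 8)) *
        (N : ℝ) ^ (-(1 / 2 - η / 16))) := by
        rw [Real.rpow_one, Real.rpow_neg hNpos.le (1 / 2 - η / 16)]
        field_simp
    _ = κ ^ 2 / 2 * (N : ℝ) ^ (-(η / 16)) := by
        rw [← Real.rpow_add hNpos, ← Real.rpow_add hNpos]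
        congr 2; ring

/-- The number of good pairs is of order N for fixed κ, and r is smaller than √N by a power of N. -/
lemma shift_div_sqrt_le {N : ℕ} {r κ c η : ℝ} (hN : 0 < N) (hκ : 0 < κ)
    (hr : r ≤ (N : ℝ) ^ (1 / 2 - η / 16) + 1) (hc : N / (4 * κ ^ 3) ≤ c) :
    r / √(c / 2) ≤ ((N : ℝ) ^ (-(η / 16)) + (N : ℝ) ^ (-(1 / 2 : ℝ))) * √(8 * κ ^ 3) := by
  have hNpos : (0 : ℝ) < N := by exact_mod_cast hN
  have h1 : √(N / (8 * κ ^ 3)) ≤ √(c / 2) := by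
    refine Real.sqrt_le_sqrt ?_
    have : (N : ℝ) / (8 * κ ^ 3) = N / (4 * κ ^ 3) / 2 := by field_simp; norm_num
    rw [this]; linarith
  have h2 : 0 < √(N / (8 * κ ^ 3)) := Real.sqrt_pos.2 (by positivity)
  calc r / √(c / 2) ≤ ((N : ℝ) ^ (1 / 2 - η / 16) + 1) / √(N / (8 * κ ^ 3)) := by gcongr
    _ = ((N : ℝ) ^ (1 / 2 - η / 16) + 1) * (N : ℝ) ^ (-(1 / 2 : ℝ)) * √(8 * κ ^ 3) := by
        rw [Real.sqrt_div hNpos.le, Real.sqrt_eq_rpow (N : ℝ), Real.rpow_neg hNpos.le]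
        field_simp
    _ = _ := by
        rw [add_mul, one_mul, ← Real.rpow_add hNpos]
        congr 3; ring

/-- Separation is small slightly after the time `N² log N / π²`. -/
lemma eventually_dSep_le {η ε : ℝ} (hη : 0 < η) (hε : 0 < ε) :
    ∀ᶠ N : ℕ in atTop, dSep N ((1 + η) * scale N) ≤ ε := by
  -- This number of blocks depends on η only and makes K²η ≥ 32π², as `block_relaxation_le`
  -- requires.
  obtain ⟨K, hK⟩ := exists_nat_ge (32 * Real.pi ^ 2 / η + 2)
  have hK2 : 2 ≤ K := by
    have : (2 : ℝ) ≤ K := le_trans (by have : 0 ≤ 32 * Real.pi ^ 2 / η := by positivity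
                                       linarith) hK
    exact_mod_cast this
  have hKη : 32 * Real.pi ^ 2 ≤ K ^ 2 * η := by
    have h1 : 32 * Real.pi ^ 2 / η ≤ K := by linarith
    rw [div_le_iff₀ hη] at h1
    have h2 : (1 : ℝ) ≤ K := by exact_mod_cast (by omega : 1 ≤ K)
    nlinarith [mul_le_mul_of_nonneg_right h2 (mul_nonneg (by linarith : (0 : ℝ) ≤ K) hη.le)]
  set Kr : ℝ := (K : ℝ) with hKr
  have hKr0 : 0 < Kr := by rw [hKr]; exact_mod_cast (by omega : 0 < K)
  set b : ℕ → ℝ := fun N => 2 * (4 / N) + (Kr ^ 2 / 2 * (N : ℝ) ^ (-(η / 16)) +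
    (((N : ℝ) ^ (-(η / 16)) + (N : ℝ) ^ (-(1 / 2 : ℝ))) * √(8 * Kr ^ 3)
      + 16 * Kr ^ 3 / N + 32 / N)) with hb
  have hb0 : Tendsto b atTop (𝓝 0) := by
    have hinv : ∀ a : ℝ, Tendsto (fun N : ℕ => a / (N : ℝ)) atTop (𝓝 0) := fun a =>
      tendsto_const_div_atTop_nhds_zero_nat a
    have hp : ∀ a : ℝ, 0 < a → Tendsto (fun N : ℕ => (N : ℝ) ^ (-a)) atTop (𝓝 0) := fun a ha =>
      (tendsto_rpow_neg_atTop ha).comp tendsto_natCast_atTop_atTop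
    have := ((hinv 4).const_mul 2).add (((hp (η / 16) (by positivity)).const_mul (Kr ^ 2 / 2)).add
      (((((hp (η / 16) (by positivity)).add (hp (1 / 2) (by norm_num))).mul_const
        (√(8 * Kr ^ 3))).add (hinv (16 * Kr ^ 3))).add (hinv 32)))
    simpa [hb] using this
  have hsmall : Tendsto (fun N : ℕ => 2 / (N : ℝ) ^ 2) atTop (𝓝 0) := by
    have := (tendsto_const_div_atTop_nhds_zero_nat (2 : ℝ)).mul
      (tendsto_const_div_atTop_nhds_zero_nat (1 : ℝ))
    simp only [mul_zero] at this
    refine this.congr fun N => ?_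
    rw [div_mul_div_comm, mul_one, sq]
  have hev1 := hb0.eventually (gt_mem_nhds (show (0 : ℝ) < ε / 2 by positivity))
  have hev2 := hsmall.eventually (gt_mem_nhds (show (0 : ℝ) < η / (4 + 2 * η) by positivity))
  filter_upwards [hev1, hev2, eventually_ge_atTop (2 * K ^ 2 + 10)] with N hN1 hN2 hN
  have hN0 : (10 : ℝ) ≤ N := by exact_mod_cast (by omega : 10 ≤ N)
  have hNpos : (0 : ℝ) < N := by linarith
  have hNK : 2 * Kr ^ 2 ≤ N := by
    have : 2 * K ^ 2 ≤ N := by omega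
    rw [hKr]; exact_mod_cast this
  have hlog : 0 ≤ Real.log N := Real.log_nonneg (by linarith)
  have hscale : 0 ≤ scale N := by rw [scale]; positivity
  -- With this length K blocks cover all positions, and N ≥ 2K² leaves the last block at least
  -- N/(2K) positions.
  set n := N / K + 1 with hn
  have hKpos : 0 < K := by omega
  have hdiv := Nat.div_add_mod N K
  have hmod := Nat.mod_lt N hKpos
  have hnK : n * K = K * (N / K) + K := by rw [hn]; ring
  have hNn : N ≤ n * K := by omega
  have hnK1 : n * (K - 1) + n = n * K := by
    rw [← Nat.mul_succ]; congr 1; omega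
  have hn_lower : Kr * n ≤ N + Kr := by
    have : n * K ≤ N + K := by omega
    rw [mul_comm Kr, hKr]; exact_mod_cast this
  have hn_lower' : (N : ℝ) ≤ Kr * n := by rw [mul_comm Kr, hKr]; exact_mod_cast hNn
  have hn1 : 0 < n := Nat.succ_pos _
  have hn0 : (0 : ℝ) < n := by exact_mod_cast hn1
  have hKr2 : 2 ≤ Kr := by rw [hKr]; exact_mod_cast hK2
  have hmN : n * (K - 1) < N := by
    have h1 : K < n := by
      have : K ≤ N / K := by
        rw [Nat.le_div_iff_mul_le hKpos]; nlinarith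
      rw [hn]; omega
    have : n * K ≤ N + K := by omega
    omega
  have hJ : N / (2 * Kr) ≤ ((N - n * (K - 1) : ℕ) : ℝ) := by
    rw [Nat.cast_sub hmN.le]
    have h1 : ((n * (K - 1) : ℕ) : ℝ) + n = Kr * n := by
      rw [mul_comm Kr, hKr]; exact_mod_cast hnK1
    have h2 : ((n * (K - 1) : ℕ) : ℝ) ≤ N + Kr - n := by linarith
    have h3 : (N : ℝ) / Kr ≤ n := by rw [div_le_iff₀ hKr0]; linarith
    have h4 : Kr ≤ N / (2 * Kr) := by
      rw [le_div_iff₀ (by positivity)]; nlinarith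
    have h5 : (N : ℝ) / Kr = 2 * (N / (2 * Kr)) := by field_simp
    linarith
  set c : ℝ := (N - n * (K - 1) : ℕ) ^ 2 * n / N ^ 2 with hc
  have hc_lower : N / (4 * Kr ^ 3) ≤ c := by
    have h3 : (N : ℝ) / Kr ≤ n := by rw [div_le_iff₀ hKr0]; linarith
    calc N / (4 * Kr ^ 3) = (N / (2 * Kr)) ^ 2 * (N / Kr) / N ^ 2 := by field_simp; norm_num
      _ ≤ c := by rw [hc]; gcongr
  set t₀ := η / 8 * scale N with ht₀
  set t₁ := (1 / 2 + η / 4) * scale N with ht₁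
  have ht₀0 : 0 ≤ t₀ := by positivity
  have ht₁0 : 0 ≤ t₁ := by positivity
  set r := ⌈(N : ℝ) ^ (1 / 2 - η / 16)⌉₊ with hr
  have hrp : 0 < (N : ℝ) ^ (1 / 2 - η / 16) := Real.rpow_pos_of_pos hNpos _
  have hr0 : 0 < r := Nat.ceil_pos.2 hrp
  have hrle : (N : ℝ) ^ (1 / 2 - η / 16) ≤ r := Nat.le_ceil _
  have hrlt : (r : ℝ) ≤ (N : ℝ) ^ (1 / 2 - η / 16) + 1 := (Nat.ceil_lt_add_one hrp.le).le
  have hE := block_relaxation_le (n := n) (by omega : 10 ≤ N) hn1 hKr2 (by nlinarith) hη hKη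
  have hD := mean_relaxation_le (κ := Kr) (by omega : 10 ≤ N) hη hN2 hrle
  have hR := shift_div_sqrt_le (by omega : 0 < N) hKr0 hrlt hc_lower
  have hcinv : 4 / c ≤ 16 * Kr ^ 3 / N := by
    have : 4 / c ≤ 4 / (N / (4 * Kr ^ 3)) := by gcongr
    refine this.trans (le_of_eq ?_)
    field_simp; norm_num
  have hfin := dSep_two_mul_le (N := N) (s := t₀ + (t₁ + t₀)) (e := b N) (by positivity)
    fun f hf hf0 hf1 => by
      refine (Pt_incr_le hK2 hmN hNn (by omega) hf hf0 hf1 hr0 hc ht₀0 ht₁0).trans ?_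
      have hb' : 2 * ((N + 1) ^ 2 * (n / 2 * Real.exp (-lam n * t₀))) +
          (Kr ^ 2 * (N / 2 * Real.exp (-lam N * t₁)) / r + (r / √(c / 2) + 4 / c + 32 / N))
          ≤ b N := by
        simp only [hb]
        linarith
      have := mul_le_mul_of_nonneg_left hb' (factorial_cast_pos N).le
      linarith
  -- Each half lasts η/8 + (1/2 + η/4) + η/8 in units of the scale, and separation doubles it.
  have hsum : (1 + η) * scale N = t₀ + (t₁ + t₀) + (t₀ + (t₁ + t₀)) := by
    rw [ht₀, ht₁]; ring
  rw [hsum]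
  linarith

end Asymptotics

/-! ### Correlation inequalities on the lattice of height profiles -/

section Correlation

open scoped FinsetFamily

variable {N : ℕ}

/-- Every lattice path with the right endpoints is a height profile. -/
lemma exists_ht_eq {p : ℕ → ℤ} {y : ℕ} (h0 : p 0 = 0)
    (hs : ∀ x < N, p (x + 1) = p x ∨ p (x + 1) = p x + 1)
    (hN : p N = ∑ z : Fin N, if z.val < y then 1 else 0) :
    ∃ σ : Equiv.Perm (Fin N), ∀ x ≤ N, ht σ x y = p x := by
  -- The up-steps of the path are as many as the labels below y; any bijection between them extends
  -- to a permutation.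
  have hcard : Fintype.card {z : Fin N // p (z.1 + 1) = p z.1 + 1}
      = Fintype.card {z : Fin N // z.val < y} := by
    have h1 : ∑ z : Fin N, (if p (z.1 + 1) = p z.1 + 1 then (1 : ℤ) else 0)
        = ∑ z : Fin N, if z.val < y then 1 else 0 := by
      have h2 := Finset.sum_range_sub p N
      rw [h0, sub_zero] at h2
      rw [← hN, ← h2, ← Fin.sum_univ_eq_sum_range (fun i => p (i + 1) - p i)]
      refine Finset.sum_congr rfl fun z _ => ?_
      rcases hs z.1 z.2 with h | h <;> simp [h]
    rw [Finset.sum_boole, Finset.sum_boole] at h1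
    rw [Fintype.card_subtype, Fintype.card_subtype]
    exact_mod_cast h1
  let e := Fintype.equivOfCardEq hcard
  refine ⟨e.extendSubtype, fun x => ?_⟩
  induction x with
  | zero => simp [h0]
  | succ x ih =>
    intro hx
    rw [ht_succ _ (show x < N by omega), ih (by omega)]
    by_cases h : p (x + 1) = p x + 1
    · rw [if_pos (e.extendSubtype_mem ⟨x, by omega⟩ h), h]
    · rw [if_neg (e.extendSubtype_not_mem ⟨x, by omega⟩ h), add_zero]
      exact ((hs x (by omega)).resolve_right h).symm

lemma ht_step (σ : Equiv.Perm (Fin N)) (x y : ℕ) (hx : x < N) :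
    ht σ (x + 1) y = ht σ x y ∨ ht σ (x + 1) y = ht σ x y + 1 := by
  rw [ht_succ σ hx]; split_ifs <;> simp

/-- The minimum of two paths with steps 0 or 1 and common endpoints is again such a path. -/
lemma exists_ht_eq_min (σ σ' : Equiv.Perm (Fin N)) (y : ℕ) :
    ∃ τ : Equiv.Perm (Fin N), ∀ x, ht τ x y = min (ht σ x y) (ht σ' x y) := by
  obtain ⟨τ, hτ⟩ := exists_ht_eq (N := N) (y := y) (p := fun x => min (ht σ x y) (ht σ' x y))
    (by simp) (fun x hx => by
      have h1 := ht_step σ x y hx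
      have h2 := ht_step σ' x y hx
      omega) (by simp only [ht_of_le σ le_rfl, ht_of_le σ' le_rfl, min_self])
  refine ⟨τ, fun x => ?_⟩
  rcases le_total x N with h | h
  · exact hτ x h
  · rw [ht_of_le τ h, ht_of_le σ h, ht_of_le σ' h, min_self]

lemma exists_ht_eq_max (σ σ' : Equiv.Perm (Fin N)) (y : ℕ) :
    ∃ τ : Equiv.Perm (Fin N), ∀ x, ht τ x y = max (ht σ x y) (ht σ' x y) := by
  obtain ⟨τ, hτ⟩ := exists_ht_eq (N := N) (y := y) (p := fun x => max (ht σ x y) (ht σ' x y))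
    (by simp) (fun x hx => by
      have h1 := ht_step σ x y hx
      have h2 := ht_step σ' x y hx
      omega) (by simp only [ht_of_le σ le_rfl, ht_of_le σ' le_rfl, max_self])
  refine ⟨τ, fun x => ?_⟩
  rcases le_total x N with h | h
  · exact hτ x h
  · rw [ht_of_le τ h, ht_of_le σ h, ht_of_le σ' h, max_self]

/-- The height profile of `σ` at level `y`. -/
def profile (y : ℕ) (σ : Equiv.Perm (Fin N)) : ℕ → ℤ := fun x => ht σ x y

lemma profile_mul {y : ℕ} {σ σ₀ τ : Equiv.Perm (Fin N)} (h : profile y τ = profile y σ) :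
    profile y (τ * (σ⁻¹ * σ₀)) = profile y σ₀ := by
  have hz : ∀ z : Fin N, (τ z).val < y ↔ (σ z).val < y := fun z => by
    have h1 := congrFun h z.1
    have h2 := congrFun h (z.1 + 1)
    simp only [profile] at h1 h2
    rw [ht_succ τ z.2, ht_succ σ z.2, h1] at h2
    simp only [Fin.eta] at h2
    split_ifs at h2 <;> omega
  funext x
  simp only [profile, ht]
  refine Finset.sum_congr rfl fun z _ => ?_
  have : ((τ * (σ⁻¹ * σ₀)) z).val < y ↔ (σ₀ z).val < y := by
    rw [Equiv.Perm.mul_apply, hz, ← Equiv.Perm.mul_apply, mul_inv_cancel_left]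
  simp only [this]

open Classical in
-- Right multiplication rearranges positions and carries one fiber onto another, so the uniform
-- measure projects to the uniform measure on paths.
lemma card_profile_fiber (y : ℕ) (σ σ₀ : Equiv.Perm (Fin N)) :
    (Finset.univ.filter fun τ : Equiv.Perm (Fin N) => profile y τ = profile y σ).card
      = (Finset.univ.filter fun τ : Equiv.Perm (Fin N) => profile y τ = profile y σ₀).card := by
  refine Finset.card_bij' (fun τ _ => τ * (σ⁻¹ * σ₀)) (fun τ _ => τ * (σ₀⁻¹ * σ)) ?_ ?_ ?_ ?_
  · intro τ hτ; simp only [Finset.mem_filter, Finset.mem_univ, true_and] at hτ ⊢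
    exact profile_mul hτ
  · intro τ hτ; simp only [Finset.mem_filter, Finset.mem_univ, true_and] at hτ ⊢
    exact profile_mul hτ
  · intro τ _; simp [mul_assoc]
  · intro τ _; simp [mul_assoc]

/-- Positive correlation of functions of one height profile, conditionally on one height. -/
lemma sum_mul_sum_le_of_incr {x₀ y : ℕ} (P : ℤ → Prop) [DecidablePred P]
    {f g : Equiv.Perm (Fin N) → ℝ} (hf : Incr {y} f) (hg : Incr {y} g) (hf0 : ∀ σ, 0 ≤ f σ)
    (hg0 : ∀ σ, 0 ≤ g σ) :
    (∑ σ with P (ht σ x₀ y), f σ) * (∑ σ with P (ht σ x₀ y), g σ)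
      ≤ (Finset.univ.filter fun σ : Equiv.Perm (Fin N) => P (ht σ x₀ y)).card
        * ∑ σ with P (ht σ x₀ y), f σ * g σ := by
  classical
  set B := Finset.univ.filter fun σ : Equiv.Perm (Fin N) => P (ht σ x₀ y) with hB
  have hBmem : ∀ σ, σ ∈ B ↔ P (profile y σ x₀) := fun σ => by simp [hB, profile]
  set s := B.image (profile y) with hs
  let Q : (Equiv.Perm (Fin N) → ℝ) → (ℕ → ℤ) → ℝ := fun h p => ∑ σ ∈ B with profile y σ = p, h σ
  have hQ : ∀ h, ∑ p ∈ s, Q h p = ∑ σ ∈ B, h σ := fun h =>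
    Finset.sum_fiberwise_of_maps_to (fun σ hσ => Finset.mem_image_of_mem _ hσ) h
  have hQ0 : ∀ h : Equiv.Perm (Fin N) → ℝ, (∀ σ, 0 ≤ h σ) → 0 ≤ Q h := fun h hh p =>
    Finset.sum_nonneg fun σ _ => hh σ
  set k : ℝ := Nat.cast
    (Finset.univ.filter fun τ : Equiv.Perm (Fin N) => profile y τ = profile y 1).card
    with hk
  have hQval : ∀ h : Equiv.Perm (Fin N) → ℝ, (∀ σ σ', profile y σ = profile y σ' → h σ = h σ') →
      ∀ σ ∈ B, Q h (profile y σ) = k * h σ := fun h hh σ hσ => by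
    have h1 : (B.filter fun τ => profile y τ = profile y σ)
        = Finset.univ.filter fun τ => profile y τ = profile y σ := by
      ext τ
      simp only [Finset.mem_filter, Finset.mem_univ, true_and, and_iff_right_iff_imp]
      intro hτ
      rw [hBmem, hτ, ← hBmem]; exact hσ
    simp only [Q]
    rw [h1, Finset.sum_congr rfl fun τ hτ => hh τ σ (Finset.mem_filter.1 hτ).2, Finset.sum_const,
      card_profile_fiber y σ 1, nsmul_eq_mul]
  have hinv : ∀ {h : Equiv.Perm (Fin N) → ℝ}, Incr {y} h →
      ∀ σ σ', profile y σ = profile y σ' → h σ = h σ' := fun hh σ σ' he => by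
    have he' : ∀ x, ht σ x y = ht σ' x y := congrFun he
    refine le_antisymm (hh fun x y' hy => ?_) (hh fun x y' hy => ?_) <;> rw [hy, he']
  -- A minimum or maximum of two values is one of them, so conditioning on any set of values of a
  -- single height leaves a sublattice.
  have hmin : ∀ σ ∈ B, ∀ σ' ∈ B, ∃ τ ∈ B, profile y τ = profile y σ ⊓ profile y σ' := by
    intro σ hσ σ' hσ'
    obtain ⟨τ, hτ⟩ := exists_ht_eq_min σ σ' y
    have hτ' : profile y τ = profile y σ ⊓ profile y σ' := funext hτ
    refine ⟨τ, ?_, hτ'⟩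
    rw [hBmem, hτ', Pi.inf_apply]
    rcases min_choice (profile y σ x₀) (profile y σ' x₀) with h | h <;> rw [h, ← hBmem] <;> assumption
  have hmax : ∀ σ ∈ B, ∀ σ' ∈ B, ∃ τ ∈ B, profile y τ = profile y σ ⊔ profile y σ' := by
    intro σ hσ σ' hσ'
    obtain ⟨τ, hτ⟩ := exists_ht_eq_max σ σ' y
    have hτ' : profile y τ = profile y σ ⊔ profile y σ' := funext hτ
    refine ⟨τ, ?_, hτ'⟩
    rw [hBmem, hτ', Pi.sup_apply]
    rcases max_choice (profile y σ x₀) (profile y σ' x₀) with h | h <;> rw [h, ← hBmem] <;> assumption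
  have hinf : s ⊼ s = s := by
    refine (Finset.infs_subset_iff.2 fun a ha b hb => ?_).antisymm Finset.subset_infs_self
    obtain ⟨σ, hσ, rfl⟩ := Finset.mem_image.1 ha
    obtain ⟨σ', hσ', rfl⟩ := Finset.mem_image.1 hb
    obtain ⟨τ, hτ, h⟩ := hmin σ hσ σ' hσ'
    exact Finset.mem_image.2 ⟨τ, hτ, h⟩
  have hsup : s ⊻ s = s := by
    refine (Finset.sups_subset_iff.2 fun a ha b hb => ?_).antisymm Finset.subset_sups_self
    obtain ⟨σ, hσ, rfl⟩ := Finset.mem_image.1 ha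
    obtain ⟨σ', hσ', rfl⟩ := Finset.mem_image.1 hb
    obtain ⟨τ, hτ, h⟩ := hmax σ hσ σ' hσ'
    exact Finset.mem_image.2 ⟨τ, hτ, h⟩
  have hempty : ∀ h p, p ∉ s → Q h p = 0 := fun h p hp => by
    simp only [Q]
    rw [Finset.filter_eq_empty_iff.2, Finset.sum_empty]
    exact fun σ hσ he => hp (Finset.mem_image.2 ⟨σ, hσ, he⟩)
  -- Fiber sums are k times the value because fibers have equal size. The four-function condition
  -- then reduces to f(a) g(b) ≤ f(a ∨ b) g(a ∨ b).
  have key := four_functions_theorem (Q f) (Q g) (Q 1) (Q (f * g)) (hQ0 f hf0) (hQ0 g hg0)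
    (hQ0 1 fun _ => zero_le_one) (hQ0 _ fun σ => mul_nonneg (hf0 σ) (hg0 σ)) (fun a b => ?_) s s
  · rw [hinf, hsup, hQ, hQ, hQ, hQ] at key
    simpa using key
  · by_cases ha : a ∈ s
    · by_cases hb : b ∈ s
      · obtain ⟨σ, hσ, rfl⟩ := Finset.mem_image.1 ha
        obtain ⟨σ', hσ', rfl⟩ := Finset.mem_image.1 hb
        obtain ⟨τ, hτ, h⟩ := hmin σ hσ σ' hσ'
        obtain ⟨τ', hτ', h'⟩ := hmax σ hσ σ' hσ'
        rw [← h, ← h', hQval f (hinv hf) σ hσ, hQval g (hinv hg) σ' hσ', hQval 1 (fun _ _ _ => rfl) τ hτ,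
          hQval (f * g) (fun a b hab => by simp [hinv hf a b hab, hinv hg a b hab]) τ' hτ']
        have e1 : f σ ≤ f τ' := hf fun x y' hy => by
          have := congrFun h' x
          rw [hy]; exact le_of_le_of_eq le_sup_left this.symm
        have e2 : g σ' ≤ g τ' := hg fun x y' hy => by
          have := congrFun h' x
          rw [hy]; exact le_of_le_of_eq le_sup_right this.symm
        have e3 := mul_le_mul e1 e2 (hg0 _) (hf0 _)
        have := mul_le_mul_of_nonneg_left e3 (mul_self_nonneg k)
        simp only [Pi.one_apply, Pi.mul_apply]
        linarith
      · rw [hempty g b hb, mul_zero]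
        exact mul_nonneg (hQ0 1 (fun _ => zero_le_one) _)
          (hQ0 _ (fun σ => mul_nonneg (hf0 σ) (hg0 σ)) _)
    · rw [hempty f a ha, zero_mul]
      exact mul_nonneg (hQ0 1 (fun _ => zero_le_one) _)
        (hQ0 _ (fun σ => mul_nonneg (hf0 σ) (hg0 σ)) _)

/-- The case of an increasing and a decreasing function. -/
lemma card_mul_sum_le_of_incr {x₀ y : ℕ} (P : ℤ → Prop) [DecidablePred P]
    {f g : Equiv.Perm (Fin N) → ℝ} (hf : Incr {y} f) (hg : Incr {y} (-g)) (hf0 : ∀ σ, 0 ≤ f σ)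
    (hg1 : ∀ σ, g σ ≤ 1) :
    (Finset.univ.filter fun σ : Equiv.Perm (Fin N) => P (ht σ x₀ y)).card
        * ∑ σ with P (ht σ x₀ y), f σ * g σ
      ≤ (∑ σ with P (ht σ x₀ y), f σ) * (∑ σ with P (ht σ x₀ y), g σ) := by
  have h := sum_mul_sum_le_of_incr (x₀ := x₀) P hf (g := fun σ => 1 - g σ)
    (fun σ σ' hl => by have := hg hl; simp only [Pi.neg_apply] at this; linarith) hf0
    (fun σ => sub_nonneg.2 (hg1 σ))
  simp only [mul_sub, mul_one, Finset.sum_sub_distrib, Finset.sum_const, nsmul_eq_mul] at h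
  linarith

end Correlation

/-! ### Means and variances of heights -/

section Variance

variable {N : ℕ}

/-- The generator of the motion of a single card. -/
def walk (N : ℕ) : Op (Fin N) :=
  ContinuousLinearMap.pi fun z =>
    ∑ e : Fin (N - 1), ((ContinuousLinearMap.proj (tau N e z) : (Fin N → ℝ) →L[ℝ] ℝ)
      - (ContinuousLinearMap.proj z : (Fin N → ℝ) →L[ℝ] ℝ))

lemma walk_apply (w : Fin N → ℝ) (z : Fin N) : walk N w z = ∑ e, (w (tau N e z) - w z) := by
  simp [walk]

/-- The sum of `w` over the positions of the labels below `y`. -/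
def occupation (N y : ℕ) : (Fin N → ℝ) →L[ℝ] (Equiv.Perm (Fin N) → ℝ) :=
  ContinuousLinearMap.pi fun σ =>
    ∑ z : Fin N, (if (σ z).val < y then (1 : ℝ) else 0) • ContinuousLinearMap.proj z

lemma occupation_apply (y : ℕ) (w : Fin N → ℝ) (σ : Equiv.Perm (Fin N)) :
    occupation N y w σ = ∑ z, (if (σ z).val < y then 1 else 0) * w z := by
  simp only [occupation, ContinuousLinearMap.coe_pi', sum_apply,
    smul_apply, ContinuousLinearMap.proj_apply, smul_eq_mul]

lemma occupation_mul_tau (y : ℕ) (w : Fin N → ℝ) (σ : Equiv.Perm (Fin N)) (e : Fin (N - 1)) :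
    occupation N y w (σ * tau N e) = ∑ z, (if (σ z).val < y then 1 else 0) * w (tau N e z) := by
  rw [occupation_apply, ← Equiv.sum_comp (tau N e)]
  refine Finset.sum_congr rfl fun z _ => ?_
  rw [← Equiv.Perm.mul_apply, mul_assoc, tau_mul_self, mul_one]

/-- Linear functions of the occupied positions are mapped to linear functions: the mean of an
occupation sum evolves by the motion of one card. -/
lemma gen_occupation (y : ℕ) (w : Fin N → ℝ) :
    gen N Finset.univ (occupation N y w) = occupation N y (walk N w) := by
  funext σ
  rw [gen_apply]
  simp only [occupation_mul_tau]
  simp only [occupation_apply, walk_apply, Finset.mul_sum]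
  rw [Finset.sum_comm]
  refine Finset.sum_congr rfl fun e _ => ?_
  rw [← Finset.sum_sub_distrib]
  exact Finset.sum_congr rfl fun z _ => by ring

lemma occupation_indicator (x y : ℕ) :
    occupation N y (fun z => if z.val < x then 1 else 0) = Hf N x y := by
  funext σ
  rw [occupation_apply, Hf, ht]
  push_cast
  refine Finset.sum_congr rfl fun z _ => ?_
  split_ifs <;> simp_all

/-- The effect of one transposition is controlled by the Dirichlet form of the single card. -/
lemma sq_occupation_sub_le (y : ℕ) (w : Fin N → ℝ) (σ : Equiv.Perm (Fin N)) (e : Fin (N - 1)) :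
    (occupation N y w (σ * tau N e) - occupation N y w σ) ^ 2
      ≤ 1 / 2 * ∑ z, (w (tau N e z) - w z) ^ 2 := by
  have hne : lo e ≠ hi e := fun h => by
    have := congrArg Fin.val h
    simp [lo, hi] at this
  have h0 : ∀ z, z ≠ lo e ∧ z ≠ hi e → w (tau N e z) - w z = 0 := fun z hz => by
    rw [tau_eq, Equiv.swap_apply_of_ne_of_ne hz.1 hz.2, sub_self]
  rw [occupation_mul_tau, occupation_apply, ← Finset.sum_sub_distrib]
  simp only [← mul_sub]
  rw [Finset.sum_eq_add (lo e) (hi e) hne (fun z _ hz => by rw [h0 z hz, mul_zero]) (by simp)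
    (by simp), Finset.sum_eq_add (lo e) (hi e) hne (fun z _ hz => by rw [h0 z hz]; ring) (by simp)
    (by simp), tau_eq, Equiv.swap_apply_left, Equiv.swap_apply_right]
  split_ifs <;> nlinarith [sq_nonneg (w (hi e) - w (lo e))]

lemma dotProduct_walk (w : Fin N → ℝ) :
    w ⬝ᵥ walk N w = -(1 / 2 * ∑ e, ∑ z, (w (tau N e z) - w z) ^ 2) := by
  have h1 : ∀ e : Fin (N - 1), ∑ z, (w (tau N e z)) ^ 2 = ∑ z, w z ^ 2 := fun e =>
    Equiv.sum_comp (tau N e) fun z => w z ^ 2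
  have h2 : ∀ e : Fin (N - 1), ∑ z, w z * (w (tau N e z) - w z)
      = -(1 / 2 * ∑ z, (w (tau N e z) - w z) ^ 2) := fun e => by
    have h3 : ∑ z, (w (tau N e z) - w z) ^ 2 = ∑ z, (w (tau N e z)) ^ 2 - ∑ z, w z ^ 2
        - 2 * ∑ z, w z * (w (tau N e z) - w z) := by
      rw [Finset.mul_sum, ← Finset.sum_sub_distrib, ← Finset.sum_sub_distrib]
      exact Finset.sum_congr rfl fun z _ => by ring
    rw [h3, h1]; ring
  simp only [dotProduct, walk_apply, Finset.mul_sum]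
  rw [Finset.sum_comm, ← Finset.sum_neg_distrib]
  refine Finset.sum_congr rfl fun e _ => ?_
  rw [h2, Finset.mul_sum]

/-- The variance of a height is at most `N / 2`, from any starting state. -/
lemma Pt_sq_Hf_le {s : ℝ} (hs : 0 ≤ s) (x y : ℕ) (σ : Equiv.Perm (Fin N)) :
    Pt N Finset.univ s (fun ρ => Hf N x y ρ ^ 2) σ
      ≤ (Pt N Finset.univ s (Hf N x y) σ) ^ 2 + N / 2 := by
  set w₀ : Fin N → ℝ := fun z => if z.val < x then 1 else 0 with hw₀
  set w : ℝ → Fin N → ℝ := fun r => sg (walk N) r w₀ with hw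
  have hTw : ∀ r, occupation N y (w r) = Pt N Finset.univ r (Hf N x y) := fun r => by
    rw [hw, ← occupation_indicator]
    exact (sg_intertwine (gen N Finset.univ) (walk N) (occupation N y) (gen_occupation y) r w₀).symm
  have hdw : ∀ r, HasDerivAt w (walk N (w r)) r := fun r => hasDerivAt_sg _ _ _
  have hdT : ∀ r ρ, HasDerivAt (fun r => occupation N y (w r) ρ)
      (gen N Finset.univ (occupation N y (w r)) ρ) r := fun r ρ => by
    rw [gen_occupation]
    exact hasDerivAt_pi.1 ((occupation N y).hasFDerivAt.comp_hasDerivAt r (hdw r)) ρ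
  have hdn : ∀ r, HasDerivAt (fun r => w r ⬝ᵥ w r)
      (-∑ e, ∑ z, (w r (tau N e z) - w r z) ^ 2) r := fun r => by
    have := hasDerivAt_dotProduct (hdw r) (hdw r)
    rw [dotProduct_comm (walk N (w r)), dotProduct_walk] at this
    convert this using 1; ring
  -- A supersolution: applying the generator to the square creates the sum of squared increments,
  -- and half the energy lost by the one-card profile pays for it. The total energy is at most N.
  set v : ℝ → Equiv.Perm (Fin N) → ℝ := fun r ρ =>
    (occupation N y (w r) ρ) ^ 2 + 1 / 2 * (w₀ ⬝ᵥ w₀ - w r ⬝ᵥ w r) with hv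
  set v' : ℝ → Equiv.Perm (Fin N) → ℝ := fun r ρ =>
    2 * occupation N y (w r) ρ * gen N Finset.univ (occupation N y (w r)) ρ
      + 1 / 2 * ∑ e, ∑ z, (w r (tau N e z) - w r z) ^ 2 with hv'
  have hdv : ∀ r, HasDerivAt v (v' r) r := fun r => hasDerivAt_pi.2 fun ρ => by
    have h1 := (hdT r ρ).pow 2
    have h2 := ((hdn r).const_sub (w₀ ⬝ᵥ w₀)).const_mul (1 / 2)
    convert h1.add h2 using 1
    · rfl
    · simp only [hv', neg_neg]; push_cast; ring
  have key := sg_le_of_supersolution (gen N Finset.univ) _ (gen_pos Finset.univ) hs hdv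
    (fun r ρ => ?_) σ
  · have h0 : w 0 = w₀ := sg_zero _ _
    have hv0 : v 0 = fun ρ => Hf N x y ρ ^ 2 := by
      funext ρ
      simp only [hv, h0, sub_self, mul_zero, add_zero]
      rw [hw₀, occupation_indicator]
    have hn0 : w₀ ⬝ᵥ w₀ ≤ N := by
      calc w₀ ⬝ᵥ w₀ ≤ ∑ _z : Fin N, (1 : ℝ) := Finset.sum_le_sum fun z _ => by
            simp only [hw₀]; split_ifs <;> norm_num
        _ = N := by simp
    have hn1 : 0 ≤ w s ⬝ᵥ w s := Finset.sum_nonneg fun z _ => mul_self_nonneg _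
    rw [hv0] at key
    refine le_trans key ?_
    simp only [hv]
    rw [hTw]; linarith
  · simp only [Pi.zero_apply, Pi.sub_apply, hv', hv, gen_apply, sub_nonneg]
    rw [Finset.mul_sum, Finset.mul_sum, ← Finset.sum_add_distrib]
    refine Finset.sum_le_sum fun e _ => ?_
    have := sq_occupation_sub_le y (w r) ρ e
    linarith [this, sub_sq (occupation N y (w r) (ρ * tau N e)) (occupation N y (w r) ρ)]

/-- Chebyshev's inequality for the heights. -/
lemma Pt_mul_sq_le {s : ℝ} (hs : 0 ≤ s) (x y : ℕ) (σ : Equiv.Perm (Fin N))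
    {g : Equiv.Perm (Fin N) → ℝ} {D : ℝ}
    (hg : ∀ ρ, g ρ * D ^ 2 ≤ (Hf N x y ρ - Pt N Finset.univ s (Hf N x y) σ) ^ 2) :
    Pt N Finset.univ s g σ * D ^ 2 ≤ N / 2 := by
  set M := Pt N Finset.univ s (Hf N x y) σ with hM
  have h1 := Pt_mono (C := Finset.univ) hs (f := D ^ 2 • g)
    (g := (fun ρ => Hf N x y ρ ^ 2) - (2 * M) • Hf N x y + fun _ => M ^ 2) (fun ρ => by
      have := hg ρ
      simp only [Pi.smul_apply, Pi.add_apply, Pi.sub_apply, smul_eq_mul]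
      linarith) σ
  rw [map_add, map_sub, map_smul, map_smul, Pt_const] at h1
  simp only [Pi.smul_apply, Pi.add_apply, Pi.sub_apply, smul_eq_mul, ← hM] at h1
  have h2 := Pt_sq_Hf_le hs x y σ
  rw [← hM] at h2
  linarith

/-- The mean height under the uniform measure. -/
lemma sum_Hf (hN : 0 < N) {x y : ℕ} (hx : x ≤ N) (hy : y ≤ N) :
    ∑ σ, Hf N x y σ = N.factorial * (x * y / N : ℝ) := by
  have hcount : ∀ k ≤ N, ∑ z : Fin N, (if z.val < k then (1 : ℝ) else 0) = k := fun k hk => by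
    rw [Fin.sum_univ_eq_sum_range (fun i => if i < k then (1 : ℝ) else 0), Finset.sum_boole]
    congr 1
    rw [show (Finset.range N).filter (· < k) = Finset.range k by ext; simp; omega,
      Finset.card_range]
  set c : Fin N → ℝ := fun z => ∑ σ : Equiv.Perm (Fin N), if (σ z).val < y then 1 else 0 with hc
  -- Under the uniform measure all positions are exchangeable.
  have hcc : ∀ z z', c z = c z' := fun z z' => by
    simp only [hc]
    rw [← sum_mul_right (Equiv.swap z z') fun σ => if (σ z).val < y then (1 : ℝ) else 0]
    simp
  have hcs : ∑ z, c z = N.factorial * y := by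
    simp only [hc]
    rw [Finset.sum_comm, ← sum_const_perm]
    refine Finset.sum_congr rfl fun σ _ => ?_
    rw [← hcount y hy]
    exact Equiv.sum_comp σ fun z : Fin N => if z.val < y then (1 : ℝ) else 0
  have hcv : ∀ z, c z = N.factorial * y / N := fun z => by
    rw [Finset.sum_congr rfl fun z' _ => hcc z' z, Finset.sum_const, Finset.card_univ,
      Fintype.card_fin, nsmul_eq_mul] at hcs
    rw [eq_div_iff (by positivity), ← hcs]; ring
  have h1 : ∑ σ, Hf N x y σ = ∑ z : Fin N, (if z.val < x then (1 : ℝ) else 0) * c z := by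
    simp only [hc, Finset.mul_sum]
    rw [Finset.sum_comm]
    refine Finset.sum_congr rfl fun σ _ => ?_
    rw [← occupation_indicator, occupation_apply]
    exact Finset.sum_congr rfl fun z _ => mul_comm _ _
  rw [h1]
  simp only [hcv]
  rw [← Finset.sum_mul, hcount x hx]
  ring

/-- The variance of a height under the uniform measure. -/
lemma sum_sq_Hf_sub_le (hN : 0 < N) {x y : ℕ} (hx : x ≤ N) (hy : y ≤ N) :
    ∑ σ, (Hf N x y σ - x * y / N) ^ 2 ≤ N.factorial * (N / 2 + 1 : ℝ) := by
  set m : ℝ := x * y / N with hm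
  have hf0 := factorial_cast_pos N
  have hNr : (0 : ℝ) < N := by exact_mod_cast hN
  have hlam : 0 < lam N := by
    refine lt_of_lt_of_le ?_ (four_div_sq_le_lam hN)
    positivity
  -- Long enough for the mean height from every start to be within 1 of x y / N. The uniform
  -- variance is then at most N/2 plus the square of that error.
  set s := Real.log N / lam N with hs
  have hlog : 0 ≤ Real.log N := Real.log_nonneg (by exact_mod_cast hN)
  have hs0 : 0 ≤ s := by positivity
  have hexp : N / 2 * Real.exp (-lam N * s) ≤ 1 := by
    rw [hs, show -lam N * (Real.log N / lam N) = -Real.log N by field_simp, Real.exp_neg,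
      Real.exp_log hNr]
    field_simp; norm_num
  set g := Pt N Finset.univ s (Hf N x y) with hg
  have hgs : ∑ σ, g σ = N.factorial * m := by rw [hg, sum_Pt, sum_Hf hN hx hy]
  have hdiff : ∀ σ σ', g σ - g σ' ≤ 1 := fun σ σ' =>
    (Pt_Hf_sub_le_univ hN σ σ' hs0 x y).trans hexp
  have hg1 : ∀ σ, (g σ - m) ^ 2 ≤ 1 := fun σ => by
    have h1 := Finset.sum_le_sum fun σ' (_ : σ' ∈ Finset.univ) => hdiff σ σ'
    have h2 := Finset.sum_le_sum fun σ' (_ : σ' ∈ Finset.univ) => hdiff σ' σ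
    rw [Finset.sum_sub_distrib, hgs, sum_const_perm, sum_const_perm, ← mul_sub] at h1
    rw [Finset.sum_sub_distrib, hgs, sum_const_perm, sum_const_perm, ← mul_sub] at h2
    have h3 := le_of_mul_le_mul_left h1 hf0
    have h4 := le_of_mul_le_mul_left h2 hf0
    rw [sq_le_one_iff_abs_le_one, abs_le]
    constructor <;> linarith
  have hexpand : ∀ f : Equiv.Perm (Fin N) → ℝ, ∑ σ, f σ = N.factorial * m →
      ∑ σ, (f σ - m) ^ 2 = ∑ σ, f σ ^ 2 - N.factorial * m ^ 2 := fun f hf => by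
    have : ∑ σ, (f σ - m) ^ 2 = ∑ σ, f σ ^ 2 - 2 * m * ∑ σ, f σ + N.factorial * m ^ 2 := by
      rw [← sum_const_perm, Finset.mul_sum, ← Finset.sum_sub_distrib, ← Finset.sum_add_distrib]
      exact Finset.sum_congr rfl fun σ _ => by ring
    rw [this, hf]; ring
  have h1 := Finset.sum_le_sum fun σ (_ : σ ∈ Finset.univ) => hg1 σ
  rw [hexpand g hgs, sum_const_perm] at h1
  have h2 := Finset.sum_le_sum fun σ (_ : σ ∈ Finset.univ) => Pt_sq_Hf_le (N := N) hs0 x y σ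
  rw [sum_Pt, Finset.sum_add_distrib, sum_const_perm] at h2
  rw [hexpand _ (sum_Hf hN hx hy)]
  linarith

end Variance

/-! ### Slow relaxation of mean heights from extremal profiles -/

section MeanHeight

variable {N : ℕ}

lemma ht_eq_of_le (σ : Equiv.Perm (Fin N)) {x y : ℕ} (hx : N ≤ x) (hy : y ≤ N) : ht σ x y = y := by
  rw [ht_of_le σ hx, ← ht_of_le (1 : Equiv.Perm (Fin N)) le_rfl, ← ht_inv, inv_one]
  exact ht_one_of_le hy hy

/-- A mean height that starts away from its limit, relaxes no faster than the ground state. -/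
lemma mul_exp_mul_sinv_le (hN : 0 < N) {y : ℕ} (hy : y ≤ N) {κ a : ℝ} {σ : Equiv.Perm (Fin N)}
    (h0 : ∀ x, 0 < x → x < N → a * sinv N x ≤ κ * (ht σ x y - x * y / N)) {s : ℝ} (hs : 0 ≤ s)
    {x : ℕ} (hx : 0 < x) (hxN : x < N) :
    a * Real.exp (-lam N * s) * sinv N x
      ≤ κ * (Pt N Finset.univ s (Hf N x y) σ - x * y / N) := by
  have hNr : (N : ℝ) ≠ 0 := by positivity
  have key := heat_nonneg N
    (fun x t => κ * (Pt N Finset.univ t (Hf N x y) σ - x * y / N)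
      - a * Real.exp (-lam N * t) * sinv N x)
    (fun x t => κ * (Pt N Finset.univ t (Hf N (x - 1) y) σ + Pt N Finset.univ t (Hf N (x + 1) y) σ
        - 2 * Pt N Finset.univ t (Hf N x y) σ)
      - a * (Real.exp (-lam N * t) * -lam N) * sinv N x)
    (fun x hx hxN t => ?_) (fun x hx hxN => ?_) (fun t _ => ?_) (fun t _ => ?_)
    (fun x hx hxN t _ => Or.inr ?_) hs hx hxN
  · linarith
  · have hnd : ¬ N ∣ x := fun h => absurd (Nat.le_of_dvd hx h) (by omega)
    have h1 := hasDerivAt_Pt_Hf hx hxN hnd y σ t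
    rw [blockEdges_self] at h1
    have h2 : HasDerivAt (fun t => Real.exp (-lam N * t)) (Real.exp (-lam N * t) * -lam N) t := by
      simpa using ((hasDerivAt_id t).const_mul (-lam N)).exp
    exact ((h1.sub_const _).const_mul κ).sub ((h2.const_mul a).mul_const _)
  · have := h0 x hx hxN
    simp only [Pt, sg_zero, mul_zero, Real.exp_zero, mul_one, Hf]
    linarith
  · have := Pt_Hf_cut (N := N) (n := N) (x := 0) (Or.inr (Or.inr rfl)) y t
    rw [blockEdges_self] at this
    simp [this, Hf, sinv]
  · have := Pt_Hf_cut (N := N) (n := N) (x := N) (Or.inl dvd_rfl) y t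
    rw [blockEdges_self] at this
    rw [this, sinv_of_dvd dvd_rfl, Hf, ht_eq_of_le σ le_rfl hy]
    field_simp; simp
  · have hnd : ¬ N ∣ x := fun h => absurd (Nat.le_of_dvd hx h) (by omega)
    have h1 := sinv_laplacian hN hnd
    have h2 : a * (Real.exp (-lam N * t) * -lam N) * sinv N x
        = a * Real.exp (-lam N * t) * (sinv N (x - 1) + sinv N (x + 1) - 2 * sinv N x) := by
      rw [h1]; ring
    rw [h2]
    have h3 : ((x - 1 : ℕ) : ℝ) = x - 1 := by
      rw [Nat.cast_sub (by omega)]; simp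
    rw [h3]
    -- The equilibrium profile x y / N is linear in x, so it disappears from the discrete Laplacian.
    refine le_of_eq ?_
    push_cast
    ring

lemma sinv_le_four_mul {x : ℕ} (hxN : x < N) :
    sinv N x ≤ 4 * x / N ∧ sinv N x ≤ 4 * (N - x) / N := by
  have hNr : (0 : ℝ) < N := by exact_mod_cast (by omega : 0 < N)
  have hx : (x : ℝ) ≤ N := by exact_mod_cast hxN.le
  have hpi := Real.pi_pos
  have hpi4 := Real.pi_le_four
  rw [sinv, Nat.mod_eq_of_lt hxN]
  constructor
  · refine (Real.sin_le (by positivity)).trans ?_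
    gcongr
  · rw [← Real.sin_pi_sub, show Real.pi - Real.pi * x / N = Real.pi * (N - x) / N by field_simp]
    refine (Real.sin_le (div_nonneg (mul_nonneg hpi.le (by linarith)) hNr.le)).trans ?_
    have : 0 ≤ (N : ℝ) - x := by linarith
    gcongr

lemma half_le_sinv (hN : 4 ≤ N) : 1 / 2 ≤ sinv N (N / 2 + 1) := by
  have hNr : (4 : ℝ) ≤ N := by exact_mod_cast hN
  have h1 : (N / 2 + 1) % N = N / 2 + 1 := Nat.mod_eq_of_lt (by omega)
  have hd : (N : ℝ) ≤ 4 * (N / 2 + 1 : ℕ) := by exact_mod_cast (by omega : N ≤ 4 * (N / 2 + 1))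
  have hd' : 4 * ((N / 2 + 1 : ℕ) : ℝ) ≤ 3 * N := by
    exact_mod_cast (by omega : 4 * (N / 2 + 1) ≤ 3 * N)
  have := min_le_sinv (n := N) (x := N / 2 + 1) (d := N / 4) (by omega) (by rw [h1]; linarith)
    (by rw [h1]; linarith)
  by_contra! h
  have h2 : (N : ℝ) / 2 * sinv N (N / 2 + 1) < N / 2 * (1 / 2) := by gcongr
  linarith

/-- The maximal profile min(x, n) exceeds the chord x n / N by at least a quarter of the distance to
the nearer end, because n lies between N/2 and 3N/4; the sine is at most linear in that distance. -/
lemma sinv_le_ht_sub (hN : 4 ≤ N) {σ : Equiv.Perm (Fin N)} (hσ : HLe {N / 2 + 1} 1 σ) {x : ℕ}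
    (hxN : x < N) :
    N / 16 * sinv N x ≤ 1 * (ht σ x (N / 2 + 1) - x * (N / 2 + 1 : ℕ) / N) := by
  have hNr : (4 : ℝ) ≤ N := by exact_mod_cast hN
  have hx : (x : ℝ) ≤ N := by exact_mod_cast hxN.le
  obtain ⟨h1, h2⟩ := sinv_le_four_mul hxN
  have hn : (N : ℝ) ≤ 2 * (N / 2 + 1 : ℕ) := by exact_mod_cast (by omega : N ≤ 2 * (N / 2 + 1))
  have hn' : 4 * ((N / 2 + 1 : ℕ) : ℝ) ≤ 3 * N := by
    exact_mod_cast (by omega : 4 * (N / 2 + 1) ≤ 3 * N)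
  have hσ' := hσ x (N / 2 + 1) rfl
  generalize hk : N / 2 + 1 = n at *
  rw [one_mul]
  rcases le_total x n with h | h
  · rw [ht_one_of_le h hxN.le] at hσ'
    have h3 : (x : ℝ) ≤ ht σ x n := by exact_mod_cast hσ'
    have h4 : (x : ℝ) * n / N ≤ 3 / 4 * x := by
      rw [div_le_iff₀ (by linarith)]
      have := mul_le_mul_of_nonneg_left hn' (Nat.cast_nonneg (α := ℝ) x)
      linarith
    calc (N : ℝ) / 16 * sinv N x ≤ N / 16 * (4 * x / N) := by gcongr
      _ = x / 4 := by field_simp; norm_num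
      _ ≤ _ := by linarith
  · have h5 := (ht_one_of_le (N := N) (le_refl n) (by omega)).symm.le.trans
      ((ht_mono_left 1 h n).trans hσ')
    have h3 : (n : ℝ) ≤ ht σ x n := by exact_mod_cast h5
    have h4 : (x : ℝ) * n / N ≤ n - (N - x) / 2 := by
      rw [div_le_iff₀ (by linarith)]
      nlinarith
    calc (N : ℝ) / 16 * sinv N x ≤ N / 16 * (4 * (N - x) / N) := by gcongr
      _ = (N - x) / 4 := by field_simp; norm_num
      _ ≤ _ := by linarith

lemma ht_revPerm_le {y : ℕ} (hy : y ≤ N) (x : ℕ) :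
    ht (Fin.revPerm : Equiv.Perm (Fin N)) x y ≤ max 0 ((x : ℤ) - (N - y : ℕ)) := by
  have h0 : ht (Fin.revPerm : Equiv.Perm (Fin N)) (N - y) y = 0 :=
    Finset.sum_eq_zero fun z _ => if_neg fun h => by
      have := h.2
      rw [Fin.revPerm_apply, Fin.val_rev] at this
      omega
  rcases le_total x (N - y) with h | h
  · exact ((ht_mono_left _ h y).trans h0.le).trans (le_max_left _ _)
  · have := ht_add_le (Fin.revPerm : Equiv.Perm (Fin N)) (N - y) (x - (N - y)) y
    rw [h0, show N - y + (x - (N - y)) = x by omega] at this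
    omega

/-- The mirror estimate: the reversal keeps the small labels in the last positions, so its profile
lies below the chord by a comparable amount. -/
lemma sinv_le_sub_ht (hN : 4 ≤ N) {σ : Equiv.Perm (Fin N)} (hσ : HLe {N / 2 + 1} σ Fin.revPerm)
    {x : ℕ} (hxN : x < N) :
    N / 16 * sinv N x ≤ -1 * (ht σ x (N / 2 + 1) - x * (N / 2 + 1 : ℕ) / N) := by
  have hNr : (4 : ℝ) ≤ N := by exact_mod_cast hN
  have hx : (x : ℝ) ≤ N := by exact_mod_cast hxN.le
  obtain ⟨h1, h2⟩ := sinv_le_four_mul hxN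
  have hn : (N : ℝ) ≤ 2 * (N / 2 + 1 : ℕ) := by exact_mod_cast (by omega : N ≤ 2 * (N / 2 + 1))
  have hn' : 4 * ((N / 2 + 1 : ℕ) : ℝ) ≤ 3 * N := by
    exact_mod_cast (by omega : 4 * (N / 2 + 1) ≤ 3 * N)
  have hσ' := (hσ x (N / 2 + 1) rfl).trans (ht_revPerm_le (by omega) x)
  have hnN : N / 2 + 1 ≤ N := by omega
  generalize hk : N / 2 + 1 = n at *
  have hx0 : (0 : ℝ) ≤ x := by positivity
  rcases le_total x (N - n) with h | h
  · rw [max_eq_left (by omega)] at hσ'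
    have h3 : (ht σ x n : ℝ) ≤ 0 := by exact_mod_cast hσ'
    have h4 : (x : ℝ) / 2 ≤ x * n / N := by
      rw [le_div_iff₀ (by linarith)]
      nlinarith
    calc (N : ℝ) / 16 * sinv N x ≤ N / 16 * (4 * x / N) := by gcongr
      _ = x / 4 := by field_simp; norm_num
      _ ≤ _ := by linarith
  · have h6 : ht σ x n + N ≤ x + n := by omega
    have h3 : (ht σ x n : ℝ) + N ≤ x + n := by exact_mod_cast h6
    have h4 : (N - x : ℝ) / 4 ≤ x * n / N - (x + n - N) := by
      rw [le_sub_iff_add_le, le_div_iff₀ (by linarith)]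
      nlinarith
    calc (N : ℝ) / 16 * sinv N x ≤ N / 16 * (4 * (N - x) / N) := by gcongr
      _ = (N - x) / 4 := by field_simp; norm_num
      _ ≤ _ := by linarith

end MeanHeight

/-! ### A height splitting the uniform measure -/

section Quantile

variable {N : ℕ}

/-- Shifting the central height by r = 1 costs little, so no single value has mass above 1/6. For N
≥ 10000 the three errors are at most 1/12, 1/24 and 1/24. -/
lemma card_height_le_card_succ (hN : 10000 ≤ N) (c : ℤ) :
    ((Finset.univ.filter fun σ : Equiv.Perm (Fin N) =>
        ht σ (N / 2 + 1) (N / 2 + 1) < c + 1).card : ℝ)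
      ≤ (Finset.univ.filter fun σ : Equiv.Perm (Fin N) =>
        ht σ (N / 2 + 1) (N / 2 + 1) < c).card + N.factorial / 6 := by
  have hf0 := factorial_cast_pos N
  have hNr : (10000 : ℝ) ≤ N := by exact_mod_cast hN
  set n := N / 2 + 1 with hn
  have hcomp : ∀ b : ℤ, ((Finset.univ.filter fun σ : Equiv.Perm (Fin N) => ht σ n n < b).card : ℝ)
      = N.factorial - ∑ σ : Equiv.Perm (Fin N), if b ≤ ht σ n n then (1 : ℝ) else 0 := fun b => by
    rw [Finset.natCast_card_filter, eq_sub_iff_add_eq, ← Finset.sum_add_distrib,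
      ← mul_one (N.factorial : ℝ), ← sum_const_perm]
    refine Finset.sum_congr rfl fun σ _ => ?_
    split_ifs <;> first | omega | norm_num
  -- The box is the single point (n, n); with n = N/2 + 1 rounded down, the condition N - n ≤ n
  -- holds for both parities.
  have key := sum_shift_heights_le (N := N) (m := n) (n := n) (by omega) (by omega) (by omega) le_rfl
    (by omega) (S := {(n, n)}) (by simp)
    (F := fun σ => if c + 1 ≤ ht σ n n then 1 else 0) (G := fun σ => if c ≤ ht σ n n then 1 else 0)
    (fun σ σ' h => by
      have := h (n, n) rfl
      simp only at this
      split_ifs <;> first | omega | norm_num)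
    (fun σ => by split_ifs <;> norm_num) (fun σ => by split_ifs <;> norm_num)
    (fun σ => by split_ifs <;> norm_num) (r := 1)
    (fun σ σ' h => by
      have := h (n, n) rfl
      simp only at this
      split_ifs <;> first | omega | norm_num) rfl
  rw [hcomp, hcomp]
  set q : ℝ := ((N - n : ℕ) : ℝ) ^ 2 * n / N ^ 2 with hq
  have h1 : (N : ℝ) / 4 ≤ (N - n : ℕ) := by
    have : (N : ℝ) ≤ 4 * (N - n : ℕ) := by exact_mod_cast (by omega : N ≤ 4 * (N - n))
    linarith
  have h2 : (N : ℝ) / 2 ≤ n := by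
    have : (N : ℝ) ≤ 2 * n := by exact_mod_cast (by omega : N ≤ 2 * n)
    linarith
  have h3 : N / 32 ≤ q := by
    calc (N : ℝ) / 32 = (N / 4) ^ 2 * (N / 2) / N ^ 2 := by field_simp; norm_num
      _ ≤ q := by rw [hq]; gcongr
  have h4 : (12 : ℝ) ≤ √(q / 2) := by
    refine Real.le_sqrt_of_sq_le ?_
    linarith
  have h5 : ((1 : ℕ) : ℝ) / √(q / 2) + 4 / q + 32 / N ≤ 1 / 6 := by
    have e1 : ((1 : ℕ) : ℝ) / √(q / 2) ≤ 1 / 12 := by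
      rw [Nat.cast_one]; gcongr
    have e2 : 4 / q ≤ 1 / 24 := by
      rw [div_le_div_iff₀ (by linarith) (by norm_num)]; linarith
    have e3 : 32 / (N : ℝ) ≤ 1 / 24 := by
      rw [div_le_div_iff₀ (by linarith) (by norm_num)]; linarith
    linarith
  have := mul_le_mul_of_nonneg_left h5 hf0.le
  linarith

lemma card_mul_sq_le (hN : 4 ≤ N) {D : ℝ} {P : Equiv.Perm (Fin N) → Prop} [DecidablePred P]
    (hP : ∀ σ, P σ → D ^ 2 ≤
      (Hf N (N / 2 + 1) (N / 2 + 1) σ - (N / 2 + 1 : ℕ) * (N / 2 + 1 : ℕ) / N) ^ 2) :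
    ((Finset.univ.filter P).card : ℝ) * D ^ 2 ≤ N.factorial * (N / 2 + 1 : ℝ) := by
  refine le_trans ?_ (sum_sq_Hf_sub_le (N := N) (x := N / 2 + 1) (y := N / 2 + 1) (by omega)
    (by omega) (by omega))
  rw [Finset.natCast_card_filter, Finset.sum_mul]
  refine Finset.sum_le_sum fun σ _ => ?_
  split_ifs with h
  · rw [one_mul]; exact hP σ h
  · rw [zero_mul]; exact sq_nonneg _

/-- A level near the mean which splits the uniform measure evenly. -/
lemma exists_splitting_height (hN : 10000 ≤ N) : ∃ c : ℤ,
    (N.factorial : ℝ) / 3 ≤ (Finset.univ.filter fun σ : Equiv.Perm (Fin N) =>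
      c ≤ ht σ (N / 2 + 1) (N / 2 + 1)).card ∧
    (N.factorial : ℝ) / 3 ≤ (Finset.univ.filter fun σ : Equiv.Perm (Fin N) =>
      ¬ c ≤ ht σ (N / 2 + 1) (N / 2 + 1)).card ∧
    |(c : ℝ) - (N / 2 + 1 : ℕ) * (N / 2 + 1 : ℕ) / N| ≤ 2 * √N + 1 := by
  classical
  have hf0 := factorial_cast_pos N
  have hNr : (10000 : ℝ) ≤ N := by exact_mod_cast hN
  have hsq : √(N : ℝ) ^ 2 = N := Real.sq_sqrt (by linarith)
  have hs0 : 0 ≤ √(N : ℝ) := Real.sqrt_nonneg _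
  let Q : ℤ → ℕ := fun c => (Finset.univ.filter fun σ : Equiv.Perm (Fin N) =>
      ht σ (N / 2 + 1) (N / 2 + 1) < c).card
  have hex : ∃ k : ℕ, (N.factorial : ℝ) / 3 ≤ Q k := ⟨N + 1, by
    have : Q ((N + 1 : ℕ) : ℤ) = N.factorial := by
      simp only [Q]
      rw [Finset.filter_true_of_mem, Finset.card_univ, Fintype.card_perm, Fintype.card_fin]
      intro σ _
      have := ht_le_left σ (N / 2 + 1) (N / 2 + 1)
      omega
    rw [this]; linarith⟩
  -- The first level with a third of the mass below it. The previous level has less, and one step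
  -- adds at most 1/6, so at least half the mass lies at or above k.
  set k := Nat.find hex with hk
  have hk1 : (N.factorial : ℝ) / 3 ≤ Q k := Nat.find_spec hex
  have hk0 : k ≠ 0 := fun h => by
    have : Q k = 0 := by
      simp only [Q]
      rw [h, Finset.filter_false_of_mem, Finset.card_empty]
      intro σ _
      have := ht_nonneg σ (N / 2 + 1) (N / 2 + 1)
      omega
    rw [this] at hk1
    push_cast at hk1; linarith
  have hk2 : (Q ((k - 1 : ℕ) : ℤ) : ℝ) < N.factorial / 3 :=
    not_le.1 (Nat.find_min hex (show k - 1 < k by omega))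
  have hkk : ((k - 1 : ℕ) : ℤ) + 1 = k := by omega
  have hcomp : ∀ c : ℤ, ((Finset.univ.filter fun σ : Equiv.Perm (Fin N) =>
      c ≤ ht σ (N / 2 + 1) (N / 2 + 1)).card : ℝ) = N.factorial - Q c := fun c => by
    rw [eq_sub_iff_add_eq]
    have := Finset.card_filter_add_card_filter_not (s := Finset.univ)
      (fun σ : Equiv.Perm (Fin N) => c ≤ ht σ (N / 2 + 1) (N / 2 + 1))
    simp only [not_le, Finset.card_univ, Fintype.card_perm, Fintype.card_fin] at this
    exact_mod_cast this
  have hstep := card_height_le_card_succ hN ((k - 1 : ℕ) : ℤ)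
  rw [hkk] at hstep
  change (Q k : ℝ) ≤ Q ((k - 1 : ℕ) : ℤ) + N.factorial / 6 at hstep
  refine ⟨k, ?_, ?_, ?_⟩
  · rw [hcomp]; linarith
  · simp only [not_le]; exact hk1
  · rw [abs_le]
    constructor
    · by_contra! h
      -- Chebyshev: a third of the mass at distance 2√N would have second moment 4N/3, more than N/2
      -- + 1.
      have h1 := card_mul_sq_le (N := N) (by omega) (D := 2 * √N)
        (P := fun σ => ht σ (N / 2 + 1) (N / 2 + 1) < k) (fun σ hσ => by
          have : (ht σ (N / 2 + 1) (N / 2 + 1) : ℝ) < k := by exact_mod_cast hσ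
          have h4 := pow_le_pow_left₀ (by positivity) (show 2 * √(N : ℝ) ≤
            -(Hf N (N / 2 + 1) (N / 2 + 1) σ - (N / 2 + 1 : ℕ) * (N / 2 + 1 : ℕ) / N) by
              rw [Hf]; push_cast at h this ⊢; linarith) 2
          rwa [neg_sq] at h4)
      have h2 := mul_le_mul_of_nonneg_right hk1 (sq_nonneg (2 * √(N : ℝ)))
      have h3 := h2.trans h1
      rw [mul_pow, hsq] at h3
      nlinarith
    · by_contra! h
      have h1 := card_mul_sq_le (N := N) (by omega) (D := 2 * √N)
        (P := fun σ => ((k - 1 : ℕ) : ℤ) ≤ ht σ (N / 2 + 1) (N / 2 + 1)) (fun σ hσ => by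
          have : (k : ℝ) ≤ ht σ (N / 2 + 1) (N / 2 + 1) + 1 := by
            exact_mod_cast (by omega : (k : ℤ) ≤ ht σ (N / 2 + 1) (N / 2 + 1) + 1)
          exact pow_le_pow_left₀ (by positivity) (by rw [Hf]; push_cast at h this ⊢; linarith) 2)
      rw [hcomp] at h1
      have h2 := mul_le_mul_of_nonneg_right (show (N.factorial : ℝ) / 3 ≤
        N.factorial - Q ((k - 1 : ℕ) : ℤ) by linarith) (sq_nonneg (2 * √(N : ℝ)))
      have h3 := h2.trans h1
      rw [mul_pow, hsq] at h3
      nlinarith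

end Quantile

/-! ### Lower bound on the separation -/

section LowerBound

variable {N : ℕ}

lemma Pt_single_eq_law (t : ℝ) (σ ρ : Equiv.Perm (Fin N)) :
    Pt N Finset.univ t (Pi.single σ 1) ρ = law N t (σ⁻¹ * ρ) := by
  rw [law_eq, ← Pt_mul_left]
  have : (Pi.single σ 1 : Equiv.Perm (Fin N) → ℝ) =
      fun τ => (Pi.single 1 1 : Equiv.Perm (Fin N) → ℝ) (σ⁻¹ * τ) := by
    funext τ
    simp only [Pi.single_apply, inv_mul_eq_one]
    simp only [eq_comm]
  rw [this]

lemma one_sub_dSep_mul_sum_le (t : ℝ) {f : Equiv.Perm (Fin N) → ℝ} (hf : ∀ σ, 0 ≤ f σ)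
    (σ : Equiv.Perm (Fin N)) :
    (1 - dSep N t) * ∑ ρ, f ρ ≤ N.factorial * Pt N Finset.univ t f σ := by
  rw [Pt_eq_sum, Finset.mul_sum, Finset.mul_sum]
  refine Finset.sum_le_sum fun ρ _ => ?_
  rw [Pt_single_eq_law, ← mul_assoc]
  exact mul_le_mul_of_nonneg_right (one_sub_le_dSep N t _) (hf ρ)

/-- By symmetry the mass of the evolved f on P is the sum over starts, weighted by f, of the
probability of ending in P. -/
lemma sum_filter_Pt_le {s : ℝ} (P : Equiv.Perm (Fin N) → Prop) [DecidablePred P]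
    {f : Equiv.Perm (Fin N) → ℝ} {e : ℝ} (hf : ∀ σ, 0 ≤ f σ)
    (h : ∀ σ, f σ ≠ 0 → Pt N Finset.univ s (fun ρ => if P ρ then 1 else 0) σ ≤ e) :
    ∑ σ with P σ, Pt N Finset.univ s f σ ≤ e * ∑ σ, f σ := by
  have h1 := Pt_symm (C := Finset.univ) (t := s) (fun ρ => if P ρ then (1 : ℝ) else 0) f
  simp only [dotProduct, ite_mul, one_mul, zero_mul] at h1
  rw [Finset.sum_filter, h1, Finset.mul_sum]
  refine Finset.sum_le_sum fun σ _ => ?_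
  by_cases h0 : f σ = 0
  · rw [h0, mul_zero, mul_zero]
  · exact mul_le_mul_of_nonneg_right (h σ h0) (hf σ)

lemma sum_filter_Pt_le_sum {s : ℝ} (hs : 0 ≤ s) (P : Equiv.Perm (Fin N) → Prop) [DecidablePred P]
    {f : Equiv.Perm (Fin N) → ℝ} (hf : ∀ σ, 0 ≤ f σ) :
    ∑ σ with P σ, Pt N Finset.univ s f σ ≤ ∑ σ, f σ := by
  rw [← sum_Pt (C := Finset.univ) (t := s) f]
  exact Finset.sum_le_sum_of_subset_of_nonneg (Finset.filter_subset _ _)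
    fun σ _ _ => const_le_Pt hs hf σ

/-- If starts above `σ₁` and starts below `σ₂` stay on different sides of a splitting height until
time `s`, then the separation is still large at time `2 s`. -/
lemma one_sub_dSep_two_mul_le {s e : ℝ} (hs : 0 ≤ s) {x₀ y : ℕ} {σ₁ σ₂ : Equiv.Perm (Fin N)} {c : ℤ}
    (hB : (N.factorial : ℝ) / 3 ≤ (Finset.univ.filter fun σ : Equiv.Perm (Fin N) =>
      c ≤ ht σ x₀ y).card)
    (hB' : (N.factorial : ℝ) / 3 ≤ (Finset.univ.filter fun σ : Equiv.Perm (Fin N) =>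
      ¬ c ≤ ht σ x₀ y).card)
    (h₁ : ∀ σ, HLe {y} σ₁ σ →
      Pt N Finset.univ s (fun ρ => if ¬ c ≤ ht ρ x₀ y then 1 else 0) σ ≤ e)
    (h₂ : ∀ σ, HLe {y} σ σ₂ →
      Pt N Finset.univ s (fun ρ => if c ≤ ht ρ x₀ y then 1 else 0) σ ≤ e) :
    1 - dSep N (s + s) ≤ 6 * e := by
  classical
  set f : Equiv.Perm (Fin N) → ℝ := fun σ => if HLe {y} σ₁ σ then 1 else 0 with hf
  set g : Equiv.Perm (Fin N) → ℝ := fun σ => if HLe {y} σ σ₂ then 1 else 0 with hg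
  have hf0 : ∀ σ, 0 ≤ f σ := fun σ => by simp only [hf]; split_ifs <;> norm_num
  have hg0 : ∀ σ, 0 ≤ g σ := fun σ => by simp only [hg]; split_ifs <;> norm_num
  have hg1 : ∀ σ, g σ ≤ 1 := fun σ => by simp only [hg]; split_ifs <;> norm_num
  have hfi : Incr {y} f := fun σ σ' hl => by
    simp only [hf]
    split_ifs with h h'
    · exact le_rfl
    · exact absurd (h.trans hl) h'
    · exact zero_le_one
    · exact le_rfl
  have hgi : Incr {y} (-g) := fun σ σ' hl => by
    simp only [hg, Pi.neg_apply]
    split_ifs with h h' h'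
    · exact le_rfl
    · norm_num
    · exact absurd (hl.trans h') h
    · exact le_rfl
  have hfs : 0 < ∑ σ, f σ := Finset.sum_pos' (fun σ _ => hf0 σ)
    ⟨σ₁, Finset.mem_univ _, by simp only [hf, if_pos (HLe.refl σ₁)]; exact one_pos⟩
  have hgs : 0 < ∑ σ, g σ := Finset.sum_pos' (fun σ _ => hg0 σ)
    ⟨σ₂, Finset.mem_univ _, by simp only [hg, if_pos (HLe.refl σ₂)]; exact one_pos⟩
  have hF0 := const_le_Pt (C := Finset.univ) hs hf0
  have hG1 := Pt_le_const (C := Finset.univ) hs hg1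
  have hFi := hfi.Pt Finset.univ hs
  have hGi : Incr {y} (-Pt N Finset.univ s g) := by
    have := hgi.Pt Finset.univ hs
    rwa [map_neg] at this
  set F := Pt N Finset.univ s f with hF
  set G := Pt N Finset.univ s g with hG
  -- The transition over 2s meets in the middle: symmetry gives half of the time to each end.
  have hFG : F ⬝ᵥ G = f ⬝ᵥ Pt N Finset.univ (s + s) g := by
    rw [hF, ← Pt_symm, Pt_add]
  have hlow : (1 - dSep N (s + s)) * (∑ σ, g σ) * ∑ σ, f σ ≤ N.factorial * (F ⬝ᵥ G) := by
    have hlow' := one_sub_dSep_mul_sum_le (s + s) hg0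
    generalize (1 - dSep N (s + s)) * ∑ σ, g σ = a at hlow' ⊢
    rw [hFG, dotProduct, Finset.mul_sum, Finset.mul_sum]
    refine Finset.sum_le_sum fun σ _ => ?_
    have := mul_le_mul_of_nonneg_left (hlow' σ) (hf0 σ)
    linarith
  have hF0' : ∀ P : Equiv.Perm (Fin N) → Prop, [DecidablePred P] → 0 ≤ ∑ σ with P σ, F σ :=
    fun P _ => Finset.sum_nonneg fun σ _ => hF0 σ
  have hG0 : ∀ P : Equiv.Perm (Fin N) → Prop, [DecidablePred P] → 0 ≤ ∑ σ with P σ, G σ :=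
    fun P _ => Finset.sum_nonneg fun σ _ => const_le_Pt hs hg0 σ
  have hFG0 : ∀ P : Equiv.Perm (Fin N) → Prop, [DecidablePred P] → 0 ≤ ∑ σ with P σ, F σ * G σ :=
    fun P _ => Finset.sum_nonneg fun σ _ => mul_nonneg (hF0 σ) (const_le_Pt hs hg0 σ)
  -- On the high side negative correlation separates F from G, and G has little mass there. On the
  -- low side the roles are exchanged.
  have hup : N.factorial / 3 * ∑ σ with c ≤ ht σ x₀ y, F σ * G σ
      ≤ (∑ σ, f σ) * (e * ∑ σ, g σ) := by
    refine (mul_le_mul_of_nonneg_right hB (hFG0 _)).trans ?_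
    refine (card_mul_sum_le_of_incr (c ≤ ·) hFi hGi hF0 hG1).trans ?_
    refine mul_le_mul (sum_filter_Pt_le_sum hs _ hf0) (sum_filter_Pt_le _ hg0 fun σ hσ => ?_)
      (hG0 _) hfs.le
    refine h₂ σ (by_contra fun h => hσ ?_)
    simp only [hg, if_neg h]
  have hup' : N.factorial / 3 * ∑ σ with ¬ c ≤ ht σ x₀ y, F σ * G σ
      ≤ (e * ∑ σ, f σ) * ∑ σ, g σ := by
    refine (mul_le_mul_of_nonneg_right hB' (hFG0 _)).trans ?_
    refine (card_mul_sum_le_of_incr (¬ c ≤ ·) hFi hGi hF0 hG1).trans ?_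
    have hle := sum_filter_Pt_le (s := s) (fun σ => ¬ c ≤ ht σ x₀ y) hf0 (e := e) fun σ hσ => by
      refine h₁ σ (by_contra fun h => hσ ?_)
      simp only [hf, if_neg h]
    exact mul_le_mul hle (sum_filter_Pt_le_sum hs _ hg0) (hG0 _) ((hF0' _).trans hle)
  have hsplit : F ⬝ᵥ G = ∑ σ with c ≤ ht σ x₀ y, F σ * G σ
      + ∑ σ with ¬ c ≤ ht σ x₀ y, F σ * G σ :=
    (Finset.sum_filter_add_sum_filter_not _ _ _).symm
  rw [hsplit] at hlow
  have hfg := mul_pos hgs hfs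
  have hfin : (1 - dSep N (s + s)) * ((∑ σ, g σ) * ∑ σ, f σ)
      ≤ 6 * e * ((∑ σ, g σ) * ∑ σ, f σ) := by linarith
  exact le_of_mul_le_mul_right hfin hfg

open Filter Topology

/-- The mean heights are still separated until half of the time `N² log N / π²`. -/
lemma rpow_le_mul_exp {η : ℝ} (hN : 4 ≤ N) (hη : η ≤ 1) :
    (N : ℝ) ^ ((1 + η) / 2) / 32
      ≤ N / 16 * Real.exp (-lam N * ((1 - η) / 2 * scale N)) * sinv N (N / 2 + 1) := by
  have hNr : (4 : ℝ) ≤ N := by exact_mod_cast hN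
  have hNpos : (0 : ℝ) < N := by linarith
  have hlog : 0 ≤ Real.log N := Real.log_nonneg (by linarith)
  have hscale : 0 ≤ scale N := by rw [scale]; positivity
  have hpi := Real.pi_pos
  have h1 : lam N * ((1 - η) / 2 * scale N) ≤ (1 - η) / 2 * Real.log N := by
    refine (mul_le_mul_of_nonneg_right (lam_le N)
      (mul_nonneg (by linarith) hscale)).trans (le_of_eq ?_)
    rw [scale]; field_simp
  have h2 : (N : ℝ) ^ (-((1 - η) / 2)) ≤ Real.exp (-lam N * ((1 - η) / 2 * scale N)) := by
    rw [← exp_neg_mul_log (by omega)]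
    exact Real.exp_le_exp.2 (by linarith)
  calc (N : ℝ) ^ ((1 + η) / 2) / 32
      = N / 16 * (N : ℝ) ^ (-((1 - η) / 2)) * (1 / 2) := by
        rw [show (1 + η) / 2 = 1 + -((1 - η) / 2) by ring, Real.rpow_add hNpos, Real.rpow_one]
        ring
    _ ≤ _ := by
        have := half_le_sinv hN
        gcongr

/-- Separation is still large slightly before the time `N² log N / π²`. -/
lemma eventually_lt_dSep {η ε : ℝ} (hη : 0 < η) (hη1 : η ≤ 1) (hε : ε < 1) :
    ∀ᶠ N : ℕ in atTop, ε < dSep N ((1 - η) * scale N) := by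
  have hsmall : Tendsto (fun N : ℕ => 6 * (2048 * (N : ℝ) ^ (-η))) atTop (𝓝 0) := by
    have := (((tendsto_rpow_neg_atTop hη).comp tendsto_natCast_atTop_atTop).const_mul
      2048).const_mul 6
    simpa using this
  have hlarge : Tendsto (fun N : ℕ => (N : ℝ) ^ (η / 2)) atTop atTop :=
    (tendsto_rpow_atTop (by positivity)).comp tendsto_natCast_atTop_atTop
  filter_upwards [hsmall.eventually (gt_mem_nhds (show (0 : ℝ) < 1 - ε by linarith)),
    hlarge.eventually_ge_atTop 256, eventually_ge_atTop 10000] with N hN1 hN2 hN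
  have hNr : (10000 : ℝ) ≤ N := by exact_mod_cast hN
  have hNpos : (0 : ℝ) < N := by linarith
  have hlog : 0 ≤ Real.log N := Real.log_nonneg (by linarith)
  set s := (1 - η) / 2 * scale N with hs
  have hs0 : 0 ≤ s := by
    rw [hs, scale]
    have : 0 ≤ 1 - η := by linarith
    positivity
  obtain ⟨c, hB, hB', hc⟩ := exists_splitting_height hN
  -- Half of the remaining displacement of the mean. It dominates the distance 2√N + 1 from the
  -- splitting level to equilibrium, so reaching the wrong side still requires a deviation of D.
  set D := (N : ℝ) ^ ((1 + η) / 2) / 64 with hD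
  have hDpos : 0 < D := by rw [hD]; positivity
  have hshift : 2 * D ≤ N / 16 * Real.exp (-lam N * s) * sinv N (N / 2 + 1) := by
    have := rpow_le_mul_exp (N := N) (by omega) hη1
    rw [hD]; linarith
  have hDsq : D ^ 2 = (N : ℝ) * (N : ℝ) ^ η / 4096 := by
    rw [hD, div_pow, ← Real.rpow_natCast, ← Real.rpow_mul hNpos.le]
    rw [show (1 + η) / 2 * ((2 : ℕ) : ℝ) = 1 + η by push_cast; ring, Real.rpow_add hNpos,
      Real.rpow_one]
    norm_num
  have hsqrt : 2 * √(N : ℝ) + 1 ≤ D := by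
    have h1 : (1 : ℝ) ≤ √N := Real.one_le_sqrt.2 (by linarith)
    have h2 : D = √N * (N : ℝ) ^ (η / 2) / 64 := by
      rw [hD, Real.sqrt_eq_rpow, ← Real.rpow_add hNpos]
      ring_nf
    have h3 := mul_le_mul_of_nonneg_left hN2 (Real.sqrt_nonneg (N : ℝ))
    rw [h2]; linarith
  have hprob : ∀ p : ℝ, p * D ^ 2 ≤ N / 2 → p ≤ 2048 * (N : ℝ) ^ (-η) := fun p hp => by
    rw [← le_div_iff₀ (by positivity)] at hp
    refine hp.trans (le_of_eq ?_)
    rw [hDsq, Real.rpow_neg hNpos.le]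
    field_simp; norm_num
  obtain ⟨hc1, hc2⟩ := abs_le.1 hc
  set m : ℝ := ((N / 2 + 1 : ℕ) : ℝ) * (N / 2 + 1 : ℕ) / N with hm
  have key := one_sub_dSep_two_mul_le (N := N) (e := 2048 * (N : ℝ) ^ (-η)) hs0
    (σ₁ := 1) (σ₂ := Fin.revPerm) hB hB' (fun σ hσ => ?_) (fun σ hσ => ?_)
  · rw [show s + s = (1 - η) * scale N by rw [hs]; ring] at key
    linarith
  · have h1 := mul_exp_mul_sinv_le (N := N) (by omega) (by omega)
      (fun x _ hx => sinv_le_ht_sub (by omega) hσ hx) hs0 (x := N / 2 + 1) (by omega) (by omega)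
    refine hprob _ (Pt_mul_sq_le hs0 (N / 2 + 1) (N / 2 + 1) σ fun ρ => ?_)
    split_ifs with h
    · rw [zero_mul]; exact sq_nonneg _
    · have h2 : (ht ρ (N / 2 + 1) (N / 2 + 1) : ℝ) < c := by exact_mod_cast not_le.1 h
      rw [one_mul, ← neg_sq (_ - _)]
      refine pow_le_pow_left₀ hDpos.le ?_ 2
      rw [Hf]; linarith
  · have h1 := mul_exp_mul_sinv_le (N := N) (by omega) (by omega)
      (fun x _ hx => sinv_le_sub_ht (by omega) hσ hx) hs0 (x := N / 2 + 1) (by omega) (by omega)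
    refine hprob _ (Pt_mul_sq_le hs0 (N / 2 + 1) (N / 2 + 1) σ fun ρ => ?_)
    split_ifs with h
    · have h2 : (c : ℝ) ≤ ht ρ (N / 2 + 1) (N / 2 + 1) := by exact_mod_cast h
      rw [one_mul]
      refine pow_le_pow_left₀ hDpos.le ?_ 2
      rw [Hf]; linarith
    · rw [zero_mul]; exact sq_nonneg _

end LowerBound

/-! ### From separation bounds to the mixing time -/

section MixingTime

open Filter Topology

lemma Tsep_le {N : ℕ} {t ε : ℝ} (ht : 0 ≤ t) (h : dSep N t ≤ ε) : Tsep N ε ≤ t :=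
  csInf_le ⟨0, fun _ hs => hs.1⟩ ⟨ht, h⟩

/-- Separation is nonincreasing, so no time before s qualifies. The time t shows that the set is
nonempty; the real infimum of the empty set would be 0. -/
lemma le_Tsep {N : ℕ} {s t ε : ℝ} (ht : 0 ≤ t) (h : dSep N t ≤ ε) (hs : ε < dSep N s) :
    s ≤ Tsep N ε :=
  le_csInf ⟨t, ht, h⟩ fun r hr => by
    by_contra! hlt
    exact absurd (hs.trans_le (dSep_anti hlt.le)) (not_lt.2 hr.2)

end MixingTime

end

end ATShuffle

theorem theorem2p3 (ε : ℝ) (hε : ε ∈ Set.Ioo (0 : ℝ) 1) :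
    Filter.Tendsto
      (fun N : ℕ => Real.pi ^ 2 * ATShuffle.Tsep N ε / ((N : ℝ) ^ 2 * Real.log (N : ℝ)))
      Filter.atTop (nhds 1) := by
  rw [Metric.tendsto_atTop']
  intro δ hδ
  set η := min δ 1 / 2 with hη
  have hη0 : 0 < η := by rw [hη]; positivity
  have hηδ : η < δ := by
    have := min_le_left δ 1
    rw [hη]; linarith
  have hη1 : η ≤ 1 := by
    have := min_le_right δ 1
    rw [hη]; linarith
  obtain ⟨n, hn⟩ := Filter.eventually_atTop.1 ((ATShuffle.eventually_dSep_le hη0 hε.1).and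
    ((ATShuffle.eventually_lt_dSep hη0 hη1 hε.2).and (Filter.eventually_ge_atTop 2)))
  refine ⟨n, fun N hN => ?_⟩
  obtain ⟨h1, h2, h3⟩ := hn N hN.le
  have hNr : (2 : ℝ) ≤ N := by exact_mod_cast h3
  have hlog : 0 < Real.log N := Real.log_pos (by linarith)
  have hscale : 0 < ATShuffle.scale N := by
    have := Real.pi_pos
    rw [ATShuffle.scale]; positivity
  have ht : 0 ≤ (1 + η) * ATShuffle.scale N := by positivity
  have hup := ATShuffle.Tsep_le ht h1
  have hlo := ATShuffle.le_Tsep ht h1 h2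
  have he : Real.pi ^ 2 * ATShuffle.Tsep N ε / ((N : ℝ) ^ 2 * Real.log (N : ℝ))
      = ATShuffle.Tsep N ε / ATShuffle.scale N := by
    have := Real.pi_pos
    rw [ATShuffle.scale]; field_simp
  rw [he, Real.dist_eq, abs_lt]
  constructor
  · have := (le_div_iff₀ hscale).2 hlo
    linarith
  · have := (div_le_iff₀ hscale).2 hup
    linarith
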